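/- Let $(X_i)_{i\in\mathbb Z}$ be a strictly stationary sequence of real random variables on a probability space, with $\mathbb E(X_0)=0$ and $\|X_0\|_\infty=1$. Let $\mathcal F_0=\sigma(X_i,\ i\le 0)$ and, for integers $k\ge 0$, let $$\theta(k)=\sup\Big\|\mathbb E\Big(\prod_{i=1}^4X_{k_i}^{a_i}\,\Big|\,\mathcal F_0\Big)-\mathbb E\Big(\prod_{i=1}^4X_{k_i}^{a_i}\Big)\Big\|_1 ,$$ where the supremum is over all integers $k_4>k_3>k_2>k_1\ge k$ and all nonnegative integers $a_1,\dots,a_4$ with $a_1\ge 1$ and $a_1+a_2+a_3+a_4\le 4$. Assume that $\sum_{k\ge1}k\,\theta(k)<\infty$. Set $S_0=0$, $S_n=X_1+\cdots+X_n$ and $S_n^*=\max_{0\le k\le n}S_k$. Then the series $\mathbb E(X_0^2)+2\sum_{k\ge1}\mathbb E(X_0X_k)$ converges to a nonnegative real number $\sigma^2$. Moreover, for every real $x>0$ and every integer $n\ge1$, $$\mathbb P(S_n^*\ge x)\le c_1\mathbf 1_{\{\sigma^2>0\}}\Big(\frac{n\sigma^2}{x^2}\Big)^4\exp\Big(-\frac{x^2}{16n\sigma^2}\Big)+c_2\frac{n}{x^4}\Big(\Theta_1\Theta_2+\sum_{k\ge1}k\,(k\wedge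 x)\,\theta(k)\Big),$$ where $\Theta_1=1+\sum_{k\ge1}\theta(k)$, $\Theta_2=1+\sum_{k\ge1}k\,\theta(k)$, and $c_1,c_2>0$ are numerical constants, which depend neither on the sequence nor on $x$ and $n$. (For $\sigma^2=0$ the first term is $0$.) -/

import Mathlib

open MeasureTheory ProbabilityTheory Filter Topology
open scoped ENNReal

/-- Strict stationarity of a real process indexed by `ℤ`: every time shift of the whole process
has the same law on `ℤ → ℝ` as the process itself. -/
def IsStrictlyStationary {Ω : Type*} [MeasurableSpace Ω] (μ : Measure Ω) (X : ℤ → Ω → ℝ) : Prop :=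
  ∀ h : ℤ, IdentDistrib (fun ω (i : ℤ) => X (i + h) ω) (fun ω (i : ℤ) => X i ω) μ μ

/-- The σ-algebra `F₀ = σ(X_i, i ≤ 0)` generated by the past of the process. -/
abbrev pastSigma {Ω : Type*} (X : ℤ → Ω → ℝ) : MeasurableSpace Ω :=
  ⨆ i : ℤ, ⨆ _ : i ≤ 0, MeasurableSpace.comap (X i) inferInstance

/-- The set `Γ_{p,q}` of exponents `(a_1, …, a_p) ∈ ℕ^p` with `a_1 ≥ 1` and `∑ a_i ≤ q`.
Indices run over `Fin p`, so `a 0` is `a_1`. -/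
def exponentSet (p q : ℕ) [NeZero p] : Set (Fin p → ℕ) :=
  {a | 1 ≤ a 0 ∧ ∑ i, a i ≤ q}

/-- The product `∏ X_{k_i}^{a_i}`. -/
def powerProduct {Ω : Type*} (X : ℤ → Ω → ℝ) {p : ℕ} (κ : Fin p → ℕ) (a : Fin p → ℕ) :
    Ω → ℝ :=
  fun ω => ∏ i, X (κ i : ℤ) ω ^ a i

/-- The supremum, in `[0, ∞]`, of the `L¹` norms of
`E(∏ X_{k_i}^{a_i} | F₀) - E(∏ X_{k_i}^{a_i})` over `k ≤ k_1 < ⋯ < k_p` and `a ∈ Γ_{p,q}`. -/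
noncomputable def thetaSup {Ω : Type*} [MeasurableSpace Ω] (μ : Measure Ω) (X : ℤ → Ω → ℝ)
    (p q : ℕ) [NeZero p] (k : ℕ) : ℝ≥0∞ :=
  ⨆ (κ : Fin p → ℕ) (_ : StrictMono κ) (_ : k ≤ κ 0) (a : Fin p → ℕ) (_ : a ∈ exponentSet p q),
    eLpNorm (fun ω => (μ[powerProduct X κ a | pastSigma X]) ω - ∫ ω', powerProduct X κ a ω' ∂μ)
      1 μ

/-- The weak dependence coefficient `θ_{X,p,q}(k)` as a real number. For a process with
`|X_i| ≤ M` almost surely, the supremum is finite. -/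
noncomputable def theta {Ω : Type*} [MeasurableSpace Ω] (μ : Measure Ω) (X : ℤ → Ω → ℝ)
    (p q : ℕ) [NeZero p] (k : ℕ) : ℝ :=
  (thetaSup μ X p q k).toReal

/-- `S_n = X_1 + ⋯ + X_n`, with `S_0 = 0`. -/
def partialSum {Ω : Type*} (X : ℤ → Ω → ℝ) (n : ℕ) (ω : Ω) : ℝ :=
  ∑ i ∈ Finset.Icc 1 n, X (i : ℤ) ω

/-- `S_n^* = max_{0 ≤ k ≤ n} S_k`. -/
noncomputable def maxPartialSum {Ω : Type*} (X : ℤ → Ω → ℝ) (n : ℕ) (ω : Ω) : ℝ :=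
  (Finset.range (n + 1)).sup' Finset.nonempty_range_add_one (fun k => partialSum X k ω)

/-! The proof is a Lindeberg comparison for the test function `hinge y s ^ 4`, the fourth power of
(s - y)₊, averaged over independent Rademacher steps. Let B indicate that the sums up to time m + 1
stay below x, let L be of order x, and let k = m + 1 + (3L + 1). A fourth order expansion of E
B(g(S_k) - g(S_{k-1})) gives (σ²/2) E B g''(S_{k-1}) + κ_L E B g'''(S_{k-1}), up to a multiple of
V(L) = `depConst θ L` (`expansion_scaled`). Here κ_L = `skewCoeff` is the third cumulant truncated
at lag L. The expansion applies Taylor's formula to the increment, then again to the derivatives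
evaluated at earlier times. At each of the three levels the telescoping goes back L steps and uses
that a centred monomial in the future is nearly orthogonal to bounded functions of the past. This is
why B must be known 3L + 1 steps before time k.

The third order term is not small by itself. It is controlled by the variance: either κ_L² ≤ C σ²
V(L), or |κ_L| L ≤ C V(L) (`skewCoeff_bound`). In the second case the term is an error, because g'''
= O(L) where it matters. In the first case, with p = (s - y)₊, g'' = 12p² and g''' = 24p, the
arithmetic-geometric inequality absorbs it into (σ²/2) g'' + C V (`skewCoeff_mul_le`). The total
second order term is then at most σ² g''. Rademacher steps of size h with h² = 2σ², twice the true
variance, dominate it with no remainder, since averaging over one step adds at least (h²/2) g''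
(`rademacherIter_succ_ge`).

The dichotomy rests on scales where σ² L² ≤ 2 V(L) (`abs_skewCoeff_le_of_small_var`). For l =
1/(1000 L), the mean of 2 sin(l S) - sin(2 l S) is driven to leading order by the third cumulant,
because this function is cubic at 0. It is also bounded by 2 E(1 - cos(l S)). If |κ_L| L were much
larger than V(L), the first quantity would drift faster than the second can grow (`no_drift`). Other
scales are compared with the largest good scale below them.

For the maximum, let a process survive until it first reaches x. Exit at time m + 1 forces
S_{m+3L+1} > x - (3L + 1), where the test function is at least a constant times x⁴. Replacing the
steps one at a time therefore gives x⁴ P(S_n^* ≥ x) ≤ C (initial value + n V)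
(`mul_measureReal_maxPartialSum_le`). The initial value is a truncated fourth moment of a Rademacher
sum, bounded by Chernoff's method (`rademacherIter_hinge_four_le`). -/

set_option linter.unusedSectionVars false

/-- The σ-algebra generated by the process up to time `z`. -/
abbrev past {Ω : Type*} (X : ℤ → Ω → ℝ) (z : ℤ) : MeasurableSpace Ω :=
  ⨆ i : ℤ, ⨆ _ : i ≤ z, MeasurableSpace.comap (X i) inferInstance

/-- A strictly stationary centered process bounded by `1`. -/
structure BddStationary {Ω : Type*} [MeasurableSpace Ω] (μ : Measure Ω) (X : ℤ → Ω → ℝ) :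
    Prop where
  meas : ∀ i, Measurable (X i)
  stat : IsStrictlyStationary μ X
  mean : ∀ i, ∫ ω, X i ω ∂μ = 0
  bdd : ∀ᵐ ω ∂μ, ∀ i, |X i ω| ≤ 1

/-- Measurable and essentially bounded real functions. -/
def EssBdd {Ω : Type*} [MeasurableSpace Ω] (μ : Measure Ω) (Y : Ω → ℝ) : Prop :=
  Measurable Y ∧ ∃ C, ∀ᵐ ω ∂μ, |Y ω| ≤ C

/-! ### Essentially bounded variables -/

section EssBdd
variable {Ω : Type*} [MeasurableSpace Ω] {μ : Measure Ω} {Y Z : Ω → ℝ}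

theorem EssBdd.integrable [IsFiniteMeasure μ] (h : EssBdd μ Y) : Integrable Y μ := by
  obtain ⟨hm, C, hC⟩ := h
  exact Integrable.of_bound hm.aestronglyMeasurable C (by simpa using hC)

theorem EssBdd.const (c : ℝ) : EssBdd μ (fun _ => c) :=
  ⟨measurable_const, |c|, by simp⟩

theorem EssBdd.mul (hY : EssBdd μ Y) (hZ : EssBdd μ Z) : EssBdd μ (fun ω => Y ω * Z ω) := by
  obtain ⟨hm, C, hC⟩ := hY
  obtain ⟨hm', C', hC'⟩ := hZ
  refine ⟨hm.mul hm', C * C', ?_⟩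
  filter_upwards [hC, hC'] with ω h1 h2
  rw [abs_mul]
  exact mul_le_mul h1 h2 (abs_nonneg _) ((abs_nonneg _).trans h1)

theorem EssBdd.add (hY : EssBdd μ Y) (hZ : EssBdd μ Z) : EssBdd μ (fun ω => Y ω + Z ω) := by
  obtain ⟨hm, C, hC⟩ := hY
  obtain ⟨hm', C', hC'⟩ := hZ
  refine ⟨hm.add hm', C + C', ?_⟩
  filter_upwards [hC, hC'] with ω h1 h2
  exact (abs_add_le _ _).trans (add_le_add h1 h2)

theorem EssBdd.sub (hY : EssBdd μ Y) (hZ : EssBdd μ Z) : EssBdd μ (fun ω => Y ω - Z ω) := by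
  have := hY.add ((EssBdd.const (-1)).mul hZ)
  simpa [sub_eq_add_neg] using this

theorem EssBdd.pow (hY : EssBdd μ Y) (n : ℕ) : EssBdd μ (fun ω => Y ω ^ n) := by
  induction n with
  | zero => simpa using EssBdd.const (μ := μ) 1
  | succ n ih => simpa [pow_succ] using ih.mul hY

theorem EssBdd.sum {ι : Type*} (s : Finset ι) {Y : ι → Ω → ℝ} (h : ∀ i ∈ s, EssBdd μ (Y i)) :
    EssBdd μ (fun ω => ∑ i ∈ s, Y i ω) := by
  classical
  induction s using Finset.induction_on with
  | empty => simpa using EssBdd.const (μ := μ) 0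
  | insert a s ha ih =>
    simp only [Finset.sum_insert ha]
    exact (h a (by simp)).add (ih fun i hi => h i (by simp [hi]))

theorem EssBdd.comp_continuous (hY : EssBdd μ Y) {f : ℝ → ℝ} (hf : Continuous f) :
    EssBdd μ (fun ω => f (Y ω)) := by
  obtain ⟨hm, C, hC⟩ := hY
  obtain ⟨D, hD⟩ := (isCompact_Icc (a := -C) (b := C)).exists_bound_of_continuousOn
    hf.continuousOn
  refine ⟨hf.measurable.comp hm, D, ?_⟩
  filter_upwards [hC] with ω h
  exact hD _ (abs_le.1 h)

end EssBdd

/-! ### Covariances between the past and future monomials -/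

section Cov
variable {Ω : Type*} [mΩ : MeasurableSpace Ω] {μ : Measure Ω} [IsProbabilityMeasure μ]
  {X : ℤ → Ω → ℝ}

theorem abs_integral_le_of_ae {Y : Ω → ℝ} {C : ℝ} (h : ∀ᵐ ω ∂μ, |Y ω| ≤ C) :
    |∫ ω, Y ω ∂μ| ≤ C := by
  have := norm_integral_le_of_norm_le_const (μ := μ) (f := Y) (C := C) (by simpa using h)
  simpa using this

/-- Writing the past as the pullback of a single map lets the Doob–Dynkin factorization turn a
variable of the past into a function of coordinates, which can then be shifted in time. -/
theorem past_eq_comap (X : ℤ → Ω → ℝ) (z : ℤ) :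
    past X z = MeasurableSpace.comap (fun ω (i : Set.Iic z) => X i ω) MeasurableSpace.pi := by
  rw [MeasurableSpace.pi, MeasurableSpace.comap_iSup]
  simp only [MeasurableSpace.comap_comp]
  rw [past, iSup_subtype']
  rfl

theorem measurable_past {i z : ℤ} (h : i ≤ z) : Measurable[past X z] (X i) := by
  have h1 : MeasurableSpace.comap (X i) inferInstance ≤ past X z :=
    le_iSup₂_of_le (f := fun i (_ : i ≤ z) => MeasurableSpace.comap (X i) inferInstance) i h le_rfl
  exact Measurable.mono (comap_measurable (X i)) h1 le_rfl

theorem past_mono {z z' : ℤ} (h : z ≤ z') : past X z ≤ past X z' :=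
  iSup₂_le fun _ hi => (measurable_past (X := X) (hi.trans h)).comap_le

theorem past_le (hX : ∀ i, Measurable (X i)) (z : ℤ) : past X z ≤ mΩ :=
  iSup₂_le fun i _ => (hX i).comap_le

theorem BddStationary.essBdd (H : BddStationary μ X) (i : ℤ) : EssBdd μ (X i) :=
  ⟨H.meas i, 1, H.bdd.mono fun _ h => h i⟩

theorem BddStationary.essBdd_powerProduct (H : BddStationary μ X) {p : ℕ} (κ a : Fin p → ℕ) :
    EssBdd μ (powerProduct X κ a) := by
  refine ⟨?_, 1, ?_⟩
  · exact Finset.measurable_prod _ fun i _ => (H.meas _).pow_const _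
  · filter_upwards [H.bdd] with ω h
    rw [powerProduct, Finset.abs_prod]
    refine Finset.prod_le_one (fun _ _ => abs_nonneg _) fun i _ => ?_
    rw [abs_pow]
    exact pow_le_one₀ (abs_nonneg _) (h _)

theorem BddStationary.abs_powerProduct (H : BddStationary μ X) {p : ℕ} (κ a : Fin p → ℕ) :
    ∀ᵐ ω ∂μ, |powerProduct X κ a ω| ≤ 1 := by
  filter_upwards [H.bdd] with ω h
  rw [powerProduct, Finset.abs_prod]
  refine Finset.prod_le_one (fun _ _ => abs_nonneg _) fun i _ => ?_
  rw [abs_pow]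
  exact pow_le_one₀ (abs_nonneg _) (h _)

theorem BddStationary.thetaSup_le (H : BddStationary μ X) (p q : ℕ) [NeZero p] (k : ℕ) :
    thetaSup μ X p q k ≤ 2 := by
  refine iSup₂_le fun κ _ => iSup₂_le fun _ a => iSup_le fun _ => ?_
  have h1 : ∀ᵐ ω ∂μ, ‖(μ[powerProduct X κ a | pastSigma X]) ω -
      ∫ ω', powerProduct X κ a ω' ∂μ‖ ≤ (2 : ℝ) := by
    have h := ae_bdd_abs_condExp_of_ae_bdd_abs (m := pastSigma X) (H.abs_powerProduct κ a)
    filter_upwards [h] with ω hω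
    have := abs_integral_le_of_ae (H.abs_powerProduct κ a)
    rw [Real.norm_eq_abs]
    exact (abs_sub _ _).trans (by linarith)
  refine (eLpNorm_le_of_ae_bound h1).trans ?_
  simp

theorem theta_nonneg (p q : ℕ) [NeZero p] (k : ℕ) : 0 ≤ theta μ X p q k := ENNReal.toReal_nonneg

theorem BddStationary.theta_anti (H : BddStationary μ X) (p q : ℕ) [NeZero p] :
    Antitone (theta μ X p q) := by
  intro k l hkl
  refine ENNReal.toReal_mono (ne_top_of_le_ne_top (by simp) (H.thetaSup_le p q k)) ?_
  refine iSup₂_le fun κ hκ => iSup₂_le fun hl a => iSup_le fun ha => ?_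
  exact le_iSup₂_of_le κ hκ (le_iSup₂_of_le (hkl.trans hl) a (le_iSup_of_le ha le_rfl))

/-- Conditioning on the past replaces the monomial by its conditional expectation; the duality
between L^∞ and L¹ then brings in the norm defining θ. -/
theorem BddStationary.integral_past_zero (H : BddStationary μ X) {p q : ℕ} [NeZero p] {κ a : Fin p → ℕ}
    (hκ : StrictMono κ) (ha : a ∈ exponentSet p q) {Y : Ω → ℝ} (hY : Measurable[past X 0] Y)
    {C : ℝ} (hC : ∀ᵐ ω ∂μ, |Y ω| ≤ C) :
    |∫ ω, Y ω * powerProduct X κ a ω ∂μ - (∫ ω, Y ω ∂μ) * ∫ ω, powerProduct X κ a ω ∂μ|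
      ≤ C * theta μ X p q (κ 0) := by
  set P := powerProduct X κ a with hP
  have hm : past X 0 ≤ mΩ := past_le H.meas 0
  have hYm : Measurable Y := hY.mono hm le_rfl
  have hYb : EssBdd μ Y := ⟨hYm, C, hC⟩
  have hPb : EssBdd μ P := H.essBdd_powerProduct κ a
  have hC0 : 0 ≤ C := by
    obtain ⟨ω, h⟩ := hC.exists
    exact (abs_nonneg _).trans h
  have h1 : ∫ ω, Y ω * P ω ∂μ = ∫ ω, Y ω * (μ[P | past X 0]) ω ∂μ := by
    rw [← integral_condExp hm (f := fun ω => Y ω * P ω)]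
    exact integral_congr_ae (condExp_mul_of_stronglyMeasurable_left
      hY.stronglyMeasurable (hYb.mul hPb).integrable hPb.integrable)
  have hci : Integrable (μ[P | past X 0]) μ := integrable_condExp
  have hYci : Integrable (fun ω => Y ω * (μ[P | past X 0]) ω) μ :=
    hci.bdd_mul hYm.aestronglyMeasurable (by simpa using hC)
  have h2 : ∫ ω, Y ω * P ω ∂μ - (∫ ω, Y ω ∂μ) * ∫ ω, P ω ∂μ
      = ∫ ω, Y ω * ((μ[P | past X 0]) ω - ∫ ω', P ω' ∂μ) ∂μ := by
    rw [h1, ← integral_mul_const, ← integral_sub hYci (hYb.integrable.mul_const _)]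
    simp only [mul_sub]
  have hint : Integrable (fun ω => (μ[P | past X 0]) ω - ∫ ω', P ω' ∂μ) μ :=
    hci.sub (integrable_const _)
  have h3 : ∫ ω, |(μ[P | past X 0]) ω - ∫ ω', P ω' ∂μ| ∂μ ≤ theta μ X p q (κ 0) := by
    have h4 : eLpNorm (fun ω => (μ[P | past X 0]) ω - ∫ ω', P ω' ∂μ) 1 μ
        ≤ thetaSup μ X p q (κ 0) :=
      le_iSup₂_of_le κ hκ (le_iSup₂_of_le le_rfl a (le_iSup_of_le ha le_rfl))
    have h5 := ENNReal.toReal_mono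
      (ne_top_of_le_ne_top (by simp) (H.thetaSup_le p q (κ 0))) h4
    rw [eLpNorm_one_eq_lintegral_enorm, ← integral_norm_eq_lintegral_enorm
      hint.aestronglyMeasurable] at h5
    exact h5
  rw [h2]
  calc _ ≤ ∫ ω, |Y ω * ((μ[P | past X 0]) ω - ∫ ω', P ω' ∂μ)| ∂μ := abs_integral_le_integral_abs
    _ ≤ ∫ ω, C * |(μ[P | past X 0]) ω - ∫ ω', P ω' ∂μ| ∂μ := by
      refine integral_mono_ae ?_ (hint.abs.const_mul C) ?_
      · exact (hint.bdd_mul hYm.aestronglyMeasurable (by simpa using hC)).abs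
      · filter_upwards [hC] with ω h
        rw [abs_mul]
        exact mul_le_mul_of_nonneg_right h (abs_nonneg _)
    _ ≤ _ := by
      rw [integral_const_mul]
      exact mul_le_mul_of_nonneg_left h3 hC0

theorem IsStrictlyStationary.integral_comp (hs : IsStrictlyStationary μ X) (h : ℤ)
    {Φ : (ℤ → ℝ) → ℝ} (hΦ : Measurable Φ) :
    ∫ ω, Φ (fun i => X (i + h) ω) ∂μ = ∫ ω, Φ (fun i => X i ω) ∂μ :=
  ((hs h).comp hΦ).integral_eq

/-- Covariance of a bounded variable of the past of time `z` with a monomial in the future. -/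
theorem BddStationary.cov_le (H : BddStationary μ X) {p q : ℕ} [NeZero p] {κ a : Fin p → ℕ}
    (hκ : StrictMono κ) (ha : a ∈ exponentSet p q) (z : ℤ) {Y : Ω → ℝ}
    (hY : Measurable[past X z] Y) {C : ℝ} (hC : ∀ᵐ ω ∂μ, |Y ω| ≤ C) :
    |∫ ω, Y ω * ∏ i, X (z + κ i) ω ^ a i ∂μ
        - (∫ ω, Y ω ∂μ) * ∫ ω, ∏ i, X (z + κ i) ω ^ a i ∂μ|
      ≤ C * theta μ X p q (κ 0) := by
  rw [past_eq_comap] at hY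
  let _ : MeasurableSpace (Set.Iic z → ℝ) := MeasurableSpace.pi
  -- Doob–Dynkin: the variable is `G` of the coordinates up to time `z`. Its shift by `-z` belongs
  -- to the past of time 0, and stationarity transfers all the integrals and the essential bound.
  obtain ⟨G, hG, rfl⟩ := Measurable.exists_eq_measurable_comp hY
  set Y' : Ω → ℝ := fun ω => G (fun i : Set.Iic z => X (i + -z) ω) with hY'
  have hr : Measurable (fun w : ℤ → ℝ => fun i : Set.Iic z => w i) := by fun_prop
  have hGr : Measurable (fun w : ℤ → ℝ => G (fun i : Set.Iic z => w i)) := hG.comp hr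
  have hPm : Measurable (fun w : ℤ → ℝ => ∏ i, w (z + κ i) ^ a i) := by fun_prop
  have hm' : Measurable[past X 0] Y' := by
    refine hG.comp ?_
    rw [@measurable_pi_iff]
    intro i
    exact measurable_past (by have := i.2; simp only [Set.mem_Iic] at this; lia)
  have e1 := H.stat.integral_comp (-z) (hGr.mul hPm)
  have e2 := H.stat.integral_comp (-z) hGr
  have e3 := H.stat.integral_comp (-z) hPm
  have hC' : ∀ᵐ ω ∂μ, |Y' ω| ≤ C :=
    (H.stat (-z)).symm.ae_snd (p := fun w => |G (fun i : Set.Iic z => w i)| ≤ C)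
      (measurableSet_le (hGr.abs) measurable_const) hC
  have e4 : ∀ i, z + (κ i : ℤ) + -z = κ i := fun i => by ring
  simp only [e4, Pi.mul_apply] at e1 e3
  have := H.integral_past_zero hκ ha hm' hC'
  simp only [powerProduct] at this
  simp only [hY'] at this
  rw [e1, e2, e3] at this
  exact this

end Cov

/-! ### Near orthogonality of centred products to the past -/

section Dep
variable {Ω : Type*} [mΩ : MeasurableSpace Ω] {μ : Measure Ω} [IsProbabilityMeasure μ]
  {X : ℤ → Ω → ℝ}

/-- `W` is nearly orthogonal to the past of time `z`: `|E(Y W)| ≤ t ‖Y‖_∞` for `Y` in the past. -/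
def Dep (μ : Measure Ω) (X : ℤ → Ω → ℝ) (z : ℤ) (W : Ω → ℝ) (t : ℝ) : Prop :=
  ∀ Y : Ω → ℝ, Measurable[past X z] Y → ∀ C, (∀ᵐ ω ∂μ, |Y ω| ≤ C) → |∫ ω, Y ω * W ω ∂μ| ≤ C * t

/-- The covariance `E(X_0 X_i)`. -/
noncomputable def acov (μ : Measure Ω) (X : ℤ → Ω → ℝ) (i : ℕ) : ℝ :=
  ∫ ω, X 0 ω * X (i : ℤ) ω ∂μ

/-- The third moment `E(X_0 X_j X_{j+i})`. -/
noncomputable def thirdMoment (μ : Measure Ω) (X : ℤ → Ω → ℝ) (i j : ℕ) : ℝ :=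
  ∫ ω, X 0 ω * X (j : ℤ) ω * X (j + i : ℤ) ω ∂μ

variable {z z' : ℤ} {W : Ω → ℝ} {t t' : ℝ}

theorem nonneg_of_ae_abs_le {Y : Ω → ℝ} {C : ℝ} (h : ∀ᵐ ω ∂μ, |Y ω| ≤ C) : 0 ≤ C := by
  obtain ⟨ω, h⟩ := h.exists
  exact (abs_nonneg _).trans h

theorem Dep.mono (h : Dep μ X z W t) (hz : z' ≤ z) (ht : t ≤ t') : Dep μ X z' W t' :=
  fun Y hY C hC => (h Y (hY.mono (past_mono hz) le_rfl) C hC).trans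
    (mul_le_mul_of_nonneg_left ht (nonneg_of_ae_abs_le hC))

theorem Dep.abs_integral_le (h : Dep μ X z W t) : |∫ ω, W ω ∂μ| ≤ t := by
  have := h (fun _ => 1) measurable_const 1 (by simp)
  simpa using this

/-- A factor known at time `z` and bounded by 1 can be merged into the test variable at no cost. -/
theorem Dep.mul_left (h : Dep μ X z W t) {Z : Ω → ℝ} (hZ : Measurable[past X z] Z)
    (hZ1 : ∀ᵐ ω ∂μ, |Z ω| ≤ 1) : Dep μ X z (fun ω => Z ω * W ω) t := by
  intro Y hY C hC
  have := h (fun ω => Y ω * Z ω) (hY.mul hZ) C (by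
    filter_upwards [hC, hZ1] with ω h1 h2
    rw [abs_mul]
    nlinarith [abs_nonneg (Y ω), abs_nonneg (Z ω)])
  simpa only [mul_assoc] using this

theorem Dep.sub_const (hX : ∀ i, Measurable (X i)) (h : Dep μ X z W t) (hW : EssBdd μ W) {c s : ℝ}
    (hc : |c| ≤ s) : Dep μ X z (fun ω => W ω - c) (t + s) := by
  intro Y hY C hC
  have hYb : EssBdd μ Y := ⟨hY.mono (past_le hX z) le_rfl, C, hC⟩
  have e : ∫ ω, Y ω * (W ω - c) ∂μ = ∫ ω, Y ω * W ω ∂μ - (∫ ω, Y ω ∂μ) * c := by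
    simp only [mul_sub]
    rw [integral_sub (hYb.mul hW).integrable (hYb.integrable.mul_const _), integral_mul_const]
  rw [e]
  have h1 := h Y hY C hC
  have h2 := abs_integral_le_of_ae hC
  have hC0 := nonneg_of_ae_abs_le hC
  have h3 : |(∫ ω, Y ω ∂μ) * c| ≤ C * s := by
    rw [abs_mul]
    exact mul_le_mul h2 hc (abs_nonneg _) hC0
  calc _ ≤ _ := abs_sub _ _
    _ ≤ C * t + C * s := add_le_add h1 h3
    _ = _ := by ring

theorem Dep.sub (hX : ∀ i, Measurable (X i)) (h : Dep μ X z W t) {W' : Ω → ℝ}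
    (h' : Dep μ X z W' t')
    (hW : EssBdd μ W) (hW' : EssBdd μ W') : Dep μ X z (fun ω => W ω - W' ω) (t + t') := by
  intro Y hY C hC
  have hYb : EssBdd μ Y := ⟨hY.mono (past_le hX z) le_rfl, C, hC⟩
  simp only [mul_sub]
  rw [integral_sub (hYb.mul hW).integrable (hYb.mul hW').integrable]
  calc _ ≤ _ := abs_sub _ _
    _ ≤ C * t + C * t' := add_le_add (h Y hY C hC) (h' Y hY C hC)
    _ = _ := by ring

theorem Dep.const_mul (h : Dep μ X z W t) {c : ℝ} (hc : |c| ≤ 1) :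
    Dep μ X z (fun ω => c * W ω) t := by
  intro Y hY C hC
  have : ∫ ω, Y ω * (c * W ω) ∂μ = c * ∫ ω, Y ω * W ω ∂μ := by
    rw [← integral_const_mul]; congr 1; ext ω; ring
  rw [this, abs_mul]
  have h1 := h Y hY C hC
  nlinarith [abs_nonneg c, abs_nonneg (∫ ω, Y ω * W ω ∂μ)]

variable (H : BddStationary μ X)
include H

theorem BddStationary.dep_aux {κ a : Fin 4 → ℕ} (hκ : StrictMono κ)
    (ha : a ∈ exponentSet 4 4) {P : Ω → ℝ} {c : ℝ}
    (hP : (fun ω => ∏ i, X (z + κ i) ω ^ a i) = P) (hc : ∫ ω, P ω ∂μ = c) :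
    Dep μ X z (fun ω => P ω - c) (theta μ X 4 4 (κ 0)) := by
  intro Y hY C hC
  have hYb : EssBdd μ Y := ⟨hY.mono (past_le H.meas z) le_rfl, C, hC⟩
  have hPb : EssBdd μ P := by
    rw [← hP]
    refine ⟨?_, 1, ?_⟩
    · exact Finset.measurable_prod _ fun i _ => (H.meas _).pow_const _
    · filter_upwards [H.bdd] with ω h
      rw [Finset.abs_prod]
      refine Finset.prod_le_one (fun _ _ => abs_nonneg _) fun i _ => ?_
      rw [abs_pow]
      exact pow_le_one₀ (abs_nonneg _) (h _)
  have h := H.cov_le hκ ha z hY hC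
  have e1 : ∀ ω, ∏ i, X (z + κ i) ω ^ a i = P ω := fun ω => congrFun hP ω
  simp only [e1] at h
  have e : ∫ ω, Y ω * (P ω - c) ∂μ = ∫ ω, Y ω * P ω ∂μ - (∫ ω, Y ω ∂μ) * c := by
    simp only [mul_sub]
    rw [integral_sub (hYb.mul hPb).integrable (hYb.integrable.mul_const _), integral_mul_const]
  rw [e, ← hc]
  exact h

theorem BddStationary.integral_two (z : ℤ) (i : ℕ) :
    ∫ ω, X z ω * X (z + i) ω ∂μ = acov μ X i := by
  have := H.stat.integral_comp z (Φ := fun w => w 0 * w i) (by fun_prop)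
  simp only [zero_add] at this
  rw [acov, ← this]
  simp only [add_comm]

theorem BddStationary.integral_three (z : ℤ) (i j : ℕ) :
    ∫ ω, X z ω * X (z + j) ω * X (z + j + i) ω ∂μ = thirdMoment μ X i j := by
  have := H.stat.integral_comp z (Φ := fun w => w 0 * w j * w (j + i)) (by fun_prop)
  simp only [zero_add] at this
  rw [thirdMoment, ← this]
  rw [show (j : ℤ) + i + z = z + j + i by ring, add_comm (j : ℤ) z]

theorem BddStationary.dep_one (k : ℤ) (l : ℕ) :
    Dep μ X (k - l) (X k) (theta μ X 4 4 l) := by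
  -- The coefficient θ asks for four strictly increasing times; the superfluous ones are dummies
  -- with exponent 0.
  have := H.dep_aux (z := k - l) (κ := ![l, l + 1, l + 2, l + 3]) (a := ![1, 0, 0, 0])
    (P := X k) (c := 0) (Fin.strictMono_iff_lt_succ.2 (by intro i; fin_cases i <;> simp))
    (by simp [exponentSet, Fin.sum_univ_four])
    (by ext ω; simp [Fin.prod_univ_four]) (H.mean k)
  simpa using this

theorem BddStationary.dep_two (k : ℤ) (i l : ℕ) :
    Dep μ X (k - i - l) (fun ω => X (k - i) ω * X k ω - acov μ X i) (theta μ X 4 4 l) := by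
  have hc : ∫ ω, X (k - i) ω * X k ω ∂μ = acov μ X i := by
    have := H.integral_two (k - i) i
    simpa using this
  -- Coinciding times must be merged into a single power, because the times in θ are strictly
  -- increasing.
  rcases Nat.eq_zero_or_pos i with rfl | hi
  · refine H.dep_aux (κ := ![l, l + 1, l + 2, l + 3]) (a := ![2, 0, 0, 0])
      (Fin.strictMono_iff_lt_succ.2 (by intro i; fin_cases i <;> simp))
      (by simp [exponentSet, Fin.sum_univ_four])
      (by ext ω; simp [Fin.prod_univ_four, sq]) hc
  · refine H.dep_aux (κ := ![l, l + i, l + i + 1, l + i + 2]) (a := ![1, 1, 0, 0])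
      (Fin.strictMono_iff_lt_succ.2 (by intro i; fin_cases i <;> simp; lia))
      (by simp [exponentSet, Fin.sum_univ_four])
      (by ext ω; simp [Fin.prod_univ_four, ← add_assoc]) hc

theorem BddStationary.dep_three (k : ℤ) (i j l : ℕ) :
    Dep μ X (k - i - j - l) (fun ω => X (k - i - j) ω * X (k - i) ω * X k ω - thirdMoment μ X i j)
      (theta μ X 4 4 l) := by
  have hc : ∫ ω, X (k - i - j) ω * X (k - i) ω * X k ω ∂μ = thirdMoment μ X i j := by
    have := H.integral_three (k - i - j) i j
    simpa using this
  rcases Nat.eq_zero_or_pos i with rfl | hi <;> rcases Nat.eq_zero_or_pos j with rfl | hj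
  · refine H.dep_aux (κ := ![l, l + 1, l + 2, l + 3]) (a := ![3, 0, 0, 0])
      (Fin.strictMono_iff_lt_succ.2 (by intro i; fin_cases i <;> simp))
      (by simp [exponentSet, Fin.sum_univ_four])
      (by ext ω; simp [Fin.prod_univ_four, pow_succ]) hc
  · refine H.dep_aux (κ := ![l, l + j, l + j + 1, l + j + 2]) (a := ![1, 2, 0, 0])
      (Fin.strictMono_iff_lt_succ.2 (by intro i; fin_cases i <;> simp; lia))
      (by simp [exponentSet, Fin.sum_univ_four])
      (by ext ω; simp [Fin.prod_univ_four, pow_succ, ← add_assoc, mul_assoc]) hc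
  · refine H.dep_aux (κ := ![l, l + i, l + i + 1, l + i + 2]) (a := ![2, 1, 0, 0])
      (Fin.strictMono_iff_lt_succ.2 (by intro i; fin_cases i <;> simp; lia))
      (by simp [exponentSet, Fin.sum_univ_four])
      (by ext ω; simp [Fin.prod_univ_four, pow_succ, ← add_assoc]) hc
  · refine H.dep_aux (κ := ![l, l + j, l + j + i, l + j + i + 1]) (a := ![1, 1, 1, 0])
      (Fin.strictMono_iff_lt_succ.2 (by intro i; fin_cases i <;> simp <;> lia))
      (by simp [exponentSet, Fin.sum_univ_four])
      (by ext ω; simp [Fin.prod_univ_four, ← add_assoc]) hc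

theorem BddStationary.dep_prod (k : ℤ) (i : ℕ) :
    Dep μ X (k - i) (fun ω => X (k - i) ω * X k ω) (theta μ X 4 4 i) :=
  (H.dep_one k i).mul_left (measurable_past le_rfl) (H.bdd.mono fun _ h => h _)

theorem BddStationary.abs_acov_le (i : ℕ) : |acov μ X i| ≤ theta μ X 4 4 i := by
  have := (H.dep_prod i i).abs_integral_le
  simpa [acov] using this

theorem BddStationary.abs_acov_le_one (i : ℕ) : |acov μ X i| ≤ 1 := by
  refine abs_integral_le_of_ae ?_
  filter_upwards [H.bdd] with ω h
  rw [abs_mul]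
  exact mul_le_one₀ (h _) (abs_nonneg _) (h _)

theorem BddStationary.essBdd_two (k l : ℤ) : EssBdd μ (fun ω => X k ω * X l ω) :=
  (H.essBdd k).mul (H.essBdd l)

/-- The product can be split at either gap: before both factors (gap `l`), or between them (gap
`i`), where the covariance is itself at most θ(i). The larger gap gives the better bound, and this
is what makes the later sums over lags converge. -/
theorem BddStationary.dep_two_max (k : ℤ) {i l : ℕ} (hl : 1 ≤ l) :
    Dep μ X (k - i - l) (fun ω => X (k - i) ω * X k ω - acov μ X i)
      (2 * theta μ X 4 4 (max i l)) := by
  rcases le_total i l with h | h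
  · rw [max_eq_right h]
    exact (H.dep_two k i l).mono le_rfl (by linarith [theta_nonneg (μ := μ) (X := X) 4 4 l])
  · rw [max_eq_left h]
    exact ((H.dep_prod k i).sub_const H.meas (H.essBdd_two _ _) (H.abs_acov_le i)).mono
      (by lia) (by linarith)

/-- The centered cubic products which appear in the third order terms. -/
theorem BddStationary.dep_three_max (k : ℤ) {i j l : ℕ} (hl : 1 ≤ l) :
    Dep μ X (k - i - j - l) (fun ω => X (k - i - j) ω * (X (k - i) ω * X k ω
        - if j = 0 then 0 else acov μ X i) - thirdMoment μ X i j)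
      (4 * theta μ X 4 4 (max (max i j) l)) ∧
    (1 ≤ max i j → |thirdMoment μ X i j| ≤ 2 * theta μ X 4 4 (max i j)) := by
  have hb : EssBdd μ (fun ω => X (k - i) ω * X k ω - if j = 0 then 0 else acov μ X i) :=
    (H.essBdd_two _ _).sub (EssBdd.const _)
  have hbP := (H.essBdd (k - i - j)).mul hb
  have hint : ∫ ω, X (k - i - j) ω * (X (k - i) ω * X k ω
      - if j = 0 then 0 else acov μ X i) ∂μ = thirdMoment μ X i j := by
    simp only [mul_sub]
    rw [integral_sub ((H.essBdd _).mul (H.essBdd_two _ _)).integrable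
      ((H.essBdd _).integrable.mul_const _), integral_mul_const, H.mean, zero_mul, sub_zero,
      ← H.integral_three (k - i - j) i j]
    congr 1; ext ω; rw [← mul_assoc]; simp
  -- Three gaps are available for splitting: `hi` splits before the last factor, `hj` after the
  -- first, and the final case distinction splits before the whole product when `l` is the largest
  -- gap. The `if` reflects the two origins of the cubic terms: for j = 0 they come uncentred from
  -- Taylor's formula, for j ≥ 1 from a product already centred by its covariance.
  have hX1 : ∀ z, ∀ᵐ ω ∂μ, |X z ω| ≤ 1 := fun z => H.bdd.mono fun _ h => h _
  have hi : 1 ≤ i → Dep μ X (k - i - j) (fun ω => X (k - i - j) ω * (X (k - i) ω * X k ω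
      - if j = 0 then 0 else acov μ X i)) (2 * theta μ X 4 4 i) := by
    intro _
    refine Dep.mul_left ?_ (measurable_past le_rfl) (hX1 _)
    refine ((H.dep_prod k i).sub_const H.meas (H.essBdd_two _ _) (s := theta μ X 4 4 i) ?_).mono
      (by lia) (by linarith)
    split_ifs
    · simpa using theta_nonneg 4 4 i
    · exact H.abs_acov_le i
  have hj : 1 ≤ j → Dep μ X (k - i - j) (fun ω => X (k - i - j) ω * (X (k - i) ω * X k ω
      - if j = 0 then 0 else acov μ X i)) (theta μ X 4 4 j) := by
    intro h
    refine Dep.mul_left ?_ (measurable_past le_rfl) (hX1 _)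
    rw [if_neg (by lia)]
    exact H.dep_two k i j
  have hm : 1 ≤ max i j → Dep μ X (k - i - j) (fun ω => X (k - i - j) ω * (X (k - i) ω * X k ω
      - if j = 0 then 0 else acov μ X i)) (2 * theta μ X 4 4 (max i j)) := by
    intro h
    rcases le_total i j with h' | h'
    · rw [max_eq_right h'] at h ⊢
      exact (hj h).mono le_rfl (by linarith [theta_nonneg (μ := μ) (X := X) 4 4 j])
    · rw [max_eq_left h'] at h ⊢
      exact hi h
  have hβ : 1 ≤ max i j → |thirdMoment μ X i j| ≤ 2 * theta μ X 4 4 (max i j) := by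
    intro h
    have := (hm h).abs_integral_le
    rwa [hint] at this
  refine ⟨?_, hβ⟩
  rcases le_total (max i j) l with h | h
  · rw [max_eq_right h]
    have h1 := H.dep_three k i j l
    have h2 : Dep μ X (k - i - j - l) (fun ω => (if j = 0 then 0 else acov μ X i) *
        X (k - i - j) ω) (theta μ X 4 4 l) := by
      refine (H.dep_one (k - i - j) l).const_mul ?_
      split_ifs
      · simp
      · exact H.abs_acov_le_one i
    have h3 := h1.sub H.meas h2
      ((((H.essBdd _).mul (H.essBdd _)).mul (H.essBdd _)).sub (EssBdd.const _))
      ((EssBdd.const _).mul (H.essBdd _))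
    refine Dep.mono ?_ le_rfl (?_ : theta μ X 4 4 l + theta μ X 4 4 l ≤ _)
    · convert h3 using 2; ring
    · linarith [theta_nonneg (μ := μ) (X := X) 4 4 l]
  · rw [max_eq_left h]
    refine ((hm (hl.trans h)).sub_const H.meas hbP (hβ (hl.trans h))).mono (by lia) (by linarith)

end Dep

/-! ### Sums of a function of the largest lag -/

theorem sum_sum_max (f : ℕ → ℝ) (n : ℕ) :
    ∑ i ∈ Finset.range n, ∑ j ∈ Finset.range n, f (max i j)
      = ∑ k ∈ Finset.range n, (2 * k + 1) * f k := by
  induction n with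
  | zero => simp
  | succ n ih =>
    have h1 : ∑ i ∈ Finset.range n, f (max i n) = n * f n := by
      rw [Finset.sum_congr rfl fun i hi => by
        rw [max_eq_right (Finset.mem_range.1 hi).le]]
      simp
    have h2 : ∑ i ∈ Finset.range n, f (max n i) = n * f n := by
      simpa only [max_comm] using h1
    simp only [Finset.sum_range_succ, Finset.sum_add_distrib, ih, h1, h2, max_self]
    ring

/-- There are (k + 1)³ - k³ triples with maximum k. Triple sums over lags therefore cost only k² per
value of θ(k). -/
theorem sum_sum_sum_max (f : ℕ → ℝ) (n : ℕ) :
    ∑ i ∈ Finset.range n, ∑ j ∈ Finset.range n, ∑ l ∈ Finset.range n, f (max (max i j) l)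
      = ∑ k ∈ Finset.range n, (3 * k ^ 2 + 3 * k + 1) * f k := by
  induction n with
  | zero => simp
  | succ n ih =>
    have h0 : ∀ i ∈ Finset.range n, max i n = n := fun i hi =>
      max_eq_right (Finset.mem_range.1 hi).le
    have h0' : ∀ i ∈ Finset.range n, max n i = n := fun i hi =>
      max_eq_left (Finset.mem_range.1 hi).le
    have s1 : ∀ g : ℕ → ℝ, ∑ i ∈ Finset.range n, g (max i n) = n * g n := fun g => by
      rw [Finset.sum_congr rfl fun i hi => by rw [h0 i hi]]; simp
    have s2 : ∀ g : ℕ → ℝ, ∑ i ∈ Finset.range n, g (max n i) = n * g n := fun g => by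
      rw [Finset.sum_congr rfl fun i hi => by rw [h0' i hi]]; simp
    have e1 : ∑ i ∈ Finset.range n, ∑ j ∈ Finset.range n, f (max (max i j) n) = n * (n * f n) := by
      have : ∀ i ∈ Finset.range n, ∑ j ∈ Finset.range n, f (max (max i j) n) = n * f n := by
        intro i hi
        rw [Finset.sum_congr rfl fun j hj => by
          rw [max_eq_right (max_le (Finset.mem_range.1 hi).le (Finset.mem_range.1 hj).le)]]
        simp
      rw [Finset.sum_congr rfl this]; simp
    have e2 : ∑ i ∈ Finset.range n, ∑ l ∈ Finset.range n, f (max (max i n) l) = n * (n * f n) := by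
      rw [s1 fun m => ∑ l ∈ Finset.range n, f (max m l), s2]
    have e3 : ∑ i ∈ Finset.range n, ∑ l ∈ Finset.range n, f (max (max n i) l) = n * (n * f n) := by
      rw [s2 fun m => ∑ l ∈ Finset.range n, f (max m l), s2]
    have e4 : ∑ i ∈ Finset.range n, f (max (max i n) n) = n * f n := by
      rw [s1 fun m => f (max m n), max_self]
    have e5 : ∑ i ∈ Finset.range n, f (max (max n i) n) = n * f n := by
      rw [s2 fun m => f (max m n), max_self]
    simp only [Finset.sum_range_succ, Finset.sum_add_distrib, ih, e1, e2, e3, e4, e5, max_self, s2]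
    ring

theorem mul_le_of_abs_le_one {a b K : ℝ} (ha : |a| ≤ 1) (hb : |b| ≤ K) : |a * b| ≤ K := by
  rw [abs_mul]
  nlinarith [abs_nonneg a, abs_nonneg b]

theorem abs_weighted_sum_le {ι : Type*} {s : Finset ι} {w a e : ι → ℝ} (hw : ∀ i, 0 ≤ w i)
    (hw1 : ∀ i, w i ≤ 1) (h : ∀ i ∈ s, |a i| ≤ e i) : |∑ i ∈ s, w i * a i| ≤ ∑ i ∈ s, e i :=
  (Finset.abs_sum_le_sum_abs _ _).trans (Finset.sum_le_sum fun i hi =>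
    mul_le_of_abs_le_one (abs_le.2 ⟨by linarith [hw i], hw1 i⟩) (h i hi))

/-! ### Fourth order expansion of one increment -/

section Core
variable {Ω : Type*} [mΩ : MeasurableSpace Ω] {μ : Measure Ω} [IsProbabilityMeasure μ]
  {X : ℤ → Ω → ℝ}

/-- Telescoping of `f(S_{z-1})` down to time `z - L - 1` against a weakly dependent factor. -/
theorem telescope_bound {z : ℤ} {L : ℕ} {B W : Ω → ℝ}
    {G : ℤ → Ω → ℝ} {D : ℕ → Ω → ℝ} {t : ℕ → ℝ} {K K' : ℝ}
    (hB : Measurable[past X (z - (L + 1 : ℕ))] B) (hBb : EssBdd μ B)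
    (hG : ∀ z, Measurable[past X z] (G z)) (hGb : ∀ z, EssBdd μ (G z))
    (hD : ∀ l, Measurable[past X (z - (l + 1 : ℕ))] (D l)) (hDb : ∀ l, EssBdd μ (D l))
    (hW : EssBdd μ W) (hdep : ∀ l, l ≤ L → Dep μ X (z - (l + 1 : ℕ)) W (t l))
    (hK : ∀ l < L, ∀ᵐ ω ∂μ, |B ω * (G (z - (l + 1 : ℕ)) ω - G (z - (l + 1 : ℕ) - 1) ω - D l ω)| ≤ K)
    (hK' : ∀ᵐ ω ∂μ, |B ω * G (z - (L + 1 : ℕ)) ω| ≤ K') :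
    |∫ ω, B ω * G (z - 1) ω * W ω ∂μ - ∑ l ∈ Finset.range L, ∫ ω, B ω * D l ω * W ω ∂μ|
      ≤ K * ∑ l ∈ Finset.range L, t l + K' * t L := by
  have key : ∫ ω, B ω * G (z - 1) ω * W ω ∂μ - ∑ l ∈ Finset.range L, ∫ ω, B ω * D l ω * W ω ∂μ
      = ∑ l ∈ Finset.range L, ∫ ω, B ω * (G (z - (l + 1 : ℕ)) ω - G (z - (l + 1 : ℕ) - 1) ω - D l ω)
          * W ω ∂μ + ∫ ω, B ω * G (z - (L + 1 : ℕ)) ω * W ω ∂μ := by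
    have hR : ∀ l, EssBdd μ (fun ω => B ω * (G (z - (l + 1 : ℕ)) ω - G (z - (l + 1 : ℕ) - 1) ω
        - D l ω) * W ω) := fun l => (hBb.mul (((hGb _).sub (hGb _)).sub (hDb l))).mul hW
    have hR' : ∀ l, EssBdd μ (fun ω => B ω * D l ω * W ω) := fun l => (hBb.mul (hDb l)).mul hW
    rw [← integral_finsetSum _ fun l _ => (hR' l).integrable,
      ← integral_finsetSum _ fun l _ => (hR l).integrable, ← integral_sub
        ((hBb.mul (hGb _)).mul hW).integrable (EssBdd.sum _ fun l _ => hR' l).integrable,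
      ← integral_add (EssBdd.sum _ fun l _ => hR l).integrable
        ((hBb.mul (hGb _)).mul hW).integrable]
    congr 1; ext ω
    have h := Finset.sum_range_sub' (fun l : ℕ => G (z - (l + 1 : ℕ)) ω) L
    have h' : ∑ l ∈ Finset.range L, (G (z - (l + 1 : ℕ)) ω - G (z - (l + 1 : ℕ) - 1) ω)
        = G (z - 1) ω - G (z - (L + 1 : ℕ)) ω := by
      rw [show z - 1 = z - (0 + 1 : ℕ) by simp, ← h]
      refine Finset.sum_congr rfl fun l _ => ?_
      congr 2; push_cast; ring
    have h'' : ∑ l ∈ Finset.range L, B ω * (G (z - (l + 1 : ℕ)) ω - G (z - (l + 1 : ℕ) - 1) ω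
        - D l ω) * W ω = B ω * W ω * (G (z - 1) ω - G (z - (L + 1 : ℕ)) ω)
          - ∑ l ∈ Finset.range L, B ω * D l ω * W ω := by
      rw [← h', Finset.mul_sum, ← Finset.sum_sub_distrib]
      exact Finset.sum_congr rfl fun l _ => by ring
    rw [h'']; ring
  rw [key, Finset.mul_sum]
  refine (abs_add_le _ _).trans (add_le_add ((Finset.abs_sum_le_sum_abs _ _).trans
    (Finset.sum_le_sum fun l hl => ?_)) ?_)
  -- Once the main part `D l` is removed, the increment of `G` at lag l + 1 is a test variable
  -- bounded by `K`, known l + 1 steps before `z`.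
  · have hl' := Finset.mem_range.1 hl
    refine hdep l hl'.le _ ?_ K (hK l hl')
    exact (hB.mono (past_mono (by lia)) le_rfl).mul
      ((((hG _).sub ((hG _).mono (past_mono (by lia)) le_rfl))).sub (hD l))
  · exact hdep L le_rfl _ (hB.mul (hG _)) K' hK'

/-- A process with increments `X` after time `z₀`, adapted to the past. -/
structure AdaptedWalk (μ : Measure Ω) (X S : ℤ → Ω → ℝ) (z₀ : ℤ) : Prop where
  meas : ∀ z, Measurable[past X z] (S z)
  step : ∀ z, z₀ < z → ∀ ω, S z ω = S (z - 1) ω + X z ω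
  essBdd : ∀ z, EssBdd μ (S z)

/-- A function with three formal derivatives satisfying Taylor estimates up to a fourth order
remainder `K`. -/
structure TaylorJet (g0 g1 g2 g3 : ℝ → ℝ) (K : ℝ) : Prop where
  cont0 : Continuous g0
  cont1 : Continuous g1
  cont2 : Continuous g2
  cont3 : Continuous g3
  rem0 : ∀ s d, |d| ≤ 1 → |g0 (s + d) - g0 s - (g1 s * d + g2 s * d ^ 2 / 2 + g3 s * d ^ 3 / 6)| ≤ K
  rem1 : ∀ s d, |d| ≤ 1 → |g1 (s + d) - g1 s - (g2 s * d + g3 s * d ^ 2 / 2)| ≤ K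
  rem2 : ∀ s d, |d| ≤ 1 → |g2 (s + d) - g2 s - g3 s * d| ≤ K
  rem3 : ∀ s d, |d| ≤ 1 → |g3 (s + d) - g3 s| ≤ K

/-- Weight of the second order term of lag `i`. -/
noncomputable def lagWeight (i : ℕ) : ℝ := if i = 0 then 1 / 2 else 1

/-- Weight of the third order term of lags `i`, `j`. -/
noncomputable def lagWeight₂ (i j : ℕ) : ℝ :=
  if j = 0 then (if i = 0 then 1 / 6 else 1 / 2) else lagWeight i

/-- Truncated third cumulant. -/
noncomputable def skewCoeff (μ : Measure Ω) (X : ℤ → Ω → ℝ) (L : ℕ) : ℝ :=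
  ∑ i ∈ Finset.range (L + 1), ∑ j ∈ Finset.range (L + 1), lagWeight₂ i j * thirdMoment μ X i j

theorem lagWeight_nonneg (i : ℕ) : 0 ≤ lagWeight i := by unfold lagWeight; split_ifs <;> norm_num
theorem lagWeight_le (i : ℕ) : lagWeight i ≤ 1 := by unfold lagWeight; split_ifs <;> norm_num
theorem lagWeight₂_nonneg (i j : ℕ) : 0 ≤ lagWeight₂ i j := by
  unfold lagWeight₂ lagWeight; split_ifs <;> norm_num
theorem lagWeight₂_le (i j : ℕ) : lagWeight₂ i j ≤ 1 := by
  unfold lagWeight₂ lagWeight; split_ifs <;> norm_num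

section Expansion
variable {S : ℤ → Ω → ℝ} {k : ℤ} {L : ℕ} {B : Ω → ℝ} {g0 g1 g2 g3 : ℝ → ℝ} {K1 K2 K3 K4 : ℝ}
  (H : BddStationary μ X) (hS : AdaptedWalk μ X S (k - 3 * L - 1))
  (hB : Measurable[past X (k - 3 * L - 1)] B) (hB1 : ∀ ω, |B ω| ≤ 1)
  (hg : TaylorJet g0 g1 g2 g3 K4)
include H hS hB hB1 hg

theorem expansion_zero :
    |∫ ω, B ω * (g0 (S k ω) - g0 (S (k - 1) ω)) ∂μ
      - (∫ ω, B ω * g1 (S (k - 1) ω) * X k ω ∂μ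
        + (1 / 2) * ∫ ω, B ω * g2 (S (k - 1) ω) * (X k ω * X k ω) ∂μ
        + (1 / 6) * ∫ ω, B ω * g3 (S (k - 1) ω) * (X k ω * (X k ω * X k ω)) ∂μ)| ≤ K4 := by
  have hBb : EssBdd μ B := ⟨hB.mono (past_le H.meas _) le_rfl, 1, Eventually.of_forall hB1⟩
  have b0 := fun z => (hS.essBdd z).comp_continuous hg.cont0
  have b1 := (hS.essBdd (k - 1)).comp_continuous hg.cont1
  have b2 := (hS.essBdd (k - 1)).comp_continuous hg.cont2
  have b3 := (hS.essBdd (k - 1)).comp_continuous hg.cont3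
  have bX := H.essBdd k
  have i1 := (hBb.mul b1).mul bX
  have i2 := (EssBdd.const (μ := μ) (1 / 2)).mul ((hBb.mul b2).mul (bX.mul bX))
  have i3 := (EssBdd.const (μ := μ) (1 / 6)).mul ((hBb.mul b3).mul (bX.mul (bX.mul bX)))
  rw [← integral_const_mul, ← integral_const_mul, ← integral_add i1.integrable i2.integrable,
    ← integral_add (i1.add i2).integrable i3.integrable, ← integral_sub
      (hBb.mul ((b0 k).sub (b0 (k - 1)))).integrable ((i1.add i2).add i3).integrable]
  refine abs_integral_le_of_ae ?_
  filter_upwards [H.bdd] with ω hω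
  have := hg.rem0 (S (k - 1) ω) (X k ω) (hω k)
  rw [← hS.step k (by lia)] at this
  convert mul_le_of_abs_le_one (hB1 ω) this using 2
  ring

/-- Since X_k is nearly orthogonal to the past, g'(S_{k-1}) matters only through its increments over
the last L steps; their Taylor expansion produces the products of lag i + 1. -/
theorem expansion_one (hK1 : ∀ z ≤ k, ∀ᵐ ω ∂μ, |B ω * g1 (S z ω)| ≤ K1) :
    |∫ ω, B ω * g1 (S (k - 1) ω) * X k ω ∂μ
      - ∑ i ∈ Finset.range L, (∫ ω, B ω * g2 (S (k - (i + 1 : ℕ) - 1) ω) *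
            (X (k - (i + 1 : ℕ)) ω * X k ω) ∂μ
        + (1 / 2) * ∫ ω, B ω * g3 (S (k - (i + 1 : ℕ) - 1) ω) *
            (X (k - (i + 1 : ℕ)) ω * (X (k - (i + 1 : ℕ)) ω * X k ω)) ∂μ)|
      ≤ K4 * ∑ l ∈ Finset.range L, theta μ X 4 4 (l + 1) + K1 * theta μ X 4 4 (L + 1) := by
  have hBb : EssBdd μ B := ⟨hB.mono (past_le H.meas _) le_rfl, 1, Eventually.of_forall hB1⟩
  have b2 := fun z => (hS.essBdd z).comp_continuous hg.cont2
  have b3 := fun z => (hS.essBdd z).comp_continuous hg.cont3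
  have bX := H.essBdd
  have h := telescope_bound (μ := μ) (z := k) (L := L) (B := B) (W := X k)
    (G := fun z ω => g1 (S z ω))
    (D := fun i ω => g2 (S (k - (i + 1 : ℕ) - 1) ω) * X (k - (i + 1 : ℕ)) ω
      + g3 (S (k - (i + 1 : ℕ) - 1) ω) * X (k - (i + 1 : ℕ)) ω ^ 2 / 2)
    (t := fun l => theta μ X 4 4 (l + 1)) (K := K4) (K' := K1)
    (hB.mono (past_mono (by push_cast; lia)) le_rfl) hBb
    (fun z => hg.cont1.measurable.comp (hS.meas z))
    (fun z => (hS.essBdd z).comp_continuous hg.cont1)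
    (fun l => by
      have m := fun z (hz : z ≤ k - (l + 1 : ℕ)) => (hS.meas z).mono (past_mono hz) le_rfl
      refine Measurable.add ?_ ?_
      · exact (hg.cont2.measurable.comp (m _ (by lia))).mul (measurable_past le_rfl)
      · exact ((hg.cont3.measurable.comp (m _ (by lia))).mul
          ((measurable_past le_rfl).pow_const 2)).div_const 2)
    (fun l => by
      have := ((b2 (k - (l + 1 : ℕ) - 1)).mul (bX (k - (l + 1 : ℕ)))).add
        ((EssBdd.const (1 / 2)).mul ((b3 (k - (l + 1 : ℕ) - 1)).mul ((bX (k - (l + 1 : ℕ))).pow 2)))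
      convert this using 3
      ring)
    (bX k)
    (fun l _ => H.dep_one k (l + 1))
    (fun l hl => by
      filter_upwards [H.bdd] with ω hω
      refine mul_le_of_abs_le_one (hB1 ω) ?_
      have := hg.rem1 (S (k - (l + 1 : ℕ) - 1) ω) _ (hω (k - (l + 1 : ℕ)))
      rwa [← hS.step (k - (l + 1 : ℕ)) (by push_cast; lia)] at this)
    (hK1 _ (by lia))
  refine le_trans (le_of_eq ?_) h
  congr 2
  refine Finset.sum_congr rfl fun i _ => ?_
  have i2 := (hBb.mul (b2 (k - (i + 1 : ℕ) - 1))).mul ((bX (k - (i + 1 : ℕ))).mul (bX k))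
  have i3 := (EssBdd.const (μ := μ) (1 / 2)).mul ((hBb.mul (b3 (k - (i + 1 : ℕ) - 1))).mul
    ((bX (k - (i + 1 : ℕ))).mul ((bX (k - (i + 1 : ℕ))).mul (bX k))))
  rw [← integral_const_mul, ← integral_add i2.integrable i3.integrable]
  congr 1; ext ω; ring

/-- Same mechanism one order higher: the centred product of lag `i` plays the role of X_k, and the
increments of g'' produce the cubic terms with j ≥ 1. -/
theorem expansion_two (hK2 : ∀ z ≤ k, ∀ᵐ ω ∂μ, |B ω * g2 (S z ω)| ≤ K2) {i : ℕ} (hi : i ≤ L) :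
    |∫ ω, B ω * g2 (S (k - i - 1) ω) * (X (k - i) ω * X k ω) ∂μ
      - acov μ X i * ∫ ω, B ω * g2 (S (k - i - 1) ω) ∂μ
      - ∑ j ∈ Finset.range L, ∫ ω, B ω * g3 (S (k - i - (j + 1 : ℕ) - 1) ω) *
            (X (k - i - (j + 1 : ℕ)) ω * (X (k - i) ω * X k ω - acov μ X i)) ∂μ|
      ≤ K4 * ∑ l ∈ Finset.range L, 2 * theta μ X 4 4 (max i (l + 1))
        + K2 * (2 * theta μ X 4 4 (L + 1)) := by
  have hBb : EssBdd μ B := ⟨hB.mono (past_le H.meas _) le_rfl, 1, Eventually.of_forall hB1⟩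
  have b2 := fun z => (hS.essBdd z).comp_continuous hg.cont2
  have b3 := fun z => (hS.essBdd z).comp_continuous hg.cont3
  have bX := H.essBdd
  have bW : EssBdd μ (fun ω => X (k - i) ω * X k ω - acov μ X i) :=
    (H.essBdd_two _ _).sub (EssBdd.const _)
  have h := telescope_bound (μ := μ) (z := k - i) (L := L) (B := B)
    (W := fun ω => X (k - i) ω * X k ω - acov μ X i)
    (G := fun z ω => g2 (S z ω))
    (D := fun j ω => g3 (S (k - i - (j + 1 : ℕ) - 1) ω) * X (k - i - (j + 1 : ℕ)) ω)
    (t := fun l => 2 * theta μ X 4 4 (max i (l + 1))) (K := K4) (K' := K2)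
    (hB.mono (past_mono (by push_cast; lia)) le_rfl) hBb
    (fun z => hg.cont2.measurable.comp (hS.meas z)) b2
    (fun l => (hg.cont3.measurable.comp ((hS.meas _).mono (past_mono (by lia)) le_rfl)).mul
      (measurable_past le_rfl))
    (fun l => (b3 _).mul (bX _)) bW
    (fun l _ => H.dep_two_max k (by lia))
    (fun l hl => by
      filter_upwards [H.bdd] with ω hω
      refine mul_le_of_abs_le_one (hB1 ω) ?_
      have := hg.rem2 (S (k - i - (l + 1 : ℕ) - 1) ω) _ (hω (k - i - (l + 1 : ℕ)))
      rwa [← hS.step (k - i - (l + 1 : ℕ)) (by push_cast; lia)] at this)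
    (hK2 _ (by lia))
  rw [max_eq_right (by lia)] at h
  refine le_trans (le_of_eq ?_) h
  congr 1
  have e : ∫ ω, B ω * g2 (S (k - i - 1) ω) * (X (k - i) ω * X k ω - acov μ X i) ∂μ
      = ∫ ω, B ω * g2 (S (k - i - 1) ω) * (X (k - i) ω * X k ω) ∂μ
        - acov μ X i * ∫ ω, B ω * g2 (S (k - i - 1) ω) ∂μ := by
    rw [← integral_const_mul, ← integral_sub
      ((hBb.mul (b2 _)).mul (H.essBdd_two _ _)).integrable
      ((EssBdd.const _).mul (hBb.mul (b2 _))).integrable]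
    congr 1; ext ω; ring
  rw [e]
  congr 1
  refine Finset.sum_congr rfl fun j _ => ?_
  congr 1; ext ω; ring

/-- The last level: there is no main part left to extract (`D` is 0), as increments of g''' are
already of the size of the remainder. -/
theorem expansion_three (hK3 : ∀ z ≤ k, ∀ᵐ ω ∂μ, |B ω * g3 (S z ω)| ≤ K3) {i j : ℕ}
    (hi : i ≤ L) (hj : j ≤ L) :
    |∫ ω, B ω * g3 (S (k - i - j - 1) ω) *
            (X (k - i - j) ω * (X (k - i) ω * X k ω - if j = 0 then 0 else acov μ X i)) ∂μ
      - thirdMoment μ X i j * ∫ ω, B ω * g3 (S (k - i - j - 1) ω) ∂μ|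
      ≤ K4 * ∑ l ∈ Finset.range L, 4 * theta μ X 4 4 (max (max i j) (l + 1))
        + K3 * (4 * theta μ X 4 4 (L + 1)) := by
  have hBb : EssBdd μ B := ⟨hB.mono (past_le H.meas _) le_rfl, 1, Eventually.of_forall hB1⟩
  have b3 := fun z => (hS.essBdd z).comp_continuous hg.cont3
  have bX := H.essBdd
  have bP : EssBdd μ (fun ω => X (k - i - j) ω * (X (k - i) ω * X k ω
      - if j = 0 then 0 else acov μ X i)) :=
    (bX _).mul ((H.essBdd_two _ _).sub (EssBdd.const _))
  have h := telescope_bound (μ := μ) (z := k - i - j) (L := L) (B := B)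
    (W := fun ω => X (k - i - j) ω * (X (k - i) ω * X k ω
      - if j = 0 then 0 else acov μ X i) - thirdMoment μ X i j)
    (G := fun z ω => g3 (S z ω)) (D := fun _ _ => 0)
    (t := fun l => 4 * theta μ X 4 4 (max (max i j) (l + 1))) (K := K4) (K' := K3)
    (hB.mono (past_mono (by push_cast; lia)) le_rfl) hBb
    (fun z => hg.cont3.measurable.comp (hS.meas z)) b3
    (fun l => measurable_const) (fun l => EssBdd.const _) (bP.sub (EssBdd.const _))
    (fun l _ => (H.dep_three_max k (by lia)).1)
    (fun l hl => by
      filter_upwards [H.bdd] with ω hω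
      refine mul_le_of_abs_le_one (hB1 ω) ?_
      have := hg.rem3 (S (k - i - j - (l + 1 : ℕ) - 1) ω) _ (hω (k - i - j - (l + 1 : ℕ)))
      rw [sub_zero]
      rwa [← hS.step (k - i - j - (l + 1 : ℕ)) (by push_cast; lia)] at this)
    (hK3 _ (by lia))
  rw [max_eq_right (a := max i j) (by simp; lia)] at h
  refine le_trans (le_of_eq ?_) h
  congr 1
  simp only [mul_zero, zero_mul, integral_zero, Finset.sum_const_zero, sub_zero]
  rw [← integral_const_mul, ← integral_sub
    ((hBb.mul (b3 _)).mul bP).integrable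
    ((EssBdd.const _).mul (hBb.mul (b3 _))).integrable]
  congr 1; ext ω; ring

theorem base_change_three {i : ℕ} (hi : i ≤ 2 * L) :
    |∫ ω, B ω * g3 (S (k - i - 1) ω) ∂μ - ∫ ω, B ω * g3 (S (k - 1) ω) ∂μ| ≤ K4 * i := by
  have hBb : EssBdd μ B := ⟨hB.mono (past_le H.meas _) le_rfl, 1, Eventually.of_forall hB1⟩
  have b3 := fun z => (hS.essBdd z).comp_continuous hg.cont3
  induction i with
  | zero => simp
  | succ i ih =>
    have h1 : |∫ ω, B ω * g3 (S (k - (i + 1 : ℕ) - 1) ω) ∂μ - ∫ ω, B ω * g3 (S (k - i - 1) ω) ∂μ|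
        ≤ K4 := by
      rw [← integral_sub (hBb.mul (b3 _)).integrable (hBb.mul (b3 _)).integrable]
      refine abs_integral_le_of_ae ?_
      filter_upwards [H.bdd] with ω hω
      rw [← mul_sub]
      refine mul_le_of_abs_le_one (hB1 ω) ?_
      have := hg.rem3 (S (k - i - 1 - 1) ω) _ (hω (k - i - 1))
      rw [← hS.step (k - i - 1) (by lia)] at this
      rw [abs_sub_comm]
      rwa [show k - ((i + 1 : ℕ) : ℤ) - 1 = k - i - 1 - 1 by push_cast; ring]
    have := abs_sub_le (∫ ω, B ω * g3 (S (k - (i + 1 : ℕ) - 1) ω) ∂μ)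
      (∫ ω, B ω * g3 (S (k - i - 1) ω) ∂μ) (∫ ω, B ω * g3 (S (k - 1) ω) ∂μ)
    have := ih (by lia)
    push_cast at *
    linarith

/-- Moving the base point by one step costs E B g''' X up to K4. Bounding this by K3 would be too
weak; telescoping g''' against the centred X replaces it by K4 ∑ θ plus a boundary term. Weighted by
i |γ_i|, this is the source of the product Θ₁Θ₂. -/
theorem base_change_two (hK3 : ∀ z ≤ k, ∀ᵐ ω ∂μ, |B ω * g3 (S z ω)| ≤ K3) {i : ℕ} (hi : i ≤ L) :
    |∫ ω, B ω * g2 (S (k - i - 1) ω) ∂μ - ∫ ω, B ω * g2 (S (k - 1) ω) ∂μ|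
      ≤ i * (K4 * (1 + ∑ l ∈ Finset.range L, theta μ X 4 4 (l + 1))
        + K3 * theta μ X 4 4 (L + 1)) := by
  have hBb : EssBdd μ B := ⟨hB.mono (past_le H.meas _) le_rfl, 1, Eventually.of_forall hB1⟩
  have b2 := fun z => (hS.essBdd z).comp_continuous hg.cont2
  have b3 := fun z => (hS.essBdd z).comp_continuous hg.cont3
  have bX := H.essBdd
  induction i with
  | zero => simp
  | succ i ih =>
    have h0 := telescope_bound (μ := μ) (z := k - i - 1) (L := L) (B := B)
      (W := X (k - i - 1))
      (G := fun z ω => g3 (S z ω)) (D := fun _ _ => 0)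
      (t := fun l => theta μ X 4 4 (l + 1)) (K := K4) (K' := K3)
      (hB.mono (past_mono (by push_cast; lia)) le_rfl) hBb
      (fun z => hg.cont3.measurable.comp (hS.meas z)) b3
      (fun l => measurable_const) (fun l => EssBdd.const _) (bX _)
      (fun l _ => H.dep_one _ _)
      (fun l hl => by
        filter_upwards [H.bdd] with ω hω
        refine mul_le_of_abs_le_one (hB1 ω) ?_
        have := hg.rem3 (S (k - i - 1 - (l + 1 : ℕ) - 1) ω) _ (hω (k - i - 1 - (l + 1 : ℕ)))
        rw [sub_zero]
        rwa [← hS.step (k - i - 1 - (l + 1 : ℕ)) (by push_cast; lia)] at this)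
      (hK3 _ (by lia))
    simp only [mul_zero, zero_mul, integral_zero, Finset.sum_const_zero, sub_zero] at h0
    have h1 : |∫ ω, B ω * g2 (S (k - i - 1) ω) ∂μ - ∫ ω, B ω * g2 (S (k - (i + 1 : ℕ) - 1) ω) ∂μ
        - ∫ ω, B ω * g3 (S (k - i - 1 - 1) ω) * X (k - i - 1) ω ∂μ| ≤ K4 := by
      rw [← integral_sub (hBb.mul (b2 _)).integrable (hBb.mul (b2 _)).integrable,
        ← integral_sub ((hBb.mul (b2 _)).sub (hBb.mul (b2 _))).integrable
          ((hBb.mul (b3 _)).mul (bX _)).integrable]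
      refine abs_integral_le_of_ae ?_
      filter_upwards [H.bdd] with ω hω
      have := hg.rem2 (S (k - i - 1 - 1) ω) _ (hω (k - i - 1))
      rw [← hS.step (k - i - 1) (by lia)] at this
      have h := mul_le_of_abs_le_one (hB1 ω) this
      rw [show k - ((i + 1 : ℕ) : ℤ) - 1 = k - i - 1 - 1 by push_cast; ring]
      convert h using 2
      ring
    have := ih (by lia)
    rw [abs_le] at *
    push_cast at *
    constructor <;> nlinarith

/-- Fourth order expansion of one increment, with explicit remainder. -/
theorem expansion
    (hK1 : ∀ z ≤ k, ∀ᵐ ω ∂μ, |B ω * g1 (S z ω)| ≤ K1)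
    (hK2 : ∀ z ≤ k, ∀ᵐ ω ∂μ, |B ω * g2 (S z ω)| ≤ K2)
    (hK3 : ∀ z ≤ k, ∀ᵐ ω ∂μ, |B ω * g3 (S z ω)| ≤ K3) :
    |∫ ω, B ω * (g0 (S k ω) - g0 (S (k - 1) ω)) ∂μ
      - (∑ i ∈ Finset.range (L + 1), lagWeight i * acov μ X i) * ∫ ω, B ω * g2 (S (k - 1) ω) ∂μ
      - skewCoeff μ X L * ∫ ω, B ω * g3 (S (k - 1) ω) ∂μ|
      ≤ K4 + (K4 * ∑ l ∈ Finset.range L, theta μ X 4 4 (l + 1) + K1 * theta μ X 4 4 (L + 1))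
        + ∑ i ∈ Finset.range (L + 1),
            (K4 * ∑ l ∈ Finset.range L, 2 * theta μ X 4 4 (max i (l + 1))
              + K2 * (2 * theta μ X 4 4 (L + 1)))
        + ∑ i ∈ Finset.range (L + 1), ∑ j ∈ Finset.range (L + 1),
            (K4 * ∑ l ∈ Finset.range L, 4 * theta μ X 4 4 (max (max i j) (l + 1))
              + K3 * (4 * theta μ X 4 4 (L + 1)))
        + ∑ i ∈ Finset.range (L + 1), |acov μ X i| *
            (i * (K4 * (1 + ∑ l ∈ Finset.range L, theta μ X 4 4 (l + 1))
              + K3 * theta μ X 4 4 (L + 1)))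
        + ∑ i ∈ Finset.range (L + 1), ∑ j ∈ Finset.range (L + 1),
            |thirdMoment μ X i j| * (K4 * (i + j)) := by
  set Δ := ∫ ω, B ω * (g0 (S k ω) - g0 (S (k - 1) ω)) ∂μ with hΔ
  set J2 : ℕ → ℝ := fun i => ∫ ω, B ω * g2 (S (k - i - 1) ω) ∂μ with hJ2
  set J3 : ℕ → ℕ → ℝ := fun i j => ∫ ω, B ω * g3 (S (k - i - j - 1) ω) ∂μ with hJ3
  set Q : ℕ → ℝ := fun i => ∫ ω, B ω * g2 (S (k - i - 1) ω) * (X (k - i) ω * X k ω) ∂μ with hQ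
  set C : ℕ → ℕ → ℝ := fun i j => ∫ ω, B ω * g3 (S (k - i - j - 1) ω) *
    (X (k - i - j) ω * (X (k - i) ω * X k ω - if j = 0 then 0 else acov μ X i)) ∂μ with hC
  set T := ∑ l ∈ Finset.range L, theta μ X 4 4 (l + 1) with hT
  set e2 : ℕ → ℝ := fun i => K4 * ∑ l ∈ Finset.range L, 2 * theta μ X 4 4 (max i (l + 1))
              + K2 * (2 * theta μ X 4 4 (L + 1)) with he2
  set e3 : ℕ → ℕ → ℝ := fun i j =>
    K4 * ∑ l ∈ Finset.range L, 4 * theta μ X 4 4 (max (max i j) (l + 1))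
              + K3 * (4 * theta μ X 4 4 (L + 1)) with he3
  have h20 : ∫ ω, B ω * g2 (S (k - 1) ω) ∂μ = J2 0 := by simp [hJ2]
  have h30 : ∫ ω, B ω * g3 (S (k - 1) ω) ∂μ = J3 0 0 := by simp [hJ3]
  have t1 : |Δ - (∑ i ∈ Finset.range (L + 1), lagWeight i * Q i
      + ∑ i ∈ Finset.range (L + 1), lagWeight₂ i 0 * C i 0)|
      ≤ K4 + (K4 * T + K1 * theta μ X 4 4 (L + 1)) := by
    have a0 := expansion_zero H hS hB hB1 hg
    have a1 := expansion_one H hS hB hB1 hg hK1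
    have q0 : ∫ ω, B ω * g2 (S (k - 1) ω) * (X k ω * X k ω) ∂μ = Q 0 := by simp [hQ]
    have c0 : ∫ ω, B ω * g3 (S (k - 1) ω) * (X k ω * (X k ω * X k ω)) ∂μ = C 0 0 := by simp [hC]
    have c1 : ∀ i : ℕ, ∫ ω, B ω * g3 (S (k - (i + 1 : ℕ) - 1) ω) *
        (X (k - (i + 1 : ℕ)) ω * (X (k - (i + 1 : ℕ)) ω * X k ω)) ∂μ = C (i + 1) 0 := fun i => by
      simp [hC]
    simp only [c1] at a1
    rw [q0, c0] at a0
    have e : ∑ i ∈ Finset.range (L + 1), lagWeight i * Q i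
        + ∑ i ∈ Finset.range (L + 1), lagWeight₂ i 0 * C i 0
        = (1 / 2) * Q 0 + (1 / 6) * C 0 0
          + ∑ i ∈ Finset.range L, (Q (i + 1) + (1 / 2) * C (i + 1) 0) := by
      rw [Finset.sum_range_succ', Finset.sum_range_succ' (fun i => lagWeight₂ i 0 * C i 0),
        Finset.sum_add_distrib]
      simp only [lagWeight, lagWeight₂, if_true, Nat.add_eq_zero_iff, one_ne_zero, and_false,
        if_false, one_mul]
      ring
    rw [e]
    refine le_trans (le_of_eq ?_) ((abs_add_le _ _).trans (add_le_add a0 a1))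
    congr 1
    ring
  have t2 : |∑ i ∈ Finset.range (L + 1), lagWeight i *
      (Q i - acov μ X i * J2 i - ∑ j ∈ Finset.range L, C i (j + 1))|
      ≤ ∑ i ∈ Finset.range (L + 1), e2 i := by
    refine abs_weighted_sum_le lagWeight_nonneg lagWeight_le fun i hi => ?_
    have := expansion_two H hS hB hB1 hg hK2 (i := i) (by simp at hi; lia)
    simpa [hQ, hJ2, hC, he2] using this
  have t3 : |∑ i ∈ Finset.range (L + 1), ∑ j ∈ Finset.range (L + 1), lagWeight₂ i j *
      (C i j - thirdMoment μ X i j * J3 i j)|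
      ≤ ∑ i ∈ Finset.range (L + 1), ∑ j ∈ Finset.range (L + 1), e3 i j := by
    refine (Finset.abs_sum_le_sum_abs _ _).trans (Finset.sum_le_sum fun i hi => ?_)
    refine abs_weighted_sum_le (lagWeight₂_nonneg i) (lagWeight₂_le i) fun j hj => ?_
    exact expansion_three H hS hB hB1 hg hK3 (by simp at hi; lia) (by simp at hj; lia)
  have t4 : |∑ i ∈ Finset.range (L + 1), lagWeight i * (acov μ X i * (J2 i - J2 0))|
      ≤ ∑ i ∈ Finset.range (L + 1), |acov μ X i| *
            (i * (K4 * (1 + T) + K3 * theta μ X 4 4 (L + 1))) := by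
    refine abs_weighted_sum_le lagWeight_nonneg lagWeight_le fun i hi => ?_
    have := base_change_two H hS hB hB1 hg hK3 (i := i) (by simp at hi; lia)
    rw [abs_mul]
    refine mul_le_mul_of_nonneg_left ?_ (abs_nonneg _)
    rw [← h20]
    exact this
  have t5 : |∑ i ∈ Finset.range (L + 1), ∑ j ∈ Finset.range (L + 1), lagWeight₂ i j *
      (thirdMoment μ X i j * (J3 i j - J3 0 0))|
      ≤ ∑ i ∈ Finset.range (L + 1), ∑ j ∈ Finset.range (L + 1),
            |thirdMoment μ X i j| * (K4 * (i + j)) := by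
    refine (Finset.abs_sum_le_sum_abs _ _).trans (Finset.sum_le_sum fun i hi => ?_)
    refine abs_weighted_sum_le (lagWeight₂_nonneg i) (lagWeight₂_le i) fun j hj => ?_
    have := base_change_three H hS hB hB1 hg (i := i + j) (by simp at hi hj; lia)
    rw [abs_mul]
    refine mul_le_mul_of_nonneg_left ?_ (abs_nonneg _)
    rw [← h30]
    simpa [hJ3, sub_sub, add_assoc] using this
  have e : Δ - (∑ i ∈ Finset.range (L + 1), lagWeight i * acov μ X i) * J2 0
      - skewCoeff μ X L * J3 0 0
      = (Δ - (∑ i ∈ Finset.range (L + 1), lagWeight i * Q i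
          + ∑ i ∈ Finset.range (L + 1), lagWeight₂ i 0 * C i 0))
        + (∑ i ∈ Finset.range (L + 1), lagWeight i *
          (Q i - acov μ X i * J2 i - ∑ j ∈ Finset.range L, C i (j + 1)))
        + (∑ i ∈ Finset.range (L + 1), ∑ j ∈ Finset.range (L + 1), lagWeight₂ i j *
          (C i j - thirdMoment μ X i j * J3 i j))
        + (∑ i ∈ Finset.range (L + 1), lagWeight i * (acov μ X i * (J2 i - J2 0)))
        + (∑ i ∈ Finset.range (L + 1), ∑ j ∈ Finset.range (L + 1), lagWeight₂ i j *
          (thirdMoment μ X i j * (J3 i j - J3 0 0))) := by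
    -- The cubic terms with j = 0 were produced by the Taylor coefficients in the first two
    -- expansions, those with j ≥ 1 by expanding the quadratic terms, which explains the two regimes
    -- of `lagWeight₂`.
    have s : ∑ i ∈ Finset.range (L + 1), ∑ j ∈ Finset.range (L + 1), lagWeight₂ i j * C i j
        = ∑ i ∈ Finset.range (L + 1), lagWeight i * ∑ j ∈ Finset.range L, C i (j + 1)
          + ∑ i ∈ Finset.range (L + 1), lagWeight₂ i 0 * C i 0 := by
      rw [← Finset.sum_add_distrib]
      refine Finset.sum_congr rfl fun i _ => ?_
      rw [Finset.sum_range_succ', Finset.mul_sum]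
      rfl
    simp only [mul_sub, Finset.sum_sub_distrib, s, skewCoeff, Finset.sum_mul, ← mul_assoc]
    ring
  rw [h20, h30, e]
  refine (abs_add_le _ _).trans (add_le_add ((abs_add_le _ _).trans (add_le_add
    ((abs_add_le _ _).trans (add_le_add ((abs_add_le _ _).trans (add_le_add t1 t2)) t3)) t4)) t5)

end Expansion
end Core

/-- `(1 + ∑ t_k)(1 + ∑ k t_k) + ∑ k (k ∧ x) t_k`, the sums being over `k ≥ 1`. -/
noncomputable def depConst (t : ℕ → ℝ) (x : ℝ) : ℝ :=
  (1 + ∑' k : ℕ, t (k + 1)) * (1 + ∑' k : ℕ, ((k + 1 : ℕ) : ℝ) * t (k + 1))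
    + ∑' k : ℕ, ((k + 1 : ℕ) : ℝ) * min ((k + 1 : ℕ) : ℝ) x * t (k + 1)

/-! ### Bounds for weighted sums of the dependence coefficients -/

section Sums
variable {t : ℕ → ℝ} (h0 : ∀ k, 0 ≤ t k)
  (hs : Summable fun k : ℕ => ((k + 1 : ℕ) : ℝ) * t (k + 1))
include h0 hs

theorem summable_of_summable_mul : Summable fun k : ℕ => t (k + 1) :=
  Summable.of_nonneg_of_le (fun k => h0 _) (fun k => by
    push_cast; nlinarith [h0 (k + 1), (Nat.cast_nonneg k : (0 : ℝ) ≤ k)]) hs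

theorem summable_mul_min {x : ℝ} (hx : 0 ≤ x) :
    Summable fun k : ℕ => ((k + 1 : ℕ) : ℝ) * min ((k + 1 : ℕ) : ℝ) x * t (k + 1) :=
  Summable.of_nonneg_of_le
    (fun k => mul_nonneg (mul_nonneg (by positivity) (le_min (by positivity) hx)) (h0 _))
    (fun k => by
      have := min_le_right ((k + 1 : ℕ) : ℝ) x
      calc _ = min ((k + 1 : ℕ) : ℝ) x * (((k + 1 : ℕ) : ℝ) * t (k + 1)) := by ring
        _ ≤ _ := mul_le_mul_of_nonneg_right this (mul_nonneg (by positivity) (h0 _)))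
    (hs.mul_left x)

theorem tsum_mul_min_nonneg {x : ℝ} (hx : 0 ≤ x) :
    0 ≤ ∑' k : ℕ, ((k + 1 : ℕ) : ℝ) * min ((k + 1 : ℕ) : ℝ) x * t (k + 1) :=
  tsum_nonneg fun k => mul_nonneg (mul_nonneg (by positivity) (le_min (by positivity) hx)) (h0 _)

theorem one_le_depConst {x : ℝ} (hx : 0 ≤ x) : 1 ≤ depConst t x := by
  have h1 : 0 ≤ ∑' k : ℕ, t (k + 1) := tsum_nonneg fun k => h0 _
  have h2 : 0 ≤ ∑' k : ℕ, ((k + 1 : ℕ) : ℝ) * t (k + 1) :=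
    tsum_nonneg fun k => mul_nonneg (by positivity) (h0 _)
  have h3 := tsum_mul_min_nonneg h0 hs hx
  unfold depConst
  nlinarith

theorem depConst_mono {x y : ℝ} (hx : 0 ≤ x) (hxy : x ≤ y) : depConst t x ≤ depConst t y := by
  unfold depConst
  refine add_le_add le_rfl ?_
  exact Summable.tsum_le_tsum (fun k => mul_le_mul_of_nonneg_right
    (mul_le_mul_of_nonneg_left (min_le_min_left _ hxy) (by positivity)) (h0 _))
    (summable_mul_min h0 hs hx) (summable_mul_min h0 hs (hx.trans hxy))

theorem sum_sq_le (L : ℕ) : ∑ k ∈ Finset.range L, ((k + 1 : ℕ) : ℝ) ^ 2 * t (k + 1)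
    ≤ ∑' k : ℕ, ((k + 1 : ℕ) : ℝ) * min ((k + 1 : ℕ) : ℝ) L * t (k + 1) := by
  refine le_trans (Finset.sum_le_sum fun k hk => ?_) ((summable_mul_min h0 hs
    (Nat.cast_nonneg L)).sum_le_tsum (Finset.range L) fun k _ => mul_nonneg (mul_nonneg
      (by positivity) (le_min (by positivity) (by positivity))) (h0 _))
  have : ((k + 1 : ℕ) : ℝ) ≤ L := by
    have := Finset.mem_range.1 hk
    exact_mod_cast this
  rw [min_eq_left this, sq]

/-- By monotonicity, L³ θ(L + 1) is at most 3 ∑_{k ≤ L} k² θ(k). This pays for the boundary terms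
left at the end of each telescoping. -/
theorem cube_mul_le (hanti : Antitone t) (L : ℕ) : (L : ℝ) ^ 3 * t (L + 1)
    ≤ 3 * ∑' k : ℕ, ((k + 1 : ℕ) : ℝ) * min ((k + 1 : ℕ) : ℝ) L * t (k + 1) := by
  have h1 : ∀ n : ℕ, (n : ℝ) ^ 3 ≤ 3 * ∑ k ∈ Finset.range n, ((k + 1 : ℕ) : ℝ) ^ 2 := by
    intro n
    induction n with
    | zero => simp
    | succ n ih =>
      rw [Finset.sum_range_succ]; push_cast at *
      nlinarith [(Nat.cast_nonneg n : (0 : ℝ) ≤ n)]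
  have h2 : (∑ k ∈ Finset.range L, ((k + 1 : ℕ) : ℝ) ^ 2) * t (L + 1)
      ≤ ∑ k ∈ Finset.range L, ((k + 1 : ℕ) : ℝ) ^ 2 * t (k + 1) := by
    rw [Finset.sum_mul]
    refine Finset.sum_le_sum fun k hk => mul_le_mul_of_nonneg_left (hanti ?_) (by positivity)
    have := Finset.mem_range.1 hk
    lia
  have := mul_le_mul_of_nonneg_right (h1 L) (h0 (L + 1))
  have := sum_sq_le h0 hs L
  linarith

/-- For k > L the weight k (k ∧ L) is at least L². This pays for replacing the truncated variance by
σ². -/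
theorem sq_mul_tail_le (L : ℕ) : (L : ℝ) ^ 2 * ∑' k : ℕ, t (k + L + 1)
    ≤ ∑' k : ℕ, ((k + 1 : ℕ) : ℝ) * min ((k + 1 : ℕ) : ℝ) L * t (k + 1) := by
  have hS := summable_mul_min h0 hs (Nat.cast_nonneg L)
  have hT := (summable_nat_add_iff L).2 (summable_of_summable_mul h0 hs)
  have hS' := (summable_nat_add_iff L).2 hS
  rw [← tsum_mul_left, ← hS.sum_add_tsum_nat_add L]
  have hnn : 0 ≤ ∑ k ∈ Finset.range L, ((k + 1 : ℕ) : ℝ) * min ((k + 1 : ℕ) : ℝ) L * t (k + 1) :=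
    Finset.sum_nonneg fun k _ => mul_nonneg (mul_nonneg
      (by positivity) (le_min (by positivity) (by positivity))) (h0 _)
  refine le_trans ?_ (le_add_of_nonneg_left hnn)
  refine Summable.tsum_le_tsum (fun k => ?_) (hT.mul_left _) hS'
  have : (L : ℝ) ≤ ((k + L + 1 : ℕ) : ℝ) := by exact_mod_cast (by lia)
  rw [min_eq_right this, sq]
  exact mul_le_mul_of_nonneg_right (mul_le_mul_of_nonneg_right this (by positivity)) (h0 _)

theorem mul_le_tsum (hanti : Antitone t) (L : ℕ) : (L : ℝ) * t (L + 1) ≤ ∑' k : ℕ, t (k + 1) := by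
  refine le_trans ?_ ((summable_of_summable_mul h0 hs).sum_le_tsum (Finset.range L)
    fun k _ => h0 _)
  have h : ∑ _k ∈ Finset.range L, t (L + 1) = L * t (L + 1) := by simp
  rw [← h]
  refine Finset.sum_le_sum fun k hk => hanti ?_
  have := Finset.mem_range.1 hk
  lia

theorem sum_max_le (L : ℕ) :
    ∑ i ∈ Finset.range (L + 1), ∑ l ∈ Finset.range L, t (max i (l + 1))
      ≤ 4 * ∑' k : ℕ, ((k + 1 : ℕ) : ℝ) * t (k + 1) := by
  have h1 : ∑ i ∈ Finset.range (L + 1), ∑ l ∈ Finset.range L, t (max i (l + 1))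
      ≤ ∑ i ∈ Finset.range (L + 1), ∑ l ∈ Finset.range (L + 1), t (max 1 (max i l)) := by
    refine Finset.sum_le_sum fun i _ => ?_
    rw [Finset.sum_range_succ']
    -- The index l starts at 1 on the left; adding l = 0 symmetrizes the sum, and `max 1` keeps θ(0)
    -- from entering.
    refine le_add_of_le_of_nonneg (le_of_eq (Finset.sum_congr rfl fun l _ => ?_)) (h0 _)
    congr 1; lia
  refine h1.trans ?_
  rw [sum_sum_max (fun k => t (max 1 k)), Finset.sum_range_succ']
  have h2 := hs.sum_le_tsum (Finset.range L) fun k _ => mul_nonneg (by positivity) (h0 _)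
  have h3 : ∑ k ∈ Finset.range L, (2 * ((k + 1 : ℕ) : ℝ) + 1) * t (max 1 (k + 1))
      ≤ ∑ k ∈ Finset.range L, 3 * (((k + 1 : ℕ) : ℝ) * t (k + 1)) := by
    refine Finset.sum_le_sum fun k _ => ?_
    rw [max_eq_right (by lia)]; push_cast
    nlinarith [h0 (k + 1), mul_nonneg (Nat.cast_nonneg (α := ℝ) k) (h0 (k + 1))]
  rw [← Finset.mul_sum] at h3
  have h4 := hs.le_tsum 0 fun k _ => mul_nonneg (by positivity) (h0 _)
  simp at h2 h3 h4 ⊢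
  linarith

theorem sum_max_three_le (L : ℕ) (hL : 1 ≤ L) :
    ∑ i ∈ Finset.range (L + 1), ∑ j ∈ Finset.range (L + 1), ∑ l ∈ Finset.range L,
      t (max (max i j) (l + 1))
      ≤ 8 * ∑' k : ℕ, ((k + 1 : ℕ) : ℝ) * min ((k + 1 : ℕ) : ℝ) L * t (k + 1) := by
  have h1 : ∑ i ∈ Finset.range (L + 1), ∑ j ∈ Finset.range (L + 1), ∑ l ∈ Finset.range L,
      t (max (max i j) (l + 1))
      ≤ ∑ i ∈ Finset.range (L + 1), ∑ j ∈ Finset.range (L + 1), ∑ l ∈ Finset.range (L + 1),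
        t (max 1 (max (max i j) l)) := by
    refine Finset.sum_le_sum fun i _ => Finset.sum_le_sum fun j _ => ?_
    rw [Finset.sum_range_succ' _ L]
    refine le_add_of_le_of_nonneg (le_of_eq (Finset.sum_congr rfl fun l _ => ?_)) (h0 _)
    congr 1; lia
  refine h1.trans ?_
  rw [sum_sum_sum_max (fun k => t (max 1 k)), Finset.sum_range_succ']
  have h2 := sum_sq_le h0 hs L
  have h3 : ∑ k ∈ Finset.range L, (3 * ((k + 1 : ℕ) : ℝ) ^ 2 + 3 * ((k + 1 : ℕ) : ℝ) + 1)
        * t (max 1 (k + 1))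
      ≤ ∑ k ∈ Finset.range L, 7 * (((k + 1 : ℕ) : ℝ) ^ 2 * t (k + 1)) := by
    refine Finset.sum_le_sum fun k _ => ?_
    rw [max_eq_right (by lia), ← mul_assoc]
    refine mul_le_mul_of_nonneg_right ?_ (h0 _)
    have : (1 : ℝ) ≤ ((k + 1 : ℕ) : ℝ) := by simp
    nlinarith
  rw [← Finset.mul_sum] at h3
  have h4 : t 1 ≤ ∑ k ∈ Finset.range L, ((k + 1 : ℕ) : ℝ) ^ 2 * t (k + 1) := by
    have := Finset.single_le_sum (f := fun k : ℕ => ((k + 1 : ℕ) : ℝ) ^ 2 * t (k + 1))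
      (fun k _ => mul_nonneg (by positivity) (h0 _)) (Finset.mem_range.2 hL)
    simpa using this
  simp only [Nat.cast_zero, max_eq_left (Nat.zero_le 1)]
  linarith

theorem sum_max_weighted_le (L : ℕ) :
    ∑ i ∈ Finset.range (L + 1), ∑ j ∈ Finset.range (L + 1), ((max i j : ℕ) : ℝ) * t (max i j)
      ≤ 3 * ∑' k : ℕ, ((k + 1 : ℕ) : ℝ) * min ((k + 1 : ℕ) : ℝ) L * t (k + 1) := by
  rw [sum_sum_max (fun k => (k : ℝ) * t k), Finset.sum_range_succ']
  have h3 : ∑ k ∈ Finset.range L, (2 * ((k + 1 : ℕ) : ℝ) + 1) * (((k + 1 : ℕ) : ℝ) * t (k + 1))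
      ≤ ∑ k ∈ Finset.range L, 3 * (((k + 1 : ℕ) : ℝ) ^ 2 * t (k + 1)) := by
    refine Finset.sum_le_sum fun k _ => ?_
    rw [← mul_assoc, ← mul_assoc]
    refine mul_le_mul_of_nonneg_right ?_ (h0 _)
    have : (1 : ℝ) ≤ ((k + 1 : ℕ) : ℝ) := by simp
    nlinarith
  rw [← Finset.mul_sum] at h3
  have h2 := sum_sq_le h0 hs L
  simp only [Nat.cast_zero, zero_mul, mul_zero, add_zero]
  linarith

end Sums

/-! ### Long run variance and the expansion at scale `L` -/

section Core
variable {Ω : Type*} [mΩ : MeasurableSpace Ω] {μ : Measure Ω} [IsProbabilityMeasure μ]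
  {X : ℤ → Ω → ℝ}

/-- The long run variance. -/
noncomputable def longRunVar (μ : Measure Ω) (X : ℤ → Ω → ℝ) : ℝ :=
  acov μ X 0 + 2 * ∑' k : ℕ, acov μ X (k + 1)

variable (H : BddStationary μ X)
  (hs : Summable fun k : ℕ => ((k + 1 : ℕ) : ℝ) * theta μ X 4 4 (k + 1))
include H hs

theorem summable_acov : Summable fun k : ℕ => acov μ X (k + 1) :=
  Summable.of_norm_bounded (summable_of_summable_mul (theta_nonneg 4 4) hs)
    fun k => H.abs_acov_le (k + 1)

theorem abs_sum_lagWeight_sub_le (L : ℕ) :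
    |∑ i ∈ Finset.range (L + 1), lagWeight i * acov μ X i - longRunVar μ X / 2|
      ≤ ∑' k : ℕ, theta μ X 4 4 (k + L + 1) := by
  have hγ := summable_acov H hs
  have hT := (summable_nat_add_iff L).2 (summable_of_summable_mul (theta_nonneg 4 4) hs)
  have e : ∑ i ∈ Finset.range (L + 1), lagWeight i * acov μ X i - longRunVar μ X / 2
      = -∑' k : ℕ, acov μ X (k + L + 1) := by
    rw [Finset.sum_range_succ', longRunVar, ← hγ.sum_add_tsum_nat_add L]
    simp [lagWeight]
    ring
  rw [e, abs_neg]
  exact tsum_of_norm_bounded (f := fun k => acov μ X (k + L + 1)) hT.hasSum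
    fun k => H.abs_acov_le (k + L + 1)

set_option maxHeartbeats 1000000 in
/-- Fourth order expansion of one increment at scale `L`. -/
theorem expansion_scaled {S : ℤ → Ω → ℝ} {k : ℤ} {L : ℕ} (hL : 1 ≤ L) {B : Ω → ℝ}
    {g0 g1 g2 g3 : ℝ → ℝ} {K : ℝ} (hK : 0 ≤ K)
    (hS : AdaptedWalk μ X S (k - 3 * L - 1))
    (hB : Measurable[past X (k - 3 * L - 1)] B) (hB1 : ∀ ω, |B ω| ≤ 1)
    (hg : TaylorJet g0 g1 g2 g3 K)
    (hK1 : ∀ z ≤ k, ∀ᵐ ω ∂μ, |B ω * g1 (S z ω)| ≤ K * L ^ 3)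
    (hK2 : ∀ z ≤ k, ∀ᵐ ω ∂μ, |B ω * g2 (S z ω)| ≤ K * L ^ 2)
    (hK3 : ∀ z ≤ k, ∀ᵐ ω ∂μ, |B ω * g3 (S z ω)| ≤ K * L) :
    |∫ ω, B ω * (g0 (S k ω) - g0 (S (k - 1) ω)) ∂μ
      - longRunVar μ X / 2 * ∫ ω, B ω * g2 (S (k - 1) ω) ∂μ
      - skewCoeff μ X L * ∫ ω, B ω * g3 (S (k - 1) ω) ∂μ|
      ≤ 120 * K * depConst (theta μ X 4 4) L := by
  have h0 : ∀ k, 0 ≤ theta μ X 4 4 k := theta_nonneg 4 4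
  have hanti := H.theta_anti 4 4
  have hE := expansion H hS hB hB1 hg hK1 hK2 hK3
  have hv := abs_sum_lagWeight_sub_le H hs L
  have hJ : |∫ ω, B ω * g2 (S (k - 1) ω) ∂μ| ≤ K * L ^ 2 := abs_integral_le_of_ae (hK2 _ (by lia))
  have f0 := one_le_depConst h0 hs (Nat.cast_nonneg L)
  have f3 := cube_mul_le h0 hs hanti L
  have f5 := sq_mul_tail_le h0 hs L
  have f6 := mul_le_tsum h0 hs hanti L
  have f7 := sum_max_le h0 hs L
  have f8 := sum_max_three_le h0 hs L hL
  have f9 := sum_max_weighted_le h0 hs L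
  have f10 : ∑ l ∈ Finset.range L, theta μ X 4 4 (l + 1) ≤ ∑' k : ℕ, theta μ X 4 4 (k + 1) :=
    (summable_of_summable_mul h0 hs).sum_le_tsum _ fun k _ => h0 _
  have f11 : ∑ i ∈ Finset.range (L + 1), |acov μ X i| * i
      ≤ ∑' k : ℕ, ((k + 1 : ℕ) : ℝ) * theta μ X 4 4 (k + 1) := by
    rw [Finset.sum_range_succ']
    have := hs.sum_le_tsum (Finset.range L) fun k _ => mul_nonneg (by positivity) (h0 _)
    refine le_trans ?_ this
    simp only [Nat.cast_zero, mul_zero, add_zero]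
    refine Finset.sum_le_sum fun i _ => ?_
    rw [mul_comm]
    exact mul_le_mul_of_nonneg_left (H.abs_acov_le _) (by positivity)
  have f12 : ∑ i ∈ Finset.range (L + 1), ∑ j ∈ Finset.range (L + 1),
      |thirdMoment μ X i j| * (K * (i + j))
      ≤ 4 * K * ∑ i ∈ Finset.range (L + 1), ∑ j ∈ Finset.range (L + 1),
        ((max i j : ℕ) : ℝ) * theta μ X 4 4 (max i j) := by
    rw [Finset.mul_sum]
    refine Finset.sum_le_sum fun i _ => ?_
    rw [Finset.mul_sum]
    refine Finset.sum_le_sum fun j _ => ?_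
    rcases Nat.eq_zero_or_pos (max i j) with h | h
    · have hi : i = 0 := by lia
      have hj : j = 0 := by lia
      simp [hi, hj]
    · have h1 := (H.dep_three_max 0 (i := i) (j := j) le_rfl).2 h
      have h2 : (i : ℝ) + j ≤ 2 * ((max i j : ℕ) : ℝ) := by
        have : i + j ≤ 2 * max i j := by lia
        exact_mod_cast this
      calc |thirdMoment μ X i j| * (K * (i + j))
          ≤ (2 * theta μ X 4 4 (max i j)) * (K * (2 * ((max i j : ℕ) : ℝ))) :=
            mul_le_mul h1 (mul_le_mul_of_nonneg_left h2 hK) (by positivity)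
              (by linarith [h0 (max i j)])
        _ = _ := by ring
  set A := ∑' k : ℕ, theta μ X 4 4 (k + 1) with hA
  set A2 := ∑' k : ℕ, ((k + 1 : ℕ) : ℝ) * theta μ X 4 4 (k + 1) with hA2
  set D := ∑' k : ℕ, ((k + 1 : ℕ) : ℝ) * min ((k + 1 : ℕ) : ℝ) L * theta μ X 4 4 (k + 1) with hD
  set τ := theta μ X 4 4 (L + 1) with hτ
  have hV : depConst (theta μ X 4 4) L = (1 + A) * (1 + A2) + D := rfl
  have hA0 : 0 ≤ A := tsum_nonneg fun k => h0 _
  have hA20 : 0 ≤ A2 := tsum_nonneg fun k => mul_nonneg (by positivity) (h0 _)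
  have hD0 : 0 ≤ D := tsum_mul_min_nonneg h0 hs (Nat.cast_nonneg L)
  have hL' : (1 : ℝ) ≤ L := by exact_mod_cast hL
  have hτ0 : 0 ≤ τ := h0 _
  clear_value D A A2 τ
  have e2 : ∑ i ∈ Finset.range (L + 1),
            (K * ∑ l ∈ Finset.range L, 2 * theta μ X 4 4 (max i (l + 1))
              + K * L ^ 2 * (2 * τ)) ≤ K * (8 * A2 + 12 * D) := by
    have : ∑ i ∈ Finset.range (L + 1),
            (K * ∑ l ∈ Finset.range L, 2 * theta μ X 4 4 (max i (l + 1))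
              + K * L ^ 2 * (2 * τ))
        = K * (2 * ∑ i ∈ Finset.range (L + 1), ∑ l ∈ Finset.range L, theta μ X 4 4 (max i (l + 1))
          + (L + 1) * (L ^ 2 * (2 * τ))) := by
      simp only [Finset.sum_add_distrib, ← Finset.mul_sum, Finset.sum_const, Finset.card_range,
        nsmul_eq_mul]
      push_cast; ring
    rw [this]
    refine mul_le_mul_of_nonneg_left ?_ hK
    have : ((L : ℝ) + 1) * (L ^ 2 * (2 * τ)) ≤ 4 * (L ^ 3 * τ) := by
      have : (0 : ℝ) ≤ L ^ 2 * τ := by positivity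
      nlinarith
    linarith
  have e3 : ∑ i ∈ Finset.range (L + 1), ∑ j ∈ Finset.range (L + 1),
            (K * ∑ l ∈ Finset.range L, 4 * theta μ X 4 4 (max (max i j) (l + 1))
              + K * L * (4 * τ)) ≤ K * (80 * D) := by
    have : ∑ i ∈ Finset.range (L + 1), ∑ j ∈ Finset.range (L + 1),
            (K * ∑ l ∈ Finset.range L, 4 * theta μ X 4 4 (max (max i j) (l + 1))
              + K * L * (4 * τ))
        = K * (4 * ∑ i ∈ Finset.range (L + 1), ∑ j ∈ Finset.range (L + 1),
          ∑ l ∈ Finset.range L, theta μ X 4 4 (max (max i j) (l + 1))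
          + (L + 1) * ((L + 1) * (L * (4 * τ)))) := by
      simp only [Finset.sum_add_distrib, ← Finset.mul_sum, Finset.sum_const, Finset.card_range,
        nsmul_eq_mul]
      push_cast; ring
    rw [this]
    refine mul_le_mul_of_nonneg_left ?_ hK
    have : ((L : ℝ) + 1) * ((L + 1) * (L * (4 * τ))) ≤ 16 * (L ^ 3 * τ) := by
      have h1 : ((L : ℝ) + 1) * (L + 1) ≤ 4 * L ^ 2 := by nlinarith
      have h2 : (0 : ℝ) ≤ L * (4 * τ) := by positivity
      nlinarith [mul_le_mul_of_nonneg_right h1 h2]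
    linarith
  have e4 : ∑ i ∈ Finset.range (L + 1), |acov μ X i| *
            (i * (K * (1 + ∑ l ∈ Finset.range L, theta μ X 4 4 (l + 1)) + K * L * τ))
      ≤ K * (2 * ((1 + A) * A2)) := by
    have e : ∑ i ∈ Finset.range (L + 1), |acov μ X i| *
            (i * (K * (1 + ∑ l ∈ Finset.range L, theta μ X 4 4 (l + 1)) + K * L * τ))
        = (∑ i ∈ Finset.range (L + 1), |acov μ X i| * i) *
          (K * (1 + ∑ l ∈ Finset.range L, theta μ X 4 4 (l + 1) + L * τ)) := by
      rw [Finset.sum_mul]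
      exact Finset.sum_congr rfl fun i _ => by ring
    rw [e]
    have h1 : K * (1 + ∑ l ∈ Finset.range L, theta μ X 4 4 (l + 1) + L * τ)
        ≤ K * (2 * (1 + A)) := mul_le_mul_of_nonneg_left (by linarith) hK
    calc _ ≤ A2 * (K * (2 * (1 + A))) := mul_le_mul f11 h1 (mul_nonneg hK (by
            have : 0 ≤ ∑ l ∈ Finset.range L, theta μ X 4 4 (l + 1) :=
              Finset.sum_nonneg fun l _ => h0 _
            positivity)) hA20
      _ = _ := by ring
  have e1 : K + (K * ∑ l ∈ Finset.range L, theta μ X 4 4 (l + 1) + K * L ^ 3 * τ)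
      ≤ K * (1 + A + 3 * D) := by
    have : K + (K * ∑ l ∈ Finset.range L, theta μ X 4 4 (l + 1) + K * L ^ 3 * τ)
        = K * (1 + ∑ l ∈ Finset.range L, theta μ X 4 4 (l + 1) + L ^ 3 * τ) := by ring
    rw [this]
    exact mul_le_mul_of_nonneg_left (by linarith) hK
  -- Price of passing from the covariances up to lag `L` to σ²/2: a tail of θ times the bound K L²
  -- on g''.
  have e6 : |(∑ i ∈ Finset.range (L + 1), lagWeight i * acov μ X i - longRunVar μ X / 2)
      * ∫ ω, B ω * g2 (S (k - 1) ω) ∂μ| ≤ K * D := by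
    rw [abs_mul]
    calc _ ≤ (∑' k : ℕ, theta μ X 4 4 (k + L + 1)) * (K * L ^ 2) :=
          mul_le_mul hv hJ (abs_nonneg _) (tsum_nonneg fun k => h0 _)
      _ = K * (L ^ 2 * ∑' k : ℕ, theta μ X 4 4 (k + L + 1)) := by ring
      _ ≤ _ := mul_le_mul_of_nonneg_left f5 hK
  have e5 : ∑ i ∈ Finset.range (L + 1), ∑ j ∈ Finset.range (L + 1),
      |thirdMoment μ X i j| * (K * (i + j)) ≤ K * (12 * D) := by
    refine f12.trans ?_
    rw [mul_comm 4 K, mul_assoc]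
    exact mul_le_mul_of_nonneg_left (by linarith) hK
  -- The coefficient of `D` adds up to 3 + 12 + 80 + 12 + 1 = 108, and the remaining terms are at
  -- most 10 (1 + A)(1 + A2); hence 120.
  have hfin : K * (1 + A + 3 * D) + K * (8 * A2 + 12 * D) + K * (80 * D) + K * (2 * ((1 + A) * A2))
      + K * (12 * D) + K * D ≤ 120 * K * depConst (theta μ X 4 4) L := by
    rw [hV, mul_comm (120 : ℝ), mul_assoc, ← mul_add, ← mul_add, ← mul_add, ← mul_add, ← mul_add]
    refine mul_le_mul_of_nonneg_left ?_ hK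
    nlinarith [mul_nonneg hA0 hA20]
  have e : ∫ ω, B ω * (g0 (S k ω) - g0 (S (k - 1) ω)) ∂μ
      - longRunVar μ X / 2 * ∫ ω, B ω * g2 (S (k - 1) ω) ∂μ
      - skewCoeff μ X L * ∫ ω, B ω * g3 (S (k - 1) ω) ∂μ
      = (∫ ω, B ω * (g0 (S k ω) - g0 (S (k - 1) ω)) ∂μ
      - (∑ i ∈ Finset.range (L + 1), lagWeight i * acov μ X i) * ∫ ω, B ω * g2 (S (k - 1) ω) ∂μ
      - skewCoeff μ X L * ∫ ω, B ω * g3 (S (k - 1) ω) ∂μ)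
      + (∑ i ∈ Finset.range (L + 1), lagWeight i * acov μ X i - longRunVar μ X / 2)
      * ∫ ω, B ω * g2 (S (k - 1) ω) ∂μ := by ring
  rw [e]
  refine (abs_add_le _ _).trans (le_trans (add_le_add hE e6) ?_)
  linarith

/-- Variation of the truncated third cumulant. -/
theorem abs_skewCoeff_succ_sub_le (L : ℕ) :
    |skewCoeff μ X (L + 1) - skewCoeff μ X L| ≤ 6 * (((L + 1 : ℕ) : ℝ) * theta μ X 4 4 (L + 1)) := by
  have hterm : ∀ i j : ℕ, max i j = L + 1 →
      |lagWeight₂ i j * thirdMoment μ X i j| ≤ 2 * theta μ X 4 4 (L + 1) := by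
    intro i j h
    refine mul_le_of_abs_le_one (abs_le.2 ⟨by linarith [lagWeight₂_nonneg i j],
      lagWeight₂_le i j⟩) ?_
    rw [← h]
    exact (H.dep_three_max 0 (i := i) (j := j) le_rfl).2 (by lia)
  have e : skewCoeff μ X (L + 1) - skewCoeff μ X L
      = ∑ i ∈ Finset.range (L + 1), lagWeight₂ i (L + 1) * thirdMoment μ X i (L + 1)
        + ∑ j ∈ Finset.range (L + 1), lagWeight₂ (L + 1) j * thirdMoment μ X (L + 1) j
        + lagWeight₂ (L + 1) (L + 1) * thirdMoment μ X (L + 1) (L + 1) := by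
    simp only [skewCoeff]
    rw [Finset.sum_range_succ _ (L + 1)]
    simp only [Finset.sum_range_succ _ (L + 1), Finset.sum_add_distrib]
    ring
  have hsum : ∀ f : ℕ → ℝ, (∀ i < L + 1, |f i| ≤ 2 * theta μ X 4 4 (L + 1)) →
      |∑ i ∈ Finset.range (L + 1), f i| ≤ (L + 1) * (2 * theta μ X 4 4 (L + 1)) := by
    intro f hf
    refine (Finset.abs_sum_le_sum_abs _ _).trans ((Finset.sum_le_sum fun i hi =>
      hf i (Finset.mem_range.1 hi)).trans (le_of_eq ?_))
    simp
  have h1 := hsum (fun i => lagWeight₂ i (L + 1) * thirdMoment μ X i (L + 1))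
    fun i hi => hterm i _ (by lia)
  have h2 := hsum (fun j => lagWeight₂ (L + 1) j * thirdMoment μ X (L + 1) j)
    fun i hi => hterm _ i (by lia)
  have h3 := hterm (L + 1) (L + 1) (max_self _)
  rw [e]
  refine (abs_add_le _ _).trans ((add_le_add ((abs_add_le _ _).trans (add_le_add h1 h2)) h3).trans ?_)
  push_cast
  nlinarith [theta_nonneg (μ := μ) (X := X) 4 4 (L + 1), mul_nonneg (Nat.cast_nonneg (α := ℝ) L)
    (theta_nonneg (μ := μ) (X := X) 4 4 (L + 1))]

end Core

/-! ### Linear operations on Taylor jets -/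

section Jet
variable {g0 g1 g2 g3 f0 f1 f2 f3 : ℝ → ℝ} {K K' : ℝ}

theorem TaylorJet.mono (h : TaylorJet g0 g1 g2 g3 K) (hK : K ≤ K') : TaylorJet g0 g1 g2 g3 K' where
  cont0 := h.cont0
  cont1 := h.cont1
  cont2 := h.cont2
  cont3 := h.cont3
  rem0 s d hd := (h.rem0 s d hd).trans hK
  rem1 s d hd := (h.rem1 s d hd).trans hK
  rem2 s d hd := (h.rem2 s d hd).trans hK
  rem3 s d hd := (h.rem3 s d hd).trans hK

theorem TaylorJet.const (c : ℝ) :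
    TaylorJet (fun _ => c) (fun _ => 0) (fun _ => 0) (fun _ => 0) 0 where
  cont0 := continuous_const
  cont1 := continuous_const
  cont2 := continuous_const
  cont3 := continuous_const
  rem0 s d hd := by simp
  rem1 s d hd := by simp
  rem2 s d hd := by simp
  rem3 s d hd := by simp

theorem TaylorJet.add (hg : TaylorJet g0 g1 g2 g3 K) (hf : TaylorJet f0 f1 f2 f3 K') :
    TaylorJet (fun s => g0 s + f0 s) (fun s => g1 s + f1 s) (fun s => g2 s + f2 s)
      (fun s => g3 s + f3 s) (K + K') where
  cont0 := hg.cont0.add hf.cont0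
  cont1 := hg.cont1.add hf.cont1
  cont2 := hg.cont2.add hf.cont2
  cont3 := hg.cont3.add hf.cont3
  rem0 s d hd := by
    refine le_trans (le_of_eq ?_) ((abs_add_le _ _).trans
      (add_le_add (hg.rem0 s d hd) (hf.rem0 s d hd)))
    congr 1; ring
  rem1 s d hd := by
    refine le_trans (le_of_eq ?_) ((abs_add_le _ _).trans
      (add_le_add (hg.rem1 s d hd) (hf.rem1 s d hd)))
    congr 1; ring
  rem2 s d hd := by
    refine le_trans (le_of_eq ?_) ((abs_add_le _ _).trans
      (add_le_add (hg.rem2 s d hd) (hf.rem2 s d hd)))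
    congr 1; ring
  rem3 s d hd := by
    refine le_trans (le_of_eq ?_) ((abs_add_le _ _).trans
      (add_le_add (hg.rem3 s d hd) (hf.rem3 s d hd)))
    congr 1; ring

theorem TaylorJet.const_mul (hg : TaylorJet g0 g1 g2 g3 K) (c : ℝ) :
    TaylorJet (fun s => c * g0 s) (fun s => c * g1 s) (fun s => c * g2 s)
      (fun s => c * g3 s) (|c| * K) where
  cont0 := hg.cont0.const_mul c
  cont1 := hg.cont1.const_mul c
  cont2 := hg.cont2.const_mul c
  cont3 := hg.cont3.const_mul c
  rem0 s d hd := by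
    refine le_trans (le_of_eq ?_) (mul_le_mul_of_nonneg_left (hg.rem0 s d hd) (abs_nonneg c))
    rw [← abs_mul]; congr 1; ring
  rem1 s d hd := by
    refine le_trans (le_of_eq ?_) (mul_le_mul_of_nonneg_left (hg.rem1 s d hd) (abs_nonneg c))
    rw [← abs_mul]; congr 1; ring
  rem2 s d hd := by
    refine le_trans (le_of_eq ?_) (mul_le_mul_of_nonneg_left (hg.rem2 s d hd) (abs_nonneg c))
    rw [← abs_mul]; congr 1; ring
  rem3 s d hd := by
    refine le_trans (le_of_eq ?_) (mul_le_mul_of_nonneg_left (hg.rem3 s d hd) (abs_nonneg c))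
    rw [← abs_mul]; congr 1; ring

end Jet

/-! ### Trigonometric test functions and the drift contradiction -/

section Trig

theorem nonneg_mul_abs {a : ℝ} (ha : 0 ≤ a) (b : ℝ) : a * |b| = |a * b| := by
  rw [abs_mul, abs_of_nonneg ha]

theorem abs_mul_add_mul_le {a b p q : ℝ} (ha : |a| ≤ 1) (hb : |b| ≤ 1) :
    |a * p + b * q| ≤ |p| + |q| :=
  (abs_add_le _ _).trans (add_le_add (mul_le_of_abs_le_one ha le_rfl)
    (mul_le_of_abs_le_one hb le_rfl))

/-- Taylor estimates for a linear combination of cosine and sine at the point `0`. -/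
theorem trig_taylor {a b x : ℝ} (ha : |a| ≤ 1) (hb : |b| ≤ 1) (hx : |x| ≤ 1) :
    |a * Real.cos x + b * Real.sin x - a - (b * x - a * x ^ 2 / 2 - b * x ^ 3 / 6)| ≤ |x| ^ 4 ∧
    |a * Real.cos x + b * Real.sin x - a - (b * x - a * x ^ 2 / 2)| ≤ |x| ^ 3 ∧
    |a * Real.cos x + b * Real.sin x - a - b * x| ≤ |x| ^ 2 ∧
    |a * Real.cos x + b * Real.sin x - a| ≤ 2 * |x| := by
  have hc := Real.cos_bound hx
  have hx0 := abs_nonneg x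
  have hs : |Real.sin x - (x - x ^ 3 / 6)| ≤ |x| ^ 4 * (5 / 96) := by
    have h := Real.sin_bound hx
    have : |x| ^ 5 ≤ |x| ^ 4 := pow_le_pow_of_le_one hx0 hx (by lia)
    have := pow_nonneg hx0 4
    linarith
  have h4 := pow_nonneg hx0 4
  have h43 : |x| ^ 4 ≤ |x| ^ 3 := pow_le_pow_of_le_one hx0 hx (by lia)
  have h32 : |x| ^ 3 ≤ |x| ^ 2 := pow_le_pow_of_le_one hx0 hx (by lia)
  have h21 : |x| ^ 2 ≤ |x| ^ 1 := pow_le_pow_of_le_one hx0 hx (by lia)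
  have e3 : |x ^ 3 / 6| = |x| ^ 3 / 6 := by rw [abs_div, abs_pow]; norm_num
  have e2 : |x ^ 2 / 2| = |x| ^ 2 / 2 := by rw [abs_div, abs_pow]; norm_num
  have s3 : |Real.sin x - x| ≤ |x| ^ 3 / 6 + |x| ^ 4 * (5 / 96) := by
    have : Real.sin x - x = -(x ^ 3 / 6) + (Real.sin x - (x - x ^ 3 / 6)) := by ring
    rw [this]
    refine (abs_add_le _ _).trans (add_le_add ?_ hs)
    rw [abs_neg, e3]
  have c2 : |Real.cos x - 1| ≤ |x| ^ 2 / 2 + |x| ^ 4 * (5 / 96) := by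
    have : Real.cos x - 1 = -(x ^ 2 / 2) + (Real.cos x - (1 - x ^ 2 / 2)) := by ring
    rw [this]
    refine (abs_add_le _ _).trans (add_le_add ?_ hc)
    rw [abs_neg, e2]
  refine ⟨?_, ?_, ?_, ?_⟩
  · refine le_trans (le_of_eq ?_) ((abs_mul_add_mul_le (p := Real.cos x - (1 - x ^ 2 / 2))
      (q := Real.sin x - (x - x ^ 3 / 6)) ha hb).trans (by linarith))
    congr 1; ring
  · refine le_trans (le_of_eq ?_) ((abs_mul_add_mul_le (p := Real.cos x - (1 - x ^ 2 / 2))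
      (q := Real.sin x - x) ha hb).trans (by linarith))
    congr 1; ring
  · refine le_trans (le_of_eq ?_) ((abs_mul_add_mul_le (p := Real.cos x - 1)
      (q := Real.sin x - x) ha hb).trans (by linarith))
    congr 1; ring
  · have : |Real.sin x| ≤ |x| := Real.abs_sin_le_abs
    refine le_trans (le_of_eq ?_) ((abs_mul_add_mul_le (p := Real.cos x - 1)
      (q := Real.sin x) ha hb).trans (by linarith [pow_one |x|]))
    congr 1; ring

theorem TaylorJet.of_trig {l : ℝ} (hl : 0 ≤ l) (hl1 : l ≤ 1) {a b : ℝ → ℝ}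
    (ca : Continuous a) (cb : Continuous b)
    (ha : ∀ s, |a s| ≤ 1) (hb : ∀ s, |b s| ≤ 1)
    (ea : ∀ s d, a (s + d) = a s * Real.cos (l * d) + b s * Real.sin (l * d))
    (eb : ∀ s d, b (s + d) = b s * Real.cos (l * d) - a s * Real.sin (l * d)) :
    TaylorJet a (fun s => l * b s) (fun s => -l ^ 2 * a s) (fun s => -l ^ 3 * b s) (2 * l ^ 4) where
  cont0 := ca
  cont1 := by fun_prop
  cont2 := by fun_prop
  cont3 := by fun_prop
  rem0 s d hd := by
    have hx : |l * d| ≤ l := by rw [abs_mul, abs_of_nonneg hl]; nlinarith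
    have h := (trig_taylor (ha s) (hb s) (hx.trans hl1)).1
    have h4 := pow_le_pow_left₀ (abs_nonneg _) hx 4
    rw [ea]
    refine le_trans (le_of_eq ?_) ((h.trans h4).trans (by nlinarith [pow_nonneg hl 4]))
    congr 1; ring
  rem1 s d hd := by
    have hx : |l * d| ≤ l := by rw [abs_mul, abs_of_nonneg hl]; nlinarith
    have h := (trig_taylor (hb s) (b := -a s) (by rw [abs_neg]; exact ha s) (hx.trans hl1)).2.1
    have h4 := pow_le_pow_left₀ (abs_nonneg _) hx 3
    rw [eb]
    refine le_trans (le_of_eq ?_) ((mul_le_mul_of_nonneg_left (h.trans h4) hl).trans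
      (by nlinarith [pow_nonneg hl 4]))
    rw [nonneg_mul_abs hl]
    congr 1; ring
  rem2 s d hd := by
    have hx : |l * d| ≤ l := by rw [abs_mul, abs_of_nonneg hl]; nlinarith
    have h := (trig_taylor (ha s) (hb s) (hx.trans hl1)).2.2.1
    have h4 := pow_le_pow_left₀ (abs_nonneg _) hx 2
    rw [ea]
    refine le_trans (le_of_eq ?_) ((mul_le_mul_of_nonneg_left (h.trans h4)
      (pow_nonneg hl 2)).trans (by nlinarith [pow_nonneg hl 4]))
    rw [← abs_neg]
    rw [nonneg_mul_abs (pow_nonneg hl 2)]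
    congr 1; ring
  rem3 s d hd := by
    have hx : |l * d| ≤ l := by rw [abs_mul, abs_of_nonneg hl]; nlinarith
    have h := (trig_taylor (hb s) (b := -a s) (by rw [abs_neg]; exact ha s) (hx.trans hl1)).2.2.2
    have h4 : 2 * |l * d| ≤ 2 * l := by linarith
    rw [eb]
    refine le_trans (le_of_eq ?_) ((mul_le_mul_of_nonneg_left (h.trans h4)
      (pow_nonneg hl 3)).trans (by nlinarith [pow_nonneg hl 4]))
    rw [← abs_neg]
    rw [nonneg_mul_abs (pow_nonneg hl 3)]
    congr 1; ring

theorem TaylorJet.cos {l : ℝ} (hl : 0 ≤ l) (hl1 : l ≤ 1) :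
    TaylorJet (fun s => Real.cos (l * s)) (fun s => l * -Real.sin (l * s))
      (fun s => -l ^ 2 * Real.cos (l * s)) (fun s => -l ^ 3 * -Real.sin (l * s)) (2 * l ^ 4) :=
  TaylorJet.of_trig hl hl1 (by fun_prop) (by fun_prop) (fun s => Real.abs_cos_le_one _)
    (fun s => by rw [abs_neg]; exact Real.abs_sin_le_one _)
    (fun s d => by rw [mul_add, Real.cos_add]; ring)
    (fun s d => by rw [mul_add, Real.sin_add]; ring)

theorem TaylorJet.sin {l : ℝ} (hl : 0 ≤ l) (hl1 : l ≤ 1) :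
    TaylorJet (fun s => Real.sin (l * s)) (fun s => l * Real.cos (l * s))
      (fun s => -l ^ 2 * Real.sin (l * s)) (fun s => -l ^ 3 * Real.cos (l * s)) (2 * l ^ 4) :=
  TaylorJet.of_trig hl hl1 (by fun_prop) (by fun_prop) (fun s => Real.abs_sin_le_one _)
    (fun s => Real.abs_cos_le_one _)
    (fun s d => by rw [mul_add, Real.sin_add])
    (fun s d => by rw [mul_add, Real.cos_add])

/-- From |s| ≤ 1/100 + 25 s² and sin² t ≤ 2 (1 - cos t). The small constant term makes the growth of
1 - cos slow compared with the drift of the cubic test function. -/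
theorem abs_sin_le_of_cos (t : ℝ) : |Real.sin t| ≤ 1 / 100 + 50 * (1 - Real.cos t) := by
  have h := Real.sin_sq_add_cos_sq t
  have h1 := Real.neg_one_le_cos t
  have h2 := Real.cos_le_one t
  rw [← sq_abs] at h
  nlinarith [sq_nonneg (|Real.sin t| - 1 / 50), abs_nonneg (Real.sin t)]

theorem two_cos_sub_le (t : ℝ) :
    |6 - (-2 * Real.cos t + 8 * Real.cos (2 * t))| ≤ 34 * (1 - Real.cos t) := by
  have h1 := Real.neg_one_le_cos t
  have h2 := Real.cos_le_one t
  rw [Real.cos_two_mul, abs_le]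
  constructor <;> nlinarith

/-- The function equals 2 sin t (1 - cos t): it is t³ to leading order, so it detects a third
cumulant, yet it is dominated by 1 - cos t. -/
theorem abs_two_sin_sub_le (t : ℝ) :
    |2 * Real.sin t - Real.sin (2 * t)| ≤ 2 * (1 - Real.cos t) := by
  have h2 := Real.cos_le_one t
  have : 2 * Real.sin t - Real.sin (2 * t) = Real.sin t * (2 * (1 - Real.cos t)) := by
    rw [Real.sin_two_mul]; ring
  rw [this]
  exact mul_le_of_abs_le_one (Real.abs_sin_le_one t)
    (le_of_eq (abs_of_nonneg (by linarith)))

/-- As long as m b ≤ 1/100, `h` stays below 8/10000, so its growth per step is at most 0.06 b while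
`g` gains at least 4 b. When m b is close to 1/100, `g` has gained almost 4/100, which |g| ≤ 2 h
forbids. -/
theorem no_drift {b : ℝ} {h g : ℕ → ℝ} (hb : 0 < b) (h0 : h 0 ≤ 1 / 5000) (h1 : h 1 ≤ 1 / 5000)
    (hg : ∀ m, |g m| ≤ 2 * h m) (hh : ∀ m, h (m + 1) ≤ h m + b * (1 / 50 + 50 * h m))
    (hgs : ∀ m, b * (5 - 34 * h m) ≤ g (m + 1) - g m) : False := by
  -- The first step alone forces `b` to be small, so that integer multiples of `b` come close to
  -- 1/100.
  have hb1 : b ≤ 1 / 3000 := by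
    have := hgs 0
    have a0 := abs_le.1 (hg 0)
    have a1 := abs_le.1 (hg 1)
    simp only [zero_add] at this
    nlinarith
  have key : ∀ m : ℕ, m * b ≤ 1 / 100 →
      h m ≤ 1 / 5000 + 6 / 100 * (m * b) ∧ 4 * (m * b) ≤ g m - g 0 := by
    intro m
    induction m with
    | zero => intro _; simpa using h0
    | succ m ih =>
      intro hm
      push_cast at hm ⊢
      obtain ⟨i1, i2⟩ := ih (by nlinarith)
      have : h m ≤ 8 / 10000 := by nlinarith
      have e1 := hh m
      have e2 := hgs m
      constructor <;> nlinarith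
  set N := ⌊1 / 100 / b⌋₊ with hN
  have hN1 : (N : ℝ) * b ≤ 1 / 100 := by
    have := Nat.floor_le (a := 1 / 100 / b) (by positivity)
    rwa [le_div_iff₀ hb] at this
  have hN2 : 1 / 100 < ((N : ℝ) + 1) * b := by
    have := Nat.lt_floor_add_one (1 / 100 / b)
    rwa [div_lt_iff₀ hb] at this
  obtain ⟨k1, k2⟩ := key N hN1
  have a0 := abs_le.1 (hg 0)
  have a1 := abs_le.1 (hg N)
  nlinarith

end Trig

/-! ### Partial sums as an adapted walk -/

section Walk
variable {Ω : Type*} [mΩ : MeasurableSpace Ω] {μ : Measure Ω} [IsProbabilityMeasure μ]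
  {X : ℤ → Ω → ℝ}

/-- The partial sums, extended by `0` to negative times. -/
def sumUpTo (X : ℤ → Ω → ℝ) (z : ℤ) : Ω → ℝ := partialSum X z.toNat

theorem sumUpTo_step {z : ℤ} (hz : 0 < z) (ω : Ω) :
    sumUpTo X z ω = sumUpTo X (z - 1) ω + X z ω := by
  obtain ⟨n, rfl⟩ : ∃ n : ℕ, z = (n + 1 : ℕ) := ⟨(z - 1).toNat, by lia⟩
  simp only [sumUpTo, partialSum]
  rw [Int.toNat_natCast, show ((n + 1 : ℕ) : ℤ) - 1 = n by push_cast; ring, Int.toNat_natCast,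
    Finset.sum_Icc_succ_top (by lia)]

theorem measurable_sumUpTo (z : ℤ) : Measurable[past X z] (sumUpTo X z) := by
  have e : sumUpTo X z = fun ω => ∑ i ∈ Finset.Icc 1 z.toNat, X (i : ℤ) ω := rfl
  rw [e]
  refine @Finset.measurable_sum ℝ ℕ Ω _ _ _ (past X z) (fun i : ℕ => X i) _ fun i hi =>
    measurable_past ?_
  have := Finset.mem_Icc.1 hi
  lia

variable (H : BddStationary μ X)
include H

theorem adaptedWalk_sumUpTo {z₀ : ℤ} (hz : 0 ≤ z₀) : AdaptedWalk μ X (sumUpTo X) z₀ where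
  meas := measurable_sumUpTo
  step z h ω := sumUpTo_step (by lia) ω
  essBdd z := EssBdd.sum (Y := fun i : ℕ => X i) (Finset.Icc 1 z.toNat) fun i _ => H.essBdd _

theorem abs_sumUpTo_le : ∀ᵐ ω ∂μ, ∀ z : ℤ, |sumUpTo X z ω| ≤ z.toNat := by
  filter_upwards [H.bdd] with ω hω z
  have e : sumUpTo X z ω = ∑ i ∈ Finset.Icc 1 z.toNat, X (i : ℤ) ω := rfl
  rw [e]
  refine (Finset.abs_sum_le_sum_abs _ _).trans ((Finset.sum_le_sum
    fun (i : ℕ) _ => hω i).trans ?_)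
  simp

theorem integral_one_sub_cos_le {l : ℝ} (n : ℕ) :
    ∫ ω, (1 - Real.cos (l * sumUpTo X n ω)) ∂μ ≤ (l * n) ^ 2 / 2 := by
  have := abs_integral_le_of_ae (μ := μ) (Y := fun ω => 1 - Real.cos (l * sumUpTo X n ω))
    (C := (l * n) ^ 2 / 2) (by
      filter_upwards [abs_sumUpTo_le H] with ω hω
      have h1 := hω n
      rw [Int.toNat_natCast] at h1
      have h2 := Real.one_sub_sq_div_two_le_cos (x := l * sumUpTo X n ω)
      have h3 := Real.cos_le_one (l * sumUpTo X n ω)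
      rw [abs_of_nonneg (by linarith)]
      have h4 : (l * sumUpTo X n ω) ^ 2 ≤ (l * n) ^ 2 := by
        rw [mul_pow, mul_pow]
        refine mul_le_mul_of_nonneg_left ?_ (sq_nonneg l)
        exact sq_le_sq' (abs_le.1 h1).1 (abs_le.1 h1).2
      linarith)
  exact (le_abs_self _).trans this

end Walk

/-! ### The third cumulant at scales of small variance -/

section Skew
variable {Ω : Type*} [mΩ : MeasurableSpace Ω] {μ : Measure Ω} [IsProbabilityMeasure μ]
  {X : ℤ → Ω → ℝ} (H : BddStationary μ X)
  (hs : Summable fun k : ℕ => ((k + 1 : ℕ) : ℝ) * theta μ X 4 4 (k + 1))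
include H hs

/-- Unweighted fourth order expansion for functions with globally bounded derivatives. -/
theorem expansion_global {L : ℕ} (hL : 1 ≤ L) {k : ℤ} (hk : 3 * L + 1 ≤ k)
    {g0 g1 g2 g3 : ℝ → ℝ} {K : ℝ} (hK : 0 ≤ K) (hg : TaylorJet g0 g1 g2 g3 K)
    (hK1 : ∀ s, |g1 s| ≤ K * L ^ 3) (hK2 : ∀ s, |g2 s| ≤ K * L ^ 2)
    (hK3 : ∀ s, |g3 s| ≤ K * L) :
    |∫ ω, g0 (sumUpTo X k ω) ∂μ - ∫ ω, g0 (sumUpTo X (k - 1) ω) ∂μ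
      - longRunVar μ X / 2 * ∫ ω, g2 (sumUpTo X (k - 1) ω) ∂μ
      - skewCoeff μ X L * ∫ ω, g3 (sumUpTo X (k - 1) ω) ∂μ|
      ≤ 120 * K * depConst (theta μ X 4 4) L := by
  have hS := adaptedWalk_sumUpTo H (z₀ := k - 3 * L - 1) (by lia)
  have h := expansion_scaled H hs hL (B := fun _ => 1) hK hS measurable_const (by simp) hg
    (fun z _ => Eventually.of_forall fun ω => by simpa using hK1 _)
    (fun z _ => Eventually.of_forall fun ω => by simpa using hK2 _)
    (fun z _ => Eventually.of_forall fun ω => by simpa using hK3 _)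
  simp only [one_mul] at h
  rwa [integral_sub ((hS.essBdd _).comp_continuous hg.cont0).integrable
    ((hS.essBdd _).comp_continuous hg.cont0).integrable] at h

set_option maxHeartbeats 2000000 in
/-- At a scale where the variance is dominated by the remainder, so is the third cumulant. -/
theorem abs_skewCoeff_le_of_small_var {L : ℕ} (hL : 1 ≤ L) (hv : 0 ≤ longRunVar μ X)
    (hv2 : longRunVar μ X * L ^ 2 ≤ 2 * depConst (theta μ X 4 4) L) :
    |skewCoeff μ X L| * L ≤ 20000000000000 * depConst (theta μ X 4 4) L := by
  by_contra hcon
  push Not at hcon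
  have hV := one_le_depConst (theta_nonneg (μ := μ) (X := X) 4 4) hs (Nat.cast_nonneg L)
  set V := depConst (theta μ X 4 4) L with hVdef
  set v := longRunVar μ X with hvdef
  set κ := skewCoeff μ X L with hκ
  have hL1 : (1 : ℝ) ≤ L := by exact_mod_cast hL
  have hL0 : (0 : ℝ) < L := by linarith
  -- At this frequency l⁴ is of order L⁻⁴, so each expansion has error of order ν = V/L⁴. The
  -- initial 3L + 1 steps move the phase l S by at most 4/1000.
  obtain ⟨l, hl⟩ : ∃ l : ℝ, l = 1 / 1000 / L := ⟨_, rfl⟩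
  have hlL : l * L = 1 / 1000 := by rw [hl]; field_simp
  have hl0 : 0 < l := by rw [hl]; positivity
  have hl1 : l ≤ 1 / 1000 := by nlinarith
  obtain ⟨ν, hν⟩ : ∃ ν : ℝ, ν = V / L ^ 4 := ⟨_, rfl⟩
  have hνL : ν * L ^ 4 = V := by rw [hν]; field_simp
  have hν0 : 0 < ν := by rw [hν]; positivity
  have hvν : v * l ^ 2 ≤ ν / 1000 := by
    have e : v * l ^ 2 = v * L ^ 2 * (1 / 1000000) / L ^ 4 := by rw [hl]; field_simp; norm_num
    rw [e, hν, div_div, mul_comm (L ^ 4 : ℝ), ← div_div]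
    exact div_le_div_of_nonneg_right (by linarith) (by positivity)
  -- The strength of the third order drift. The negated conclusion gives b > 2·10¹³·10⁻⁹ ν = 20000
  -- ν, so all errors, including the variance term, are small fractions of b.
  obtain ⟨b, hb⟩ : ∃ b : ℝ, b = |κ| * l ^ 3 := ⟨_, rfl⟩
  have hbν : 15000 * ν < b := by
    have e : b = |κ| * L * (1 / 1000000000) / L ^ 4 := by rw [hb, hl]; field_simp; norm_num
    rw [e, hν, ← mul_div_assoc]
    exact div_lt_div_of_pos_right (by linarith) (by positivity)
  have hb0 : 0 < b := by linarith
  have hcL : ∀ j : ℕ, j ≤ 3 → l ^ j ≤ 1 / L ^ 4 * L ^ (4 - j) := by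
    intro j hj
    have h1 : l ≤ 1 / L := by rw [hl]; gcongr; norm_num
    have h2 : 1 / (L : ℝ) ^ 4 * L ^ (4 - j) = (1 / L) ^ j := by
      interval_cases j <;> field_simp <;> simp
    rw [h2]
    exact pow_le_pow_left₀ hl0.le h1 j
  have hl4 : l ^ 4 ≤ 1 / 1000 * (1 / L ^ 4) := by
    have : l ^ 4 = 1 / 1000000000000 * (1 / L ^ 4) := by rw [hl]; field_simp; norm_num
    rw [this]
    gcongr; norm_num
  have hKp : (0 : ℝ) ≤ 1 / L ^ 4 := by positivity
  have hKp' : (0 : ℝ) ≤ ((L : ℝ) ^ 4)⁻¹ := by positivity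
  set S := sumUpTo X with hS
  have hSb : ∀ z, EssBdd μ (S z) := fun z => (adaptedWalk_sumUpTo H le_rfl).essBdd z
  -- Time starts at 3L, since the expansion needs 3L + 1 steps of history. `h` measures the spread
  -- of the phase; `g` is the cubic detector.
  set h : ℕ → ℝ := fun m => ∫ ω, (1 - Real.cos (l * S (3 * L + m : ℕ) ω)) ∂μ with hh
  set g : ℕ → ℝ := fun m => ∫ ω, (2 * Real.sin (l * S (3 * L + m : ℕ) ω)
    - Real.sin (2 * l * S (3 * L + m : ℕ) ω)) ∂μ with hg
  have bh : ∀ z, EssBdd μ (fun ω => 1 - Real.cos (l * S z ω)) := fun z =>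
    (hSb z).comp_continuous (f := fun s => 1 - Real.cos (l * s)) (by fun_prop)
  have bg : ∀ z, EssBdd μ (fun ω => 2 * Real.sin (l * S z ω) - Real.sin (2 * l * S z ω)) :=
    fun z => (hSb z).comp_continuous (f := fun s => 2 * Real.sin (l * s) - Real.sin (2 * l * s))
      (by fun_prop)
  have jh : TaylorJet (fun s => 1 - Real.cos (l * s)) (fun s => l * Real.sin (l * s))
      (fun s => l ^ 2 * Real.cos (l * s)) (fun s => -l ^ 3 * Real.sin (l * s)) (1 / L ^ 4) := by
    have := ((TaylorJet.const 1).add ((TaylorJet.cos hl0.le (by linarith)).const_mul (-1))).mono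
      (K' := 1 / L ^ 4) (by norm_num; norm_num at hl4; linarith)
    convert this using 2 <;> ring
  have jg : TaylorJet (fun s => 2 * Real.sin (l * s) - Real.sin (2 * l * s))
      (fun s => 2 * l * (Real.cos (l * s) - Real.cos (2 * l * s)))
      (fun s => l ^ 2 * (-2 * Real.sin (l * s) + 4 * Real.sin (2 * l * s)))
      (fun s => l ^ 3 * (-2 * Real.cos (l * s) + 8 * Real.cos (2 * l * s))) (10 * (1 / L ^ 4)) := by
    have := (((TaylorJet.sin hl0.le (by linarith)).const_mul 2).add
      ((TaylorJet.sin (l := 2 * l) (by linarith) (by linarith)).const_mul (-1))).mono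
      (K' := 10 * (1 / L ^ 4)) (by norm_num; norm_num at hl4; rw [mul_pow]; linarith)
    convert this using 2 <;> ring
  have eh : ∀ m, |h (m + 1) - h m - v / 2 * ∫ ω, l ^ 2 * Real.cos (l * S (3 * L + m : ℕ) ω) ∂μ
      - κ * ∫ ω, -l ^ 3 * Real.sin (l * S (3 * L + m : ℕ) ω) ∂μ| ≤ 120 * ν := by
    intro m
    have c1 := hcL 1 (by lia)
    have c2 := hcL 2 (by lia)
    have c3 := hcL 3 (by lia)
    have := expansion_global H hs hL (k := (3 * L + (m + 1) : ℕ)) (by push_cast; lia) hKp jh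
      (fun s => by
        rw [abs_mul, abs_of_pos hl0]
        nlinarith [Real.abs_sin_le_one (l * s), abs_nonneg (Real.sin (l * s))])
      (fun s => by
        rw [abs_mul, abs_of_nonneg (pow_nonneg hl0.le 2)]
        nlinarith [Real.abs_cos_le_one (l * s), abs_nonneg (Real.cos (l * s)), pow_nonneg hl0.le 2])
      (fun s => by
        rw [abs_mul, abs_neg, abs_of_nonneg (pow_nonneg hl0.le 3)]
        simp only [Nat.reduceSub, pow_one] at c3
        nlinarith [Real.abs_sin_le_one (l * s), abs_nonneg (Real.sin (l * s)), pow_nonneg hl0.le 3])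
    rw [show ((3 * L + (m + 1) : ℕ) : ℤ) - 1 = (3 * L + m : ℕ) by push_cast; ring] at this
    refine this.trans (le_of_eq ?_)
    rw [hν]; ring
  have eg : ∀ m, |g (m + 1) - g m
      - v / 2 * ∫ ω, l ^ 2 * (-2 * Real.sin (l * S (3 * L + m : ℕ) ω)
        + 4 * Real.sin (2 * l * S (3 * L + m : ℕ) ω)) ∂μ
      - κ * ∫ ω, l ^ 3 * (-2 * Real.cos (l * S (3 * L + m : ℕ) ω)
        + 8 * Real.cos (2 * l * S (3 * L + m : ℕ) ω)) ∂μ| ≤ 1200 * ν := by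
    intro m
    have c1 := hcL 1 (by lia)
    have c2 := hcL 2 (by lia)
    have c3 := hcL 3 (by lia)
    have := expansion_global H hs hL (k := (3 * L + (m + 1) : ℕ)) (by push_cast; lia)
      (mul_nonneg (by norm_num) hKp) jg
      (fun s => by
        rw [abs_mul, abs_of_pos (by linarith : 0 < 2 * l)]
        have h1 := (abs_sub _ _).trans
          (add_le_add (Real.abs_cos_le_one (l * s)) (Real.abs_cos_le_one (2 * l * s)))
        simp only [Nat.reduceSub, pow_one] at c1
        have h2 : 0 ≤ 1 / (L : ℝ) ^ 4 * L ^ 3 := by positivity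
        nlinarith)
      (fun s => by
        rw [abs_mul, abs_of_nonneg (pow_nonneg hl0.le 2)]
        have h1 : |-2 * Real.sin (l * s) + 4 * Real.sin (2 * l * s)| ≤ 6 := by
          have a1 := abs_le.1 (Real.abs_sin_le_one (l * s))
          have a2 := abs_le.1 (Real.abs_sin_le_one (2 * l * s))
          rw [abs_le]; constructor <;> linarith
        simp only [Nat.reduceSub] at c2
        have h2 : 0 ≤ 1 / (L : ℝ) ^ 4 * L ^ 2 := by positivity
        nlinarith [pow_nonneg hl0.le 2])
      (fun s => by
        rw [abs_mul, abs_of_nonneg (pow_nonneg hl0.le 3)]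
        have h1 : |-2 * Real.cos (l * s) + 8 * Real.cos (2 * l * s)| ≤ 10 := by
          have a1 := abs_le.1 (Real.abs_cos_le_one (l * s))
          have a2 := abs_le.1 (Real.abs_cos_le_one (2 * l * s))
          rw [abs_le]; constructor <;> linarith
        simp only [Nat.reduceSub, pow_one] at c3
        have h2 : 0 ≤ 1 / (L : ℝ) ^ 4 * L := by positivity
        nlinarith [pow_nonneg hl0.le 3])
    rw [show ((3 * L + (m + 1) : ℕ) : ℤ) - 1 = (3 * L + m : ℕ) by push_cast; ring] at this
    refine this.trans (le_of_eq ?_)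
    rw [hν]; ring
  -- growth of `h`
  have gh : ∀ m, h (m + 1) ≤ h m + b * (1 / 50 + 50 * h m) := by
    intro m
    have e1 := (abs_le.1 (eh m)).2
    have i1 : |∫ ω, l ^ 2 * Real.cos (l * S (3 * L + m : ℕ) ω) ∂μ| ≤ l ^ 2 :=
      abs_integral_le_of_ae (Eventually.of_forall fun ω => by
        rw [abs_mul, abs_of_nonneg (pow_nonneg hl0.le 2)]
        exact mul_le_of_le_one_right (pow_nonneg hl0.le 2) (Real.abs_cos_le_one _))
    have i2 : |∫ ω, -l ^ 3 * Real.sin (l * S (3 * L + m : ℕ) ω) ∂μ|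
        ≤ l ^ 3 * (1 / 100 + 50 * h m) := by
      rw [integral_const_mul, abs_mul, abs_neg, abs_of_nonneg (pow_nonneg hl0.le 3)]
      refine mul_le_mul_of_nonneg_left ?_ (pow_nonneg hl0.le 3)
      refine abs_integral_le_integral_abs.trans ?_
      have e : 1 / 100 + 50 * h m
          = ∫ ω, (1 / 100 + 50 * (1 - Real.cos (l * S (3 * L + m : ℕ) ω))) ∂μ := by
        rw [integral_add (integrable_const _) ((bh _).integrable.const_mul _), integral_const_mul]
        simp [hh]
      rw [e]
      refine integral_mono ?_ ?_ fun ω => abs_sin_le_of_cos _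
      · exact ((hSb _).comp_continuous (f := fun s => |Real.sin (l * s)|) (by fun_prop)).integrable
      · exact ((EssBdd.const _).add ((EssBdd.const _).mul (bh _))).integrable
    have j1 : v / 2 * ∫ ω, l ^ 2 * Real.cos (l * S (3 * L + m : ℕ) ω) ∂μ ≤ ν := by
      have := (abs_le.1 i1).2
      nlinarith
    have j2 : κ * ∫ ω, -l ^ 3 * Real.sin (l * S (3 * L + m : ℕ) ω) ∂μ
        ≤ b * (1 / 100 + 50 * h m) := by
      refine (le_abs_self _).trans ?_
      rw [abs_mul, hb, mul_assoc]
      exact mul_le_mul_of_nonneg_left i2 (abs_nonneg κ)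
    nlinarith
  -- drift of `g`
  have hgh : ∀ m, |g m| ≤ 2 * h m := by
    intro m
    refine abs_integral_le_integral_abs.trans ?_
    rw [hh, ← integral_const_mul]
    refine integral_mono ?_ ((bh _).integrable.const_mul _) fun ω => ?_
    · exact (bg _).integrable.abs
    · have := abs_two_sin_sub_le (l * S (3 * L + m : ℕ) ω)
      simpa only [mul_assoc] using this
  -- The sign of the third cumulant, which orients the drift upwards.
  obtain ⟨ε, hε, hεκ⟩ : ∃ ε : ℝ, |ε| = 1 ∧ ε * κ = |κ| := by
    rcases le_total 0 κ with h | h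
    · exact ⟨1, by simp, by rw [abs_of_nonneg h, one_mul]⟩
    · exact ⟨-1, by simp, by rw [abs_of_nonpos h]; ring⟩
  -- At phase 0 the third derivative factor -2 cos + 8 cos equals 6; it loses at most 34 h m by
  -- spreading, and one further unit of b covers the variance term and the remainder.
  have gg : ∀ m, b * (5 - 34 * h m) ≤ ε * g (m + 1) - ε * g m := by
    intro m
    have i1 : |∫ ω, l ^ 2 * (-2 * Real.sin (l * S (3 * L + m : ℕ) ω)
        + 4 * Real.sin (2 * l * S (3 * L + m : ℕ) ω)) ∂μ| ≤ 6 * l ^ 2 :=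
      abs_integral_le_of_ae (Eventually.of_forall fun ω => by
        rw [abs_mul, abs_of_nonneg (pow_nonneg hl0.le 2), mul_comm]
        refine mul_le_mul_of_nonneg_right ?_ (pow_nonneg hl0.le 2)
        have a1 := abs_le.1 (Real.abs_sin_le_one (l * S (3 * L + m : ℕ) ω))
        have a2 := abs_le.1 (Real.abs_sin_le_one (2 * l * S (3 * L + m : ℕ) ω))
        rw [abs_le]; constructor <;> linarith)
    set J := ∫ ω, (-2 * Real.cos (l * S (3 * L + m : ℕ) ω)
        + 8 * Real.cos (2 * l * S (3 * L + m : ℕ) ω)) ∂μ with hJ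
    have bJ : EssBdd μ (fun ω => -2 * Real.cos (l * S (3 * L + m : ℕ) ω)
        + 8 * Real.cos (2 * l * S (3 * L + m : ℕ) ω)) :=
      (hSb _).comp_continuous (f := fun s => -2 * Real.cos (l * s) + 8 * Real.cos (2 * l * s))
        (by fun_prop)
    have i2 : |6 - J| ≤ 34 * h m := by
      have e : 6 - J = ∫ ω, (6 - (-2 * Real.cos (l * S (3 * L + m : ℕ) ω)
        + 8 * Real.cos (2 * l * S (3 * L + m : ℕ) ω))) ∂μ := by
        rw [integral_sub (integrable_const _) bJ.integrable]
        simp [hJ]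
      rw [e]
      refine abs_integral_le_integral_abs.trans ?_
      rw [hh, ← integral_const_mul]
      refine integral_mono ?_ ((bh _).integrable.const_mul _) fun ω => ?_
      · exact ((EssBdd.const _).sub bJ).integrable.abs
      · have := two_cos_sub_le (l * S (3 * L + m : ℕ) ω)
        simpa only [mul_assoc] using this
    have e1 := eg m
    rw [integral_const_mul (l ^ 3)] at e1
    set I := ∫ ω, l ^ 2 * (-2 * Real.sin (l * S (3 * L + m : ℕ) ω)
        + 4 * Real.sin (2 * l * S (3 * L + m : ℕ) ω)) ∂μ with hI
    have e2 : |ε * (g (m + 1) - g m - v / 2 * I - κ * (l ^ 3 * J))| ≤ 1200 * ν := by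
      rw [abs_mul, hε, one_mul]; exact e1
    have e3 : ε * (g (m + 1) - g m - v / 2 * I - κ * (l ^ 3 * J))
        = ε * g (m + 1) - ε * g m - v / 2 * (ε * I) - b * J := by
      rw [hb, ← hεκ]; ring
    rw [e3] at e2
    have j1 : |v / 2 * (ε * I)| ≤ 3 * (v * l ^ 2) := by
      rw [abs_mul, abs_mul, hε, one_mul, abs_of_nonneg (by linarith)]
      nlinarith
    have j2 := (abs_le.1 i2).2
    have j3 := (abs_le.1 e2).1
    have j4 := (abs_le.1 j1).1
    nlinarith [mul_le_mul_of_nonneg_left j2 hb0.le]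
  have hstart : ∀ m ≤ 1, h m ≤ 1 / 5000 := by
    intro m hm
    refine (integral_one_sub_cos_le H (3 * L + m)).trans ?_
    have h1 : l * ((3 * L + m : ℕ) : ℝ) ≤ 1 / 250 := by
      have : (m : ℝ) ≤ 1 := by exact_mod_cast hm
      push_cast
      nlinarith
    have h2 : 0 ≤ l * ((3 * L + m : ℕ) : ℝ) := by positivity
    nlinarith
  exact no_drift (g := fun m => ε * g m) hb0 (hstart 0 (by lia)) (hstart 1 le_rfl)
    (fun m => by rw [abs_mul, hε, one_mul]; exact hgh m) gh gg

end Skew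

/-! ### Nonnegativity of the variance and the cumulant dichotomy -/

section Variance
variable {Ω : Type*} [mΩ : MeasurableSpace Ω] {μ : Measure Ω} [IsProbabilityMeasure μ]
  {X : ℤ → Ω → ℝ} (H : BddStationary μ X)
  (hs : Summable fun k : ℕ => ((k + 1 : ℕ) : ℝ) * theta μ X 4 4 (k + 1))
include H

theorem sum_Icc_one_eq_range (f : ℕ → ℝ) (N : ℕ) :
    ∑ k ∈ Finset.Icc 1 N, f k = ∑ k ∈ Finset.range N, f (k + 1) := by
  induction N with
  | zero => simp
  | succ n ih => rw [Finset.sum_Icc_succ_top (by lia), ih, Finset.sum_range_succ]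

theorem integral_partialSum_sq (n : ℕ) : ∫ ω, partialSum X n ω ^ 2 ∂μ
    = ∑ i ∈ Finset.range n, (acov μ X 0 + 2 * ∑ k ∈ Finset.range i, acov μ X (k + 1)) := by
  have hb : ∀ n, EssBdd μ (partialSum X n) := fun n =>
    EssBdd.sum (Y := fun i : ℕ => X i) (Finset.Icc 1 n) fun i _ => H.essBdd _
  induction n with
  | zero => simp [partialSum]
  | succ n ih =>
    rw [Finset.sum_range_succ, ← ih]
    have e : ∀ ω, partialSum X (n + 1) ω = partialSum X n ω + X (n + 1 : ℕ) ω := fun ω => by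
      simp only [partialSum]
      rw [Finset.sum_Icc_succ_top (by lia)]
    have e2 : ∀ ω, partialSum X (n + 1) ω ^ 2 = partialSum X n ω ^ 2
        + (2 * (partialSum X n ω * X (n + 1 : ℕ) ω)
          + X (n + 1 : ℕ) ω * X (n + 1 : ℕ) ω) := fun ω => by rw [e]; ring
    have b1 := (hb n).mul (H.essBdd (n + 1 : ℕ))
    have e3 : ∫ ω, X (n + 1 : ℕ) ω * X (n + 1 : ℕ) ω ∂μ = acov μ X 0 := by
      have := H.integral_two (n + 1 : ℕ) 0
      simpa using this
    have e4 : ∫ ω, partialSum X n ω * X (n + 1 : ℕ) ω ∂μ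
        = ∑ k ∈ Finset.range n, acov μ X (k + 1) := by
      simp only [partialSum, Finset.sum_mul]
      rw [integral_finsetSum _ fun i _ => (H.essBdd_two _ _).integrable,
        sum_Icc_one_eq_range H (fun i : ℕ => ∫ ω, X i ω * X (n + 1 : ℕ) ω ∂μ),
        ← Finset.sum_range_reflect]
      refine Finset.sum_congr rfl fun k hk => ?_
      have hk := Finset.mem_range.1 hk
      have := H.integral_two (n - 1 - k + 1 : ℕ) (k + 1)
      rw [← this, show ((n - 1 - k + 1 : ℕ) : ℤ) + (k + 1 : ℕ) = (n + 1 : ℕ) by lia]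
    simp only [e2]
    rw [integral_add ((hb n).pow 2).integrable (((EssBdd.const 2).mul b1).add
      (H.essBdd_two _ _)).integrable, integral_add ((EssBdd.const 2).mul b1).integrable
      (H.essBdd_two _ _).integrable, integral_const_mul, e3, e4]
    ring

include hs

theorem tendsto_longRunVar : Tendsto (fun N : ℕ => acov μ X 0
    + 2 * ∑ k ∈ Finset.range N, acov μ X (k + 1)) atTop (𝓝 (longRunVar μ X)) :=
  tendsto_const_nhds.add ((summable_acov H hs).hasSum.tendsto_sum_nat.const_mul 2)

/-- E S_n² / n is the Cesàro mean of the partial sums of the variance series, so its limit is σ². -/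
theorem longRunVar_nonneg : 0 ≤ longRunVar μ X := by
  refine ge_of_tendsto' (tendsto_longRunVar H hs).cesaro fun n => ?_
  rw [← integral_partialSum_sq H]
  exact mul_nonneg (by positivity) (integral_nonneg fun ω => sq_nonneg _)

theorem longRunVar_le {x : ℝ} (hx : 0 ≤ x) : longRunVar μ X ≤ 2 * depConst (theta μ X 4 4) x := by
  have h0 : ∀ k, 0 ≤ theta μ X 4 4 k := theta_nonneg 4 4
  have h1 : ∑' k : ℕ, acov μ X (k + 1) ≤ ∑' k : ℕ, theta μ X 4 4 (k + 1) :=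
    Summable.tsum_le_tsum (fun k => (le_abs_self _).trans (H.abs_acov_le _)) (summable_acov H hs)
      (summable_of_summable_mul h0 hs)
  have h2 := (le_abs_self _).trans (H.abs_acov_le_one 0)
  have h3 := tsum_mul_min_nonneg h0 hs hx
  have h4 : 0 ≤ ∑' k : ℕ, theta μ X 4 4 (k + 1) := tsum_nonneg fun k => h0 _
  have h5 : 0 ≤ ∑' k : ℕ, ((k + 1 : ℕ) : ℝ) * theta μ X 4 4 (k + 1) :=
    tsum_nonneg fun k => mul_nonneg (by positivity) (h0 _)
  unfold longRunVar depConst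
  nlinarith

/-- The increments of κ beyond lag L are bounded by 6 k θ(k) with k > L; multiplied by L, they are
terms of 6 ∑ k (k ∧ L) θ(k). -/
theorem abs_skewCoeff_sub_le {L M : ℕ} (hLM : L ≤ M) :
    |skewCoeff μ X M - skewCoeff μ X L| * L ≤ 6 * depConst (theta μ X 4 4) L := by
  have h0 : ∀ k, 0 ≤ theta μ X 4 4 k := theta_nonneg 4 4
  have h1 : ∀ n, |skewCoeff μ X (L + n) - skewCoeff μ X L|
      ≤ 6 * ∑ k ∈ Finset.range n, ((L + k + 1 : ℕ) : ℝ) * theta μ X 4 4 (L + k + 1) := by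
    intro n
    induction n with
    | zero => simp
    | succ n ih =>
      rw [Finset.sum_range_succ, mul_add]
      refine (abs_sub_le _ (skewCoeff μ X (L + n)) _).trans ?_
      rw [add_comm]
      exact add_le_add ih (abs_skewCoeff_succ_sub_le H hs (L + n))
  obtain ⟨n, rfl⟩ := Nat.exists_eq_add_of_le hLM
  have hS := summable_mul_min h0 hs (Nat.cast_nonneg L)
  have h2 : (∑ k ∈ Finset.range n, ((L + k + 1 : ℕ) : ℝ) * theta μ X 4 4 (L + k + 1)) * L
      ≤ ∑' k : ℕ, ((k + 1 : ℕ) : ℝ) * min ((k + 1 : ℕ) : ℝ) L * theta μ X 4 4 (k + 1) := by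
    have h3 := hS.sum_le_tsum (Finset.range (L + n)) fun k _ => mul_nonneg (mul_nonneg
      (by positivity) (le_min (by positivity) (by positivity))) (h0 _)
    refine le_trans ?_ h3
    rw [Finset.sum_range_add, Finset.sum_mul]
    have h4 : 0 ≤ ∑ k ∈ Finset.range L, ((k + 1 : ℕ) : ℝ) * min ((k + 1 : ℕ) : ℝ) L
        * theta μ X 4 4 (k + 1) := Finset.sum_nonneg fun k _ => mul_nonneg (mul_nonneg
      (by positivity) (le_min (by positivity) (by positivity))) (h0 _)
    refine le_trans (Finset.sum_le_sum fun k _ => ?_) (le_add_of_nonneg_left h4)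
    rw [min_eq_right (by exact_mod_cast (by lia))]
    exact le_of_eq (by ring)
  have h5 : 0 ≤ ∑' k : ℕ, theta μ X 4 4 (k + 1) := tsum_nonneg fun k => h0 _
  have h6 : 0 ≤ ∑' k : ℕ, ((k + 1 : ℕ) : ℝ) * theta μ X 4 4 (k + 1) :=
    tsum_nonneg fun k => mul_nonneg (by positivity) (h0 _)
  have h7 := mul_le_mul_of_nonneg_right (h1 n) (Nat.cast_nonneg (α := ℝ) L)
  have h8 : ∑' k : ℕ, ((k + 1 : ℕ) : ℝ) * min ((k + 1 : ℕ) : ℝ) L * theta μ X 4 4 (k + 1)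
      ≤ depConst (theta μ X 4 4) L := by
    unfold depConst
    exact le_add_of_nonneg_left (by positivity)
  linarith

/-- The third cumulant is controlled by the variance and the dependence coefficients. -/
theorem skewCoeff_bound {L : ℕ} (hL : 1 ≤ L) :
    skewCoeff μ X L ^ 2 ≤ 10 ^ 27 * longRunVar μ X * depConst (theta μ X 4 4) L
      ∨ |skewCoeff μ X L| * L ≤ 10 ^ 27 * depConst (theta μ X 4 4) L := by
  classical
  have h0 : ∀ k, 0 ≤ theta μ X 4 4 k := theta_nonneg 4 4
  have hv := longRunVar_nonneg H hs
  set P : ℕ → Prop := fun m => longRunVar μ X * (m : ℝ) ^ 2 ≤ 2 * depConst (theta μ X 4 4) m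
  by_cases hPL : P L
  · right
    have h1 := abs_skewCoeff_le_of_small_var H hs hL hv hPL
    have h2 := one_le_depConst h0 hs (Nat.cast_nonneg L)
    linarith
  · left
    have hP1 : P 1 := by
      have := longRunVar_le H hs (x := (1 : ℕ)) (by simp)
      simpa [P] using this
    -- `M` is the largest good scale up to `L`. Its goodness bounds κ_M, and the failure at M + 1
    -- gives the reverse inequality V(M) ≤ 2 σ² M².
    obtain ⟨M, hM1, hML, hPM, hPM1⟩ : ∃ M, 1 ≤ M ∧ M < L ∧ P M ∧ ¬ P (M + 1) := by
      have a1 : 1 ≤ Nat.findGreatest P L := Nat.le_findGreatest hL hP1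
      have a2 : P (Nat.findGreatest P L) := Nat.findGreatest_spec hL hP1
      have a3 : Nat.findGreatest P L < L := lt_of_le_of_ne (Nat.findGreatest_le L) fun h =>
        hPL (h ▸ a2)
      exact ⟨_, a1, a3, a2, Nat.findGreatest_is_greatest (Nat.lt_succ_self _) a3⟩
    have hM : (1 : ℝ) ≤ M := by exact_mod_cast hM1
    have k1 := abs_skewCoeff_le_of_small_var H hs hM1 hv hPM
    have k2 := abs_skewCoeff_sub_le H hs hML.le
    have hV := one_le_depConst h0 hs (Nat.cast_nonneg M)
    have hVM := depConst_mono h0 hs (Nat.cast_nonneg M) (y := (M + 1 : ℕ)) (by simp)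
    have hVL := depConst_mono h0 hs (Nat.cast_nonneg M) (y := L) (by exact_mod_cast hML.le)
    have hV2 : depConst (theta μ X 4 4) M ≤ 2 * longRunVar μ X * M ^ 2 := by
      have : 2 * depConst (theta μ X 4 4) (M + 1 : ℕ)
          < longRunVar μ X * ((M + 1 : ℕ) : ℝ) ^ 2 := not_le.1 hPM1
      have h2 : ((M + 1 : ℕ) : ℝ) ^ 2 ≤ 4 * M ^ 2 := by push_cast; nlinarith
      nlinarith
    set V := depConst (theta μ X 4 4) M
    have k3 : |skewCoeff μ X L| * M ≤ 2 * 10 ^ 13 * V + 6 * V := by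
      have : |skewCoeff μ X L| ≤ |skewCoeff μ X L - skewCoeff μ X M| + |skewCoeff μ X M| := by
        have := abs_add_le (skewCoeff μ X L - skewCoeff μ X M) (skewCoeff μ X M)
        simpa using this
      nlinarith
    have k4 : (|skewCoeff μ X L| * M) ^ 2 ≤ (2 * 10 ^ 13 * V + 6 * V) ^ 2 :=
      pow_le_pow_left₀ (by positivity) k3 2
    rw [mul_pow, sq_abs] at k4
    -- One of the two factors V in the squared bound is exchanged for 2 σ² M², after which M²
    -- cancels.
    have k5 : skewCoeff μ X L ^ 2 * M ^ 2 ≤ 10 ^ 27 * longRunVar μ X * V * M ^ 2 := by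
      refine k4.trans ?_
      nlinarith
    have k6 : skewCoeff μ X L ^ 2 ≤ 10 ^ 27 * longRunVar μ X * V :=
      le_of_mul_le_mul_right k5 (by positivity)
    exact k6.trans (mul_le_mul_of_nonneg_left hVL (by positivity))

end Variance

/-- Averaging over a Rademacher step of size `h`. -/
noncomputable def rademacherAvg (h : ℝ) (g : ℝ → ℝ) : ℝ → ℝ := fun s => (g (s + h) + g (s - h)) / 2

/-- Averaging over `r` independent Rademacher steps of size `h`. -/
noncomputable def rademacherIter (h : ℝ) : ℕ → (ℝ → ℝ) → ℝ → ℝ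
  | 0, g => g
  | r + 1, g => rademacherAvg h (rademacherIter h r g)

/-! ### Rademacher averages of truncated fourth powers -/

section Rademacher
variable {h : ℝ} {g f : ℝ → ℝ} {g0 g1 g2 g3 : ℝ → ℝ} {K : ℝ} {r : ℕ}

theorem rademacherIter_mono (hgf : ∀ s, g s ≤ f s) (s : ℝ) :
    rademacherIter h r g s ≤ rademacherIter h r f s := by
  induction r generalizing s with
  | zero => exact hgf s
  | succ r ih =>
    simp only [rademacherIter, rademacherAvg]
    linarith [ih (s + h), ih (s - h)]

theorem rademacherIter_nonneg (hg : ∀ s, 0 ≤ g s) (s : ℝ) : 0 ≤ rademacherIter h r g s := by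
  induction r generalizing s with
  | zero => exact hg s
  | succ r ih =>
    simp only [rademacherIter, rademacherAvg]
    linarith [ih (s + h), ih (s - h)]

theorem monotone_rademacherIter (hg : Monotone g) : Monotone (rademacherIter h r g) := by
  induction r with
  | zero => exact hg
  | succ r ih =>
    intro s t hst
    simp only [rademacherIter, rademacherAvg]
    have := ih (add_le_add_left hst h)
    have := ih (sub_le_sub_right hst h)
    linarith

theorem rademacherIter_const_mul (c : ℝ) (s : ℝ) :
    rademacherIter h r (fun s => c * g s) s = c * rademacherIter h r g s := by
  induction r generalizing s with
  | zero => rfl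
  | succ r ih =>
    simp only [rademacherIter, rademacherAvg, ih]
    ring

theorem rademacherIter_zero_step (s : ℝ) : rademacherIter 0 r g s = g s := by
  induction r generalizing s with
  | zero => rfl
  | succ r ih => simp [rademacherIter, rademacherAvg, ih]

theorem TaylorJet.rademacherIter (hg : TaylorJet g0 g1 g2 g3 K) (h : ℝ) (r : ℕ) :
    TaylorJet (rademacherIter h r g0) (rademacherIter h r g1) (rademacherIter h r g2)
      (rademacherIter h r g3) K := by
  induction r with
  | zero => exact hg
  | succ r ih =>
    have hc : ∀ g : ℝ → ℝ, Continuous g → Continuous (rademacherAvg h g) := fun g hg => by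
      unfold rademacherAvg; fun_prop
    have key : ∀ a b : ℝ, |a| ≤ K → |b| ≤ K → |(a + b) / 2| ≤ K := fun a b ha hb => by
      rw [abs_le] at *; constructor <;> linarith
    refine ⟨hc _ ih.cont0, hc _ ih.cont1, hc _ ih.cont2, hc _ ih.cont3, ?_, ?_, ?_, ?_⟩
    · intro s d hd
      convert key _ _ (ih.rem0 (s + h) d hd) (ih.rem0 (s - h) d hd) using 2
      simp only [_root_.rademacherIter, rademacherAvg]
      rw [show s + d + h = s + h + d by ring, show s + d - h = s - h + d by ring]
      ring
    · intro s d hd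
      convert key _ _ (ih.rem1 (s + h) d hd) (ih.rem1 (s - h) d hd) using 2
      simp only [_root_.rademacherIter, rademacherAvg]
      rw [show s + d + h = s + h + d by ring, show s + d - h = s - h + d by ring]
      ring
    · intro s d hd
      convert key _ _ (ih.rem2 (s + h) d hd) (ih.rem2 (s - h) d hd) using 2
      simp only [_root_.rademacherIter, rademacherAvg]
      rw [show s + d + h = s + h + d by ring, show s + d - h = s - h + d by ring]
      ring
    · intro s d hd
      convert key _ _ (ih.rem3 (s + h) d hd) (ih.rem3 (s - h) d hd) using 2
      simp only [_root_.rademacherIter, rademacherAvg]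
      rw [show s + d + h = s + h + d by ring, show s + d - h = s - h + d by ring]
      ring

/-- Jensen's inequality. It lets the averaged third derivative be controlled by the averaged second
one, as for the unaveraged hinge. -/
theorem rademacherIter_sq_le (s : ℝ) :
    rademacherIter h r g s ^ 2 ≤ rademacherIter h r (fun s => g s ^ 2) s := by
  induction r generalizing s with
  | zero => exact le_rfl
  | succ r ih =>
    simp only [rademacherIter, rademacherAvg]
    nlinarith [ih (s + h), ih (s - h),
      sq_nonneg (rademacherIter h r g (s + h) - rademacherIter h r g (s - h))]

theorem rademacherIter_quadratic (a b : ℝ) (s : ℝ) :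
    rademacherIter h r (fun s => a * s ^ 2 + b) s = a * (s ^ 2 + r * h ^ 2) + b := by
  induction r generalizing s with
  | zero => simp [rademacherIter]
  | succ r ih =>
    simp only [rademacherIter, rademacherAvg, ih]
    push_cast; ring

theorem rademacherIter_quartic_le {a : ℝ} (ha : 0 ≤ a) (b : ℝ) (s : ℝ) :
    rademacherIter h r (fun s => a * s ^ 4 + b) s
      ≤ a * (s ^ 4 + 6 * (r * h ^ 2) * s ^ 2 + 3 * (r * h ^ 2) ^ 2) + b := by
  induction r generalizing s with
  | zero => simp [rademacherIter]
  | succ r ih =>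
    simp only [rademacherIter, rademacherAvg]
    have h1 := ih (s + h)
    have h2 := ih (s - h)
    have e : a * (s ^ 4 + 6 * ((r + 1 : ℕ) * h ^ 2) * s ^ 2 + 3 * ((r + 1 : ℕ) * h ^ 2) ^ 2) + b
        - ((a * ((s + h) ^ 4 + 6 * (r * h ^ 2) * (s + h) ^ 2 + 3 * (r * h ^ 2) ^ 2) + b)
        + (a * ((s - h) ^ 4 + 6 * (r * h ^ 2) * (s - h) ^ 2 + 3 * (r * h ^ 2) ^ 2) + b)) / 2
        = a * (2 * h ^ 4) := by push_cast; ring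
    have : 0 ≤ a * (2 * h ^ 4) := by positivity
    linarith

theorem rademacherIter_exp_le (l c : ℝ) (hc : 0 ≤ c) (s : ℝ) :
    rademacherIter h r (fun s => c * Real.exp (l * s)) s
      ≤ c * Real.exp (r * (l * h) ^ 2 / 2 + l * s) := by
  induction r generalizing s with
  | zero => simp [rademacherIter]
  | succ r ih =>
    simp only [rademacherIter, rademacherAvg]
    have h1 := ih (s + h)
    have h2 := ih (s - h)
    have h3 := Real.cosh_le_exp_half_sq (l * h)
    rw [Real.cosh_eq] at h3
    set E := Real.exp (r * (l * h) ^ 2 / 2 + l * s) with hE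
    have e1 : Real.exp (r * (l * h) ^ 2 / 2 + l * (s + h)) = E * Real.exp (l * h) := by
      rw [hE, ← Real.exp_add]; ring_nf
    have e2 : Real.exp (r * (l * h) ^ 2 / 2 + l * (s - h)) = E * Real.exp (-(l * h)) := by
      rw [hE, ← Real.exp_add]; ring_nf
    have e3 : Real.exp ((r + 1 : ℕ) * (l * h) ^ 2 / 2 + l * s)
        = E * Real.exp ((l * h) ^ 2 / 2) := by
      rw [hE, ← Real.exp_add]; push_cast; ring_nf
    rw [e1] at h1
    rw [e2] at h2
    rw [e3]
    have hE0 : 0 ≤ c * E := mul_nonneg hc (Real.exp_pos _).le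
    have := mul_le_mul_of_nonneg_left h3 hE0
    linarith

/-- The positive part of `s - y`. -/
noncomputable def hinge (y s : ℝ) : ℝ := max (s - y) 0

theorem hinge_nonneg (y s : ℝ) : 0 ≤ hinge y s := le_max_right _ _

theorem monotone_hinge (y : ℝ) : Monotone (hinge y) := fun _ _ h =>
  max_le_max (sub_le_sub_right h y) le_rfl

theorem monotone_const_mul_hinge_pow (y : ℝ) {c : ℝ} (hc : 0 ≤ c) (n : ℕ) :
    Monotone fun s => c * hinge y s ^ n := fun _ _ h =>
  mul_le_mul_of_nonneg_left (pow_le_pow_left₀ (hinge_nonneg _ _) (monotone_hinge y h) n) hc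

theorem hinge_jet (y : ℝ) : TaylorJet (fun s => hinge y s ^ 4) (fun s => 4 * hinge y s ^ 3)
    (fun s => 12 * hinge y s ^ 2) (fun s => 24 * hinge y s) 24 := by
  have cp : Continuous (hinge y) := by unfold hinge; fun_prop
  have pw : ∀ (w : ℝ), |w| ≤ 1 → ∀ n : ℕ, -1 ≤ w ^ n ∧ w ^ n ≤ 1 := fun w hw n => by
    rw [← abs_le, abs_pow]; exact pow_le_one₀ (abs_nonneg _) hw
  -- Either the polynomial v ↦ v⁴ is seen at both ends, or the kink is crossed or both ends vanish;
  -- in these last cases the discrepancies are powers of quantities at most 1 in absolute value.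
  have key : ∀ s d : ℝ, |d| ≤ 1 → ∃ v : ℝ, (hinge y s = v ∧ hinge y (s + d) = v + d) ∨
      (hinge y s = v ∧ hinge y (s + d) = 0 ∧ 0 ≤ v ∧ v ≤ 1 ∧ |v + d| ≤ 1) ∨
      (hinge y s = 0 ∧ hinge y (s + d) = v ∧ |v| ≤ 1) := by
    intro s d hd
    have hd' := abs_le.1 hd
    have e : s + d - y = s - y + d := by ring
    rcases le_total 0 (s - y) with h1 | h1 <;> rcases le_total 0 (s - y + d) with h2 | h2
    · exact ⟨s - y, Or.inl ⟨max_eq_left h1, by rw [hinge, e]; exact max_eq_left h2⟩⟩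
    · refine ⟨s - y, Or.inr (Or.inl ⟨max_eq_left h1, by rw [hinge, e]; exact max_eq_right h2,
        h1, by linarith, ?_⟩)⟩
      rw [abs_le]; constructor <;> linarith
    · refine ⟨s - y + d, Or.inr (Or.inr ⟨max_eq_right h1,
        by rw [hinge, e]; exact max_eq_left h2, ?_⟩)⟩
      rw [abs_le]; constructor <;> linarith
    · refine ⟨0, Or.inr (Or.inr ⟨max_eq_right h1,
        by rw [hinge, e]; exact max_eq_right h2, by simp⟩)⟩
  refine ⟨by fun_prop, by fun_prop, by fun_prop, by fun_prop, ?_, ?_, ?_, ?_⟩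
  · intro s d hd
    have d4 := pw d hd 4
    obtain ⟨v, ⟨e1, e2⟩ | ⟨e1, e2, _, _, h3⟩ | ⟨e1, e2, h3⟩⟩ := key s d hd
    · rw [e1, e2, abs_le]; constructor <;> linarith
    · have w4 := pw _ h3 4
      rw [e1, e2, abs_le]; constructor <;> linarith
    · have w4 := pw _ h3 4
      rw [e1, e2, abs_le]; constructor <;> linarith
  · intro s d hd
    have d3 := pw d hd 3
    obtain ⟨v, ⟨e1, e2⟩ | ⟨e1, e2, _, _, h3⟩ | ⟨e1, e2, h3⟩⟩ := key s d hd
    · rw [e1, e2, abs_le]; constructor <;> linarith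
    · have w3 := pw _ h3 3
      rw [e1, e2, abs_le]; constructor <;> linarith
    · have w3 := pw _ h3 3
      rw [e1, e2, abs_le]; constructor <;> linarith
  · intro s d hd
    have d2 := pw d hd 2
    have d2' := sq_nonneg d
    obtain ⟨v, ⟨e1, e2⟩ | ⟨e1, e2, _, _, h3⟩ | ⟨e1, e2, h3⟩⟩ := key s d hd
    · rw [e1, e2, abs_le]; constructor <;> linarith
    · have w2 := pw _ h3 2
      have w2' := sq_nonneg (v + d)
      rw [e1, e2, abs_le]; constructor <;> linarith
    · have w2 := pw _ h3 2
      rw [e1, e2, abs_le]; constructor <;> linarith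
  · intro s d hd
    have d1 := abs_le.1 hd
    obtain ⟨v, ⟨e1, e2⟩ | ⟨e1, e2, _, _, h3⟩ | ⟨e1, e2, h3⟩⟩ := key s d hd
    · rw [e1, e2, abs_le]; constructor <;> linarith
    · rw [e1, e2, abs_le]; constructor <;> linarith
    · have w1 := abs_le.1 h3
      rw [e1, e2, abs_le]; constructor <;> linarith

/-- For v = s - y ≥ h, the average of (v ± h)⁴ is v⁴ + 6 h² v² + h⁴. For 0 ≤ v < h the truncation
loses (h - v)⁴/2, which the spare h⁴ covers. -/
theorem hinge_pow_four_add_le (y : ℝ) (hh : 0 ≤ h) (s : ℝ) :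
    hinge y s ^ 4 + h ^ 2 / 2 * (12 * hinge y s ^ 2)
      ≤ (hinge y (s + h) ^ 4 + hinge y (s - h) ^ 4) / 2 := by
  unfold hinge
  rw [show s + h - y = s - y + h by ring, show s - h - y = s - y - h by ring]
  set v := s - y
  rcases le_total 0 v with h1 | h1
  · rw [max_eq_left h1, max_eq_left (by linarith : 0 ≤ v + h)]
    rcases le_total 0 (v - h) with h2 | h2
    · rw [max_eq_left h2]
      nlinarith [pow_nonneg hh 4]
    · rw [max_eq_right h2]
      have : (h - v) ^ 4 ≤ h ^ 4 := pow_le_pow_left₀ (by linarith) (by linarith) 4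
      have := pow_nonneg hh 4
      linarith
  · rw [max_eq_right h1]
    have := pow_nonneg (le_max_right (v + h) 0) 4
    have := pow_nonneg (le_max_right (v - h) 0) 4
    norm_num
    linarith

theorem rademacherIter_succ_ge (y : ℝ) (hh : 0 ≤ h) (s : ℝ) :
    rademacherIter h r (fun s => hinge y s ^ 4) s
        + h ^ 2 / 2 * rademacherIter h r (fun s => 12 * hinge y s ^ 2) s
      ≤ rademacherIter h (r + 1) (fun s => hinge y s ^ 4) s := by
  induction r generalizing s with
  | zero => exact hinge_pow_four_add_le y hh s
  | succ r ih =>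
    have h1 := ih (s + h)
    have h2 := ih (s - h)
    rw [rademacherIter, rademacherIter, rademacherIter, rademacherAvg, rademacherAvg, rademacherAvg]
    linarith

theorem le_rademacherIter_hinge (y : ℝ) (hh : 0 ≤ h) (s : ℝ) :
    hinge y s ^ 4 ≤ rademacherIter h r (fun s => hinge y s ^ 4) s := by
  induction r with
  | zero => exact le_rfl
  | succ r ih =>
    refine ih.trans (le_trans (le_add_of_nonneg_right ?_) (rademacherIter_succ_ge y hh s))
    exact mul_nonneg (by positivity) (rademacherIter_nonneg (fun s => by positivity) s)

theorem hinge_le_abs {y : ℝ} (hy : 0 ≤ y) (s : ℝ) : hinge y s ≤ |s| :=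
  max_le (by linarith [le_abs_self s]) (abs_nonneg s)

section Bounds
variable {x y s : ℝ} (hx : 0 < x) (hy : 0 ≤ y) (hs : s ≤ 2 * x) (hr : r * h ^ 2 ≤ 2 * x ^ 2)
include hx hy hs hr

theorem rademacherIter_hinge_three_le :
    |rademacherIter h r (fun s => 4 * hinge y s ^ 3) s| ≤ 308 * x ^ 3 := by
  rw [abs_of_nonneg (rademacherIter_nonneg (fun s => by have := hinge_nonneg y s; positivity) s)]
  -- Only an upper bound on `s` is available, so monotonicity moves the point to 2x. There the cube
  -- is majorized by a quartic, whose Rademacher average has an explicit bound.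
  refine (monotone_rademacherIter (monotone_const_mul_hinge_pow y (by norm_num) 3) hs).trans ?_
  refine (rademacherIter_mono (f := fun s => 4 / x * s ^ 4 + 4 * x ^ 3) (fun s => ?_) _).trans
    ((rademacherIter_quartic_le (by positivity) _ _).trans ?_)
  · have h1 : hinge y s ^ 3 ≤ |s| ^ 3 := pow_le_pow_left₀ (hinge_nonneg y s) (hinge_le_abs hy s) 3
    have h2 : |s| ^ 3 ≤ (|s| ^ 4 + x ^ 4) / x := by
      rw [le_div_iff₀ hx]
      rcases le_total |s| x with h | h
      · have := pow_le_pow_left₀ (abs_nonneg s) h 3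
        nlinarith [pow_nonneg (abs_nonneg s) 4]
      · have := mul_le_mul_of_nonneg_left h (pow_nonneg (abs_nonneg s) 3)
        nlinarith [pow_nonneg hx.le 4]
    have h3 : |s| ^ 4 = s ^ 4 := by rw [← abs_pow]; exact abs_of_nonneg (by positivity)
    rw [h3] at h2
    calc 4 * hinge y s ^ 3 ≤ 4 * ((s ^ 4 + x ^ 4) / x) := by linarith
      _ = _ := by field_simp
  · have h0 : 0 ≤ r * h ^ 2 := by positivity
    set a := r * h ^ 2
    have h2 : 6 * a * (2 * x) ^ 2 ≤ 48 * x ^ 4 := by nlinarith [pow_nonneg hx.le 2]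
    have h3 : 3 * a ^ 2 ≤ 12 * x ^ 4 := by nlinarith [pow_nonneg hx.le 2]
    have h4 : (2 * x) ^ 4 + 6 * a * (2 * x) ^ 2 + 3 * a ^ 2 ≤ 76 * x ^ 4 := by nlinarith
    calc _ ≤ 4 / x * (76 * x ^ 4) + 4 * x ^ 3 := by gcongr
      _ = _ := by field_simp; norm_num

theorem rademacherIter_hinge_two_le :
    |rademacherIter h r (fun s => 12 * hinge y s ^ 2) s| ≤ 72 * x ^ 2 := by
  rw [abs_of_nonneg (rademacherIter_nonneg (fun s => by positivity) s)]
  refine (monotone_rademacherIter (monotone_const_mul_hinge_pow y (by norm_num) 2) hs).trans ?_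
  refine (rademacherIter_mono (f := fun s => 12 * s ^ 2 + 0) (fun s => ?_) _).trans
    ((rademacherIter_quadratic _ _ _).le.trans (by nlinarith))
  have := pow_le_pow_left₀ (hinge_nonneg y s) (hinge_le_abs hy s) 2
  rw [sq_abs] at this
  linarith

theorem rademacherIter_hinge_one_le :
    |rademacherIter h r (fun s => 24 * hinge y s) s| ≤ 168 * x := by
  rw [abs_of_nonneg (rademacherIter_nonneg (fun s => by have := hinge_nonneg y s; positivity) s)]
  have hm : Monotone fun s => 24 * hinge y s := by
    simpa using monotone_const_mul_hinge_pow y (c := 24) (by norm_num) 1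
  refine (monotone_rademacherIter hm hs).trans ?_
  refine (rademacherIter_mono (f := fun s => 24 / x * s ^ 2 + 24 * x) (fun s => ?_) _).trans
    ((rademacherIter_quadratic _ _ _).le.trans ?_)
  · have h1 := hinge_le_abs hy s
    have h2 : |s| ≤ (s ^ 2 + x ^ 2) / x := by
      rw [le_div_iff₀ hx, ← sq_abs]
      nlinarith [sq_nonneg (|s| - x), sq_nonneg (|s| + x)]
    calc 24 * hinge y s ≤ 24 * ((s ^ 2 + x ^ 2) / x) := by linarith
      _ = _ := by field_simp
  · have : (2 * x) ^ 2 + r * h ^ 2 ≤ 6 * x ^ 2 := by nlinarith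
    calc _ ≤ 24 / x * (6 * x ^ 2) + 24 * x := by gcongr
      _ = _ := by field_simp; norm_num

end Bounds

/-- Gaussian bound for the average of a truncated fourth power. -/
theorem rademacherIter_hinge_four_le (hh : 0 < h) (hr : 1 ≤ r) {y s : ℝ} (hsy : s < y) :
    rademacherIter h r (fun s => hinge y s ^ 4) s
      ≤ 24 * (r * h ^ 2 / (y - s)) ^ 4 * Real.exp (-((y - s) ^ 2 / (2 * (r * h ^ 2)))) := by
  have hr' : (0 : ℝ) < r := by exact_mod_cast hr
  have ha : 0 < r * h ^ 2 := by positivity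
  have hd : 0 < y - s := by linarith
  -- The Chernoff optimum for variance r h². The inequality u⁴/4! ≤ exp u gives the prefactor 24/l⁴.
  obtain ⟨l, hl⟩ : ∃ l : ℝ, l = (y - s) / (r * h ^ 2) := ⟨_, rfl⟩
  have hl0 : 0 < l := by rw [hl]; positivity
  have h1 : ∀ t, hinge y t ^ 4 ≤ 24 / l ^ 4 * Real.exp (-(l * y)) * Real.exp (l * t) := by
    intro t
    have e : 24 / l ^ 4 * Real.exp (-(l * y)) * Real.exp (l * t)
        = 24 / l ^ 4 * Real.exp (l * (t - y)) := by
      rw [mul_assoc, ← Real.exp_add]; ring_nf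
    rw [e, div_mul_eq_mul_div, le_div_iff₀ (by positivity), ← mul_pow]
    rcases le_total 0 (t - y) with h | h
    · rw [hinge, max_eq_left h]
      have := Real.pow_div_factorial_le_exp (l * (t - y)) (by positivity) 4
      rw [div_le_iff₀ (by positivity)] at this
      norm_num [Nat.factorial] at this
      rw [mul_comm (t - y) l]
      linarith
    · rw [hinge, max_eq_right h]
      norm_num
      positivity
  refine (rademacherIter_mono h1 s).trans ((rademacherIter_exp_le _ _ (by positivity) _).trans ?_)
  rw [mul_assoc, ← Real.exp_add]
  have e1 : 24 / l ^ 4 = 24 * (r * h ^ 2 / (y - s)) ^ 4 := by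
    rw [hl]; field_simp
  have e2 : -(l * y) + (r * (l * h) ^ 2 / 2 + l * s) = -((y - s) ^ 2 / (2 * (r * h ^ 2))) := by
    rw [hl]; field_simp; ring
  rw [e1, e2]

end Rademacher

/-! ### One Lindeberg replacement step under survival below `x` -/

section Maximal
variable {Ω : Type*} [mΩ : MeasurableSpace Ω] {μ : Measure Ω} [IsProbabilityMeasure μ]
  {X : ℤ → Ω → ℝ} {x : ℝ}

open Classical in
/-- Indicator of the event that `S_0, …, S_m` all stay below `x`. -/
noncomputable def belowIndicator (X : ℤ → Ω → ℝ) (x : ℝ) (m : ℕ) (ω : Ω) : ℝ :=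
  if ∀ j ≤ m, partialSum X j ω < x then 1 else 0

theorem belowIndicator_nonneg (m : ℕ) (ω : Ω) : 0 ≤ belowIndicator X x m ω := by
  unfold belowIndicator; split_ifs <;> norm_num

theorem belowIndicator_le_one (m : ℕ) (ω : Ω) : belowIndicator X x m ω ≤ 1 := by
  unfold belowIndicator; split_ifs <;> norm_num

theorem abs_belowIndicator_le (m : ℕ) (ω : Ω) : |belowIndicator X x m ω| ≤ 1 := by
  rw [abs_of_nonneg (belowIndicator_nonneg _ _)]; exact belowIndicator_le_one _ _

theorem belowIndicator_succ_le (m : ℕ) (ω : Ω) :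
    belowIndicator X x (m + 1) ω ≤ belowIndicator X x m ω := by
  unfold belowIndicator
  split_ifs with h1 h2
  · exact le_rfl
  · exact absurd (fun j hj => h1 j (by lia)) h2
  · norm_num
  · exact le_rfl

theorem measurable_belowIndicator (m : ℕ) :
    Measurable[past X m] (belowIndicator X x m) := by
  classical
  have hS : ∀ j ≤ m, Measurable[past X m] (partialSum X j) := fun j hj => by
    have h1 := measurable_sumUpTo (X := X) (j : ℤ)
    simp only [sumUpTo, Int.toNat_natCast] at h1
    exact h1.mono (past_mono (by exact_mod_cast hj)) le_rfl
  let _ := past X m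
  refine Measurable.ite ?_ measurable_const measurable_const
  have e : {ω | ∀ j ≤ m, partialSum X j ω < x} = ⋂ j : ℕ, ⋂ _ : j ≤ m,
      {ω | partialSum X j ω < x} := by ext; simp
  rw [e]
  exact MeasurableSet.iInter fun j => MeasurableSet.iInter fun hj =>
    measurableSet_lt (hS j hj) measurable_const

theorem BddStationary.essBdd_belowIndicator (H : BddStationary μ X) (m : ℕ) :
    EssBdd μ (belowIndicator X x m) :=
  ⟨(measurable_belowIndicator m).mono (past_le H.meas _) le_rfl, 1,
    Eventually.of_forall fun ω => abs_belowIndicator_le m ω⟩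

variable (H : BddStationary μ X)
include H

theorem essBdd_partialSum (n : ℕ) : EssBdd μ (partialSum X n) :=
  EssBdd.sum (Y := fun i : ℕ => X i) (Finset.Icc 1 n) fun _ _ => H.essBdd _

theorem abs_partialSum_add_sub_le :
    ∀ᵐ ω ∂μ, ∀ m d : ℕ, |partialSum X (m + d) ω - partialSum X m ω| ≤ d := by
  filter_upwards [H.bdd] with ω hω m d
  induction d with
  | zero => simp
  | succ d ih =>
    have e : partialSum X (m + (d + 1)) ω = partialSum X (m + d) ω + X ((m + d + 1 : ℕ) : ℤ) ω := by
      simp only [partialSum]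
      rw [← add_assoc, Finset.sum_Icc_succ_top (by lia)]
    have h1 := hω ((m + d + 1 : ℕ) : ℤ)
    rw [e]
    push_cast at h1 ⊢
    rw [abs_le] at *
    constructor <;> linarith [ih.1, ih.2, h1.1, h1.2]

theorem belowIndicator_eq_zero_or_sumUpTo_le (m d : ℕ) :
    ∀ᵐ ω ∂μ, ∀ z ≤ ((m + d : ℕ) : ℤ),
      belowIndicator X x m ω = 0 ∨ sumUpTo X z ω ≤ x + d := by
  filter_upwards [abs_partialSum_add_sub_le H] with ω hω z hz
  by_cases hB : ∀ j ≤ m, partialSum X j ω < x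
  · right
    simp only [sumUpTo]
    obtain h1 | h1 := le_total z.toNat m
    · have := hB _ h1
      have : (0 : ℝ) ≤ d := by positivity
      linarith
    · obtain ⟨e, he⟩ := Nat.exists_eq_add_of_le h1
      rw [he]
      have h2 := (abs_le.1 (hω m e)).2
      have h3 := hB m le_rfl
      have h4 : (e : ℝ) ≤ d := by exact_mod_cast (by lia : e ≤ d)
      linarith
  · left
    simp [belowIndicator, hB]

variable (hs : Summable (fun k : ℕ => ((k + 1 : ℕ) : ℝ) * theta μ X 4 4 (k + 1)))
include hs

theorem skewCoeff_mul_le {L : ℕ} (hL : 1 ≤ L) {K b p p2 : ℝ} (hK : 0 ≤ K) (hb0 : 0 ≤ b)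
    (hb1 : b ≤ 1) (hp2 : p ^ 2 ≤ p2) (hpK : |b * (24 * p)| ≤ K * L) :
    skewCoeff μ X L * (b * (24 * p)) ≤ longRunVar μ X / 2 * (b * (12 * p2))
      + (K + 24) * 10 ^ 27 * depConst (theta μ X 4 4) L := by
  have hv := longRunVar_nonneg H hs
  have hV := one_le_depConst (theta_nonneg (μ := μ) (X := X) 4 4) hs (Nat.cast_nonneg L)
  have hbsk := skewCoeff_bound H hs hL
  set κ := skewCoeff μ X L
  set v := longRunVar μ X
  set V := depConst (theta μ X 4 4) L
  rcases hbsk with h | h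
  · have h1 : 24 * κ * p ≤ 6 * v * p ^ 2 + 24 * 10 ^ 27 * V := by
      refine le_of_sq_le_sq ?_ (by positivity)
      have h2 := mul_le_mul_of_nonneg_right h (sq_nonneg p)
      nlinarith [sq_nonneg (6 * v * p ^ 2 - 24 * 10 ^ 27 * V)]
    have h3 := mul_le_mul_of_nonneg_left h1 hb0
    have h4 := mul_le_mul_of_nonneg_left hp2 (mul_nonneg hv hb0)
    have h5 : b * (24 * 10 ^ 27 * V) ≤ 24 * 10 ^ 27 * V :=
      mul_le_of_le_one_left (by positivity) hb1
    have h6 : 0 ≤ K * V := by positivity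
    nlinarith
  · have h1 : κ * (b * (24 * p)) ≤ |κ| * (K * L) :=
      (le_abs_self _).trans ((abs_mul _ _).le.trans
        (mul_le_mul_of_nonneg_left hpK (abs_nonneg _)))
    have h2 := mul_le_mul_of_nonneg_left h hK
    have h3 : 0 ≤ p2 := (sq_nonneg p).trans hp2
    have h4 : 0 ≤ v / 2 * (b * (12 * p2)) := by positivity
    nlinarith

/-- One increment of the sum is exchanged for one Rademacher step. Of the available σ² g'', one half
covers the true variance and the other absorbs the third cumulant. -/
theorem integral_below_mul_rademacherIter_le {L : ℕ} (hL : 1 ≤ L) (hxL : x ≤ 200 * L)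
    (hLx : 3 * L + 1 ≤ x) {y h : ℝ} (hy : 0 ≤ y) (hh : 0 ≤ h) (hv : h ^ 2 = 2 * longRunVar μ X)
    {r : ℕ} (hr : r * h ^ 2 ≤ 2 * x ^ 2) (m : ℕ) :
    ∫ ω, belowIndicator X x (m + 1) ω *
        rademacherIter h r (fun s => hinge y s ^ 4) (partialSum X (m + 1 + (3 * L + 1)) ω) ∂μ
      ≤ ∫ ω, belowIndicator X x (m + 1) ω *
          rademacherIter h (r + 1) (fun s => hinge y s ^ 4) (partialSum X (m + (3 * L + 1)) ω) ∂μ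
        + 10 ^ 37 * depConst (theta μ X 4 4) x := by
  have hL' : (1 : ℝ) ≤ L := by exact_mod_cast hL
  have hx : 0 < x := by linarith
  have h0 : ∀ k, 0 ≤ theta μ X 4 4 k := theta_nonneg 4 4
  have hV : depConst (theta μ X 4 4) L ≤ depConst (theta μ X 4 4) x :=
    depConst_mono h0 hs (by positivity) (by linarith)
  have hVL := one_le_depConst h0 hs (Nat.cast_nonneg L)
  set B := belowIndicator X x (m + 1)
  obtain ⟨k, hk⟩ : ∃ k : ℤ, k = ((m + 1 + (3 * L + 1) : ℕ) : ℤ) := ⟨_, rfl⟩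
  have ek : sumUpTo X k = partialSum X (m + 1 + (3 * L + 1)) := by
    rw [sumUpTo, hk, Int.toNat_natCast]
  have ek1 : sumUpTo X (k - 1) = partialSum X (m + (3 * L + 1)) := by
    rw [sumUpTo, hk]; congr 1; lia
  have eB : k - 3 * L - 1 = ((m + 1 : ℕ) : ℤ) := by rw [hk]; push_cast; ring
  -- Since x ≤ 200 L, the bound 308 x³ on the first derivative is at most 308·200³ L³ < 2500000000
  -- L³; the other derivatives need less.
  have hjet := ((hinge_jet y).rademacherIter h r).mono (K' := 2500000000) (by norm_num)
  have hlow : ∀ᵐ ω ∂μ, ∀ z ≤ k, B ω = 0 ∨ sumUpTo X z ω ≤ 2 * x := by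
    filter_upwards [belowIndicator_eq_zero_or_sumUpTo_le (x := x) H (m + 1) (3 * L + 1)]
      with ω hω z hz
    refine (hω z (hz.trans hk.le)).imp id fun h1 => ?_
    push_cast at h1
    linarith
  have hbound : ∀ (g : ℝ → ℝ) (D C : ℝ), (∀ s ≤ 2 * x, |g s| ≤ D) → D ≤ C → 0 ≤ C →
      ∀ z ≤ k, ∀ᵐ ω ∂μ, |B ω * g (sumUpTo X z ω)| ≤ C := by
    intro g D C hg hDC hC z hz
    filter_upwards [hlow] with ω hω
    rcases hω z hz with h1 | h1
    · simpa [h1] using hC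
    · exact mul_le_of_abs_le_one (abs_belowIndicator_le _ _) ((hg _ h1).trans hDC)
  have p3 : x ^ 3 ≤ (200 * L) ^ 3 := pow_le_pow_left₀ hx.le hxL 3
  have p2 : x ^ 2 ≤ (200 * L) ^ 2 := pow_le_pow_left₀ hx.le hxL 2
  have b1 := hbound _ _ (2500000000 * (L : ℝ) ^ 3)
    (fun s hs => rademacherIter_hinge_three_le hx hy hs hr) (by nlinarith) (by positivity)
  have b2 := hbound _ _ (2500000000 * (L : ℝ) ^ 2)
    (fun s hs => rademacherIter_hinge_two_le hx hy hs hr) (by nlinarith) (by positivity)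
  have b3 := hbound _ _ (2500000000 * (L : ℝ))
    (fun s hs => rademacherIter_hinge_one_le hx hy hs hr) (by nlinarith) (by positivity)
  have key := expansion_scaled H hs hL (by norm_num)
    (adaptedWalk_sumUpTo H (by rw [eB]; positivity))
    (by rw [eB]; exact measurable_belowIndicator (m + 1)) (abs_belowIndicator_le (m + 1)) hjet
    b1 b2 b3
  have hBe : EssBdd μ B := H.essBdd_belowIndicator _
  have hint : ∀ g : ℝ → ℝ, Continuous g → ∀ n,
      Integrable (fun ω => B ω * g (partialSum X n ω)) μ := fun g hg n =>
    (hBe.mul ((essBdd_partialSum H n).comp_continuous hg)).integrable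
  have hc := hjet.cont0
  have hc2 := hjet.cont2
  have hc3 := hjet.cont3
  have hcs : Continuous (rademacherIter h (r + 1) fun s => hinge y s ^ 4) :=
    ((hinge_jet y).rademacherIter h (r + 1)).cont0
  have b3' := b3 (k - 1) (by lia)
  rw [ek1] at b3'
  rw [ek, ek1] at key
  simp only [mul_sub] at key
  rw [integral_sub (hint _ hc _) (hint _ hc _)] at key
  have skew : skewCoeff μ X L * ∫ ω, B ω *
        rademacherIter h r (fun s => 24 * hinge y s) (partialSum X (m + (3 * L + 1)) ω) ∂μ
      ≤ longRunVar μ X / 2 * ∫ ω, B ω *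
        rademacherIter h r (fun s => 12 * hinge y s ^ 2) (partialSum X (m + (3 * L + 1)) ω) ∂μ
        + (2500000000 + 24) * 10 ^ 27 * depConst (theta μ X 4 4) L := by
    rw [← integral_const_mul, ← integral_const_mul]
    have e : (2500000000 + 24) * 10 ^ 27 * depConst (theta μ X 4 4) L
        = ∫ _, (2500000000 + 24) * 10 ^ 27 * depConst (theta μ X 4 4) L ∂μ := by simp
    rw [e, ← integral_add ((hint _ hc2 _).const_mul _) (integrable_const _)]
    refine integral_mono_ae ((hint _ hc3 _).const_mul _)
      (((hint _ hc2 _).const_mul _).add (integrable_const _)) ?_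
    filter_upwards [b3'] with ω hω
    rw [rademacherIter_const_mul] at hω
    simp only [rademacherIter_const_mul]
    exact skewCoeff_mul_le H hs hL (by norm_num) (belowIndicator_nonneg _ _)
      (belowIndicator_le_one _ _) (rademacherIter_sq_le _) hω
  have grow : ∫ ω, B ω * rademacherIter h r (fun s => hinge y s ^ 4)
          (partialSum X (m + (3 * L + 1)) ω) ∂μ
        + longRunVar μ X * ∫ ω, B ω *
          rademacherIter h r (fun s => 12 * hinge y s ^ 2) (partialSum X (m + (3 * L + 1)) ω) ∂μ
      ≤ ∫ ω, B ω * rademacherIter h (r + 1) (fun s => hinge y s ^ 4)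
          (partialSum X (m + (3 * L + 1)) ω) ∂μ := by
    rw [← integral_const_mul, ← integral_add (hint _ hc _) ((hint _ hc2 _).const_mul _)]
    refine integral_mono ((hint _ hc _).add ((hint _ hc2 _).const_mul _)) (hint _ hcs _)
      fun ω => ?_
    have h1 := mul_le_mul_of_nonneg_left
      (rademacherIter_succ_ge (r := r) y hh (partialSum X (m + (3 * L + 1)) ω))
      (belowIndicator_nonneg (X := X) (x := x) (m + 1) ω)
    rw [hv] at h1
    simp only [B]
    linarith
  have h1 := (abs_le.1 key).2
  linarith

end Maximal

/-! ### Summation over exit times and the tail bound -/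

section Maximal
variable {Ω : Type*} [mΩ : MeasurableSpace Ω] {μ : Measure Ω} [IsProbabilityMeasure μ]
  {X : ℤ → Ω → ℝ} {x : ℝ}

variable (H : BddStationary μ X)
  (hs : Summable (fun k : ℕ => ((k + 1 : ℕ) : ℝ) * theta μ X 4 4 (k + 1)))
include H

theorem integral_belowIndicator (n : ℕ) :
    ∫ ω, belowIndicator X x n ω ∂μ = 1 - μ.real {ω | x ≤ maxPartialSum X n ω} := by
  have hm : MeasurableSet {ω | x ≤ maxPartialSum X n ω} := by
    refine measurableSet_le measurable_const ?_
    have e : maxPartialSum X n = (Finset.range (n + 1)).sup' Finset.nonempty_range_add_one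
        (fun k => partialSum X k) := by
      ext ω; simp [maxPartialSum]
    rw [e]
    exact Finset.measurable_sup' _ fun k _ => (essBdd_partialSum H k).1
  have e : belowIndicator X x n = {ω | x ≤ maxPartialSum X n ω}ᶜ.indicator 1 := by
    ext ω
    have : ω ∈ {ω | x ≤ maxPartialSum X n ω}ᶜ ↔ ∀ j ≤ n, partialSum X j ω < x := by
      simp [maxPartialSum]
    by_cases hω : ∀ j ≤ n, partialSum X j ω < x
    · rw [Set.indicator_of_mem (this.2 hω)]; simp only [belowIndicator, if_pos hω, Pi.one_apply]
    · rw [Set.indicator_of_notMem (mt this.1 hω)]; simp only [belowIndicator, if_neg hω]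
  rw [e, integral_indicator_one hm.compl, probReal_compl_eq_one_sub hm]

include hs

theorem mul_measureReal_maxPartialSum_le {L : ℕ} (hL : 1 ≤ L) (hxL : x ≤ 200 * L)
    (hLx : 3 * L + 1 ≤ x) {y h : ℝ} (hy : 0 ≤ y) (hyx : y ≤ x - (3 * L + 1)) (hh : 0 ≤ h)
    (hv : h ^ 2 = 2 * longRunVar μ X) {n : ℕ} (hr : n * h ^ 2 ≤ 2 * x ^ 2) :
    (x - (3 * L + 1) - y) ^ 4 * μ.real {ω | x ≤ maxPartialSum X n ω}
      ≤ rademacherIter h n (fun s => hinge y s ^ 4) (3 * L + 1)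
        + n * (10 ^ 37 * depConst (theta μ X 4 4) x) := by
  set q := 3 * L + 1 with hq
  have hqr : (q : ℝ) = 3 * L + 1 := by rw [hq]; push_cast; ring
  rw [← hqr] at hyx ⊢
  set V := depConst (theta μ X 4 4) x
  set a := (x - q - y) ^ 4 with ha
  have hx : 0 < x := by
    have : (1 : ℝ) ≤ L := by exact_mod_cast hL
    linarith
  set W : ℕ → ℝ := fun m => ∫ ω, belowIndicator X x m ω *
    rademacherIter h (n - m) (fun s => hinge y s ^ 4) (partialSum X (m + q) ω) ∂μ
  set P : ℕ → ℝ := fun m => ∫ ω, belowIndicator X x m ω ∂μ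
  have hc : ∀ r, Continuous (rademacherIter h r fun s => hinge y s ^ 4) := fun r =>
    ((hinge_jet y).rademacherIter h r).cont0
  have hint : ∀ m r k, Integrable (fun ω => belowIndicator X x m ω *
      rademacherIter h r (fun s => hinge y s ^ 4) (partialSum X k ω)) μ := fun m r k =>
    ((H.essBdd_belowIndicator m).mul ((essBdd_partialSum H k).comp_continuous (hc r))).integrable
  have hintB : ∀ m, Integrable (belowIndicator X x m) μ := fun m =>
    (H.essBdd_belowIndicator m).integrable
  -- Each step exchanges an increment and then drops the mass exiting at time m + 1, on which the
  -- test function is at least `a`.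
  have step : ∀ m < n, W (m + 1) ≤ W m - a * (P m - P (m + 1)) + 10 ^ 37 * V := by
    intro m hm
    obtain ⟨r, hr'⟩ : ∃ r, n - m = r + 1 := ⟨n - m - 1, by lia⟩
    have hr'' : n - (m + 1) = r := by lia
    have h1 := integral_below_mul_rademacherIter_le H hs hL hxL hLx hy hh hv
      (r := r) (le_trans (mul_le_mul_of_nonneg_right (by exact_mod_cast (by lia : r ≤ n))
        (sq_nonneg h)) hr) m
    have h2 : a * (P m - P (m + 1)) ≤ W m - ∫ ω, belowIndicator X x (m + 1) ω *
        rademacherIter h (r + 1) (fun s => hinge y s ^ 4) (partialSum X (m + q) ω) ∂μ := by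
      simp only [P, W, hr']
      rw [← integral_sub (hintB _) (hintB _), ← integral_const_mul,
        ← integral_sub (hint _ _ _) (hint _ _ _)]
      refine integral_mono_ae (((hintB _).sub (hintB _)).const_mul _)
        ((hint _ _ _).sub (hint _ _ _)) ?_
      filter_upwards [abs_partialSum_add_sub_le H] with ω hω
      have hle := belowIndicator_succ_le (X := X) (x := x) m ω
      rw [← sub_mul]
      by_cases hS : x - q ≤ partialSum X (m + q) ω
      · rw [mul_comm]
        refine mul_le_mul_of_nonneg_left ?_ (sub_nonneg.2 hle)
        refine le_trans ?_ (le_rademacherIter_hinge y hh _)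
        refine pow_le_pow_left₀ (by linarith) ?_ 4
        exact le_max_of_le_left (by linarith)
      -- From time m + 1 to time m + q the sum moves by at most 3L, so exit at m + 1 is impossible
      -- here.
      · have heq : belowIndicator X x m ω = belowIndicator X x (m + 1) ω := by
          by_cases hB : ∀ j ≤ m, partialSum X j ω < x
          · have hB' : ∀ j ≤ m + 1, partialSum X j ω < x := by
              intro j hj
              rcases Nat.le_succ_iff.1 hj with h | h
              · exact hB j h
              · rw [h, Nat.succ_eq_add_one]
                have h3 := (abs_le.1 (hω (m + 1) (3 * L))).1
                rw [show m + 1 + 3 * L = m + q by lia] at h3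
                push_cast at h3
                push Not at hS
                linarith
            rw [belowIndicator, belowIndicator, if_pos hB, if_pos hB']
          · have hB' : ¬ ∀ j ≤ m + 1, partialSum X j ω < x := fun h => hB fun j hj => h j (by lia)
            rw [belowIndicator, belowIndicator, if_neg hB, if_neg hB']
        rw [heq]; simp
    simp only [W, hr''] at h2 ⊢
    linarith
  have total : ∀ m ≤ n, W m + a * (P 0 - P m) ≤ W 0 + m * (10 ^ 37 * V) := by
    intro m
    induction m with
    | zero => intro _; simp
    | succ m ih =>
      intro hm
      have h1 := ih (by lia)
      have h2 := step m (by lia)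
      push_cast
      linarith
  have hW : 0 ≤ W n := integral_nonneg fun ω => mul_nonneg (belowIndicator_nonneg _ _)
    (rademacherIter_nonneg (fun s => by positivity) _)
  have hP0 : P 0 = 1 := by
    have : belowIndicator X x 0 = fun _ => 1 := by
      ext ω; simp [belowIndicator, partialSum, hx]
    simp only [P, this]
    simp
  have hPn : P n = 1 - μ.real {ω | x ≤ maxPartialSum X n ω} := integral_belowIndicator H n
  have hW0 : W 0 ≤ rademacherIter h n (fun s => hinge y s ^ 4) q := by
    have e : rademacherIter h n (fun s => hinge y s ^ 4) q
        = ∫ _, rademacherIter h n (fun s => hinge y s ^ 4) q ∂μ := by simp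
    rw [e]
    refine integral_mono_ae (hint _ _ _) (integrable_const _) ?_
    filter_upwards [abs_partialSum_add_sub_le H] with ω hω
    have h1 := (abs_le.1 (hω 0 q)).2
    rw [show partialSum X 0 ω = 0 by simp [partialSum], sub_zero] at h1
    have hmono : Monotone (rademacherIter h n fun s => hinge y s ^ 4) :=
      monotone_rademacherIter (by
        simpa using monotone_const_mul_hinge_pow y (c := 1) (by norm_num) 4)
    exact (mul_le_of_le_one_left (rademacherIter_nonneg (fun s => by positivity) _)
      (belowIndicator_le_one _ _)).trans (hmono h1)
  have := total n le_rfl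
  rw [hP0, hPn] at this
  linarith

theorem measureReal_maxPartialSum_le_of_large (hx : 100 ≤ x) {n : ℕ} (hn : 1 ≤ n)
    (hnv : n * longRunVar μ X ≤ x ^ 2) :
    μ.real {ω | x ≤ maxPartialSum X n ω}
      ≤ 4 * 10 ^ 6 * (if 0 < longRunVar μ X then 1 else 0) * (n * longRunVar μ X / x ^ 2) ^ 4
          * Real.exp (-(x ^ 2 / (16 * n * longRunVar μ X)))
        + 10 ^ 40 * (n / x ^ 4) * depConst (theta μ X 4 4) x := by
  have hx0 : 0 < x := by linarith
  have hn' : (0 : ℝ) < n := by exact_mod_cast hn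
  have hv := longRunVar_nonneg H hs
  have hV := one_le_depConst (theta_nonneg (μ := μ) (X := X) 4 4) hs hx0.le
  obtain ⟨L, hL⟩ : ∃ L : ℕ, L = ⌊x / 100⌋₊ := ⟨_, rfl⟩
  have hL1 : 1 ≤ L := by
    rw [hL]; exact Nat.le_floor (by rw [le_div_iff₀ (by norm_num)]; push_cast; linarith)
  have hL1' : (1 : ℝ) ≤ L := by exact_mod_cast hL1
  have hLle : (L : ℝ) ≤ x / 100 := by rw [hL]; exact Nat.floor_le (by positivity)
  have hlt : x / 100 < L + 1 := by rw [hL]; exact Nat.lt_floor_add_one _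
  set v := longRunVar μ X with hvdef
  set V := depConst (theta μ X 4 4) x
  have hh : Real.sqrt (2 * v) ^ 2 = 2 * v := Real.sq_sqrt (by positivity)
  -- With y = 3x/4 and L = ⌊x/100⌋, both margins are of order x: x - (3L + 1) - y ≥ x/5 and y - (3L
  -- + 1) ≥ x/2. The Rademacher sum has variance 2nσ², so the exponent is at least (x/2)²/(4nσ²) =
  -- x²/(16nσ²).
  have key := mul_measureReal_maxPartialSum_le H hs (x := x) (y := 3 * x / 4)
    (h := Real.sqrt (2 * v)) hL1 (by linarith) (by linarith) (by positivity) (by linarith)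
    (Real.sqrt_nonneg _) hh (n := n) (by rw [hh]; linarith)
  set p := μ.real {ω | x ≤ maxPartialSum X n ω}
  have ha : (x / 5) ^ 4 ≤ (x - (3 * L + 1) - 3 * x / 4) ^ 4 :=
    pow_le_pow_left₀ (by positivity) (by linarith) 4
  have hp : (x / 5) ^ 4 * p ≤ _ :=
    (mul_le_mul_of_nonneg_right ha measureReal_nonneg).trans key
  have hfin : ∀ A : ℝ, rademacherIter (Real.sqrt (2 * v)) n (fun s => hinge (3 * x / 4) s ^ 4)
      (3 * L + 1) ≤ A → p ≤ 625 * A / x ^ 4 + 10 ^ 40 * (n / x ^ 4) * V := by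
    intro A hA
    have h1 : (x / 5) ^ 4 * p ≤ A + n * (10 ^ 37 * V) := by linarith
    have e : 625 * A / x ^ 4 + 10 ^ 40 * (n / x ^ 4) * V
        = (625 * A + 10 ^ 40 * n * V) / x ^ 4 := by ring
    rw [e, le_div_iff₀ (by positivity)]
    have : 0 ≤ n * V := by positivity
    nlinarith
  rcases hv.eq_or_lt with h0 | hpos
  · rw [if_neg (by rw [← h0]; exact lt_irrefl _)]
    have := hfin 0 (by
      rw [← h0, mul_zero, Real.sqrt_zero, rademacherIter_zero_step, hinge, max_eq_right
        (by linarith)]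
      norm_num)
    simpa using this
  · rw [if_pos hpos]
    have h1 := rademacherIter_hinge_four_le (h := Real.sqrt (2 * v)) (r := n) (by positivity) hn
      (y := 3 * x / 4) (s := 3 * L + 1) (by linarith)
    rw [hh] at h1
    set d := 3 * x / 4 - (3 * L + 1 : ℝ)
    have hd : x / 2 ≤ d := by simp only [d]; linarith
    have hd0 : 0 < d := by linarith
    have h2 : n * (2 * v) / d ≤ 4 * (n * v) / x := by
      rw [div_le_div_iff₀ hd0 hx0]
      have : 0 ≤ n * v := by positivity
      nlinarith
    have h3 : Real.exp (-(d ^ 2 / (2 * (n * (2 * v))))) ≤ Real.exp (-(x ^ 2 / (16 * n * v))) := by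
      refine Real.exp_le_exp.2 (neg_le_neg ?_)
      rw [div_le_div_iff₀ (by positivity) (by positivity)]
      have h4 : x ^ 2 ≤ 4 * d ^ 2 := by nlinarith
      have : 0 ≤ n * v := by positivity
      nlinarith
    have h4 := hfin _ (h1.trans (mul_le_mul (mul_le_mul_of_nonneg_left
      (pow_le_pow_left₀ (by positivity) h2 4) (by norm_num)) h3 (by positivity) (by positivity)))
    refine h4.trans (add_le_add ?_ le_rfl)
    -- 5⁴·24·4⁴ = 3840000, whence the constant 4·10⁶.
    have e : 625 * (24 * (4 * (n * v) / x) ^ 4 * Real.exp (-(x ^ 2 / (16 * n * v)))) / x ^ 4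
        = 3840000 * ((n * v / x ^ 2) ^ 4 * Real.exp (-(x ^ 2 / (16 * n * v)))) := by
      field_simp; norm_num
    have : 0 ≤ (n * v / x ^ 2) ^ 4 * Real.exp (-(x ^ 2 / (16 * n * v))) := by positivity
    rw [e, mul_one]
    linarith

theorem measureReal_maxPartialSum_le (hx : 0 < x) {n : ℕ} (hn : 1 ≤ n) :
    μ.real {ω | x ≤ maxPartialSum X n ω}
      ≤ 4 * 10 ^ 6 * (if 0 < longRunVar μ X then 1 else 0) * (n * longRunVar μ X / x ^ 2) ^ 4
          * Real.exp (-(x ^ 2 / (16 * n * longRunVar μ X)))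
        + 10 ^ 40 * (n / x ^ 4) * depConst (theta μ X 4 4) x := by
  have hn' : (1 : ℝ) ≤ n := by exact_mod_cast hn
  have hV := one_le_depConst (theta_nonneg (μ := μ) (X := X) 4 4) hs hx.le
  have hp : μ.real {ω | x ≤ maxPartialSum X n ω} ≤ 1 := measureReal_le_one
  have hfirst : 0 ≤ 4 * 10 ^ 6 * (if 0 < longRunVar μ X then (1 : ℝ) else 0)
      * (n * longRunVar μ X / x ^ 2) ^ 4 * Real.exp (-(x ^ 2 / (16 * n * longRunVar μ X))) := by
    split_ifs <;> positivity
  have hsecond : 0 ≤ 10 ^ 40 * (n / x ^ 4) * depConst (theta μ X 4 4) x := by positivity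
  -- Outside the range of the main estimate the bound exceeds 1: for x < 100 through the second
  -- term, for x² < nσ² through the first.
  rcases lt_or_ge x 100 with h | h
  · refine hp.trans (le_trans ?_ (le_add_of_nonneg_left hfirst))
    have h1 : x ^ 4 ≤ 100 ^ 4 := pow_le_pow_left₀ hx.le h.le 4
    have h2 : 1 ≤ 10 ^ 40 * (n / x ^ 4) := by
      rw [mul_div_assoc', le_div_iff₀ (by positivity)]; linarith
    exact one_le_mul_of_one_le_of_one_le h2 hV
  · rcases lt_or_ge (x ^ 2) (n * longRunVar μ X) with h2 | h2
    · refine hp.trans (le_trans ?_ (le_add_of_nonneg_right hsecond))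
      have hv : 0 < longRunVar μ X := pos_of_mul_pos_right ((sq_nonneg x).trans_lt h2) (by positivity)
      rw [if_pos hv]
      have h3 : 1 ≤ (n * longRunVar μ X / x ^ 2) ^ 4 :=
        one_le_pow₀ (by rw [one_le_div (by positivity)]; exact h2.le)
      have h4 : Real.exp (-1) ≤ Real.exp (-(x ^ 2 / (16 * n * longRunVar μ X))) := by
        refine Real.exp_le_exp.2 (neg_le_neg ?_)
        rw [div_le_one (by positivity)]
        nlinarith [sq_nonneg x]
      have h5 := Real.exp_neg_one_gt_d9
      have h6 : 1 / 4 ≤ Real.exp (-(x ^ 2 / (16 * n * longRunVar μ X))) := by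
        refine le_trans ?_ h4; linarith
      nlinarith
    · exact measureReal_maxPartialSum_le_of_large H hs h hn h2

end Maximal

/-! ### Reduction to time 0 and conclusion -/

theorem BddStationary.of_zero {Ω : Type*} [MeasurableSpace Ω] {μ : Measure Ω} {X : ℤ → Ω → ℝ}
    (hm : ∀ i, Measurable (X i)) (hstat : IsStrictlyStationary μ X)
    (hmean : ∫ ω, X 0 ω ∂μ = 0) (hbdd : ∀ᵐ ω ∂μ, |X 0 ω| ≤ 1) : BddStationary μ X := by
  have hid : ∀ i, IdentDistrib (X i) (X 0) μ μ := fun i => by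
    simpa [Function.comp_def] using
      (hstat i).comp (u := fun f : ℤ → ℝ => f 0) (measurable_pi_apply 0)
  refine ⟨hm, hstat, fun i => ((hid i).integral_eq).trans hmean, ae_all_iff.2 fun i => ?_⟩
  exact (hid i).symm.ae_snd (p := fun t : ℝ => |t| ≤ 1)
    (measurableSet_le measurable_norm measurable_const) hbdd

theorem theorem2p1 :
    ∃ c₁ c₂ : ℝ, 0 < c₁ ∧ 0 < c₂ ∧
      ∀ (Ω : Type*) [MeasurableSpace Ω] (μ : Measure Ω) [IsProbabilityMeasure μ]
        (X : ℤ → Ω → ℝ),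
        (∀ i, Measurable (X i)) →
        IsStrictlyStationary μ X →
        ∫ ω, X 0 ω ∂μ = 0 →
        eLpNorm (X 0) ∞ μ = 1 →
        Summable (fun k : ℕ => ((k + 1 : ℕ) : ℝ) * theta μ X 4 4 (k + 1)) →
        ∃ σ2 : ℝ, 0 ≤ σ2 ∧
          Tendsto
            (fun N : ℕ =>
              (∫ ω, X 0 ω ^ 2 ∂μ)
                + 2 * ∑ k ∈ Finset.Icc 1 N, (∫ ω, X 0 ω * X (k : ℤ) ω ∂μ))
            atTop (𝓝 σ2) ∧
          ∀ (x : ℝ) (n : ℕ), 0 < x → 1 ≤ n →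
            μ.real {ω | x ≤ maxPartialSum X n ω} ≤
              c₁ * (if 0 < σ2 then 1 else 0) * (n * σ2 / x ^ 2) ^ 4
                  * Real.exp (-(x ^ 2 / (16 * n * σ2)))
                + c₂ * (n / x ^ 4) *
                  ((1 + ∑' k : ℕ, theta μ X 4 4 (k + 1))
                      * (1 + ∑' k : ℕ, ((k + 1 : ℕ) : ℝ) * theta μ X 4 4 (k + 1))
                    + ∑' k : ℕ, ((k + 1 : ℕ) : ℝ) * min ((k + 1 : ℕ) : ℝ) x
                        * theta μ X 4 4 (k + 1)) := by
  refine ⟨4 * 10 ^ 6, 10 ^ 40, by norm_num, by norm_num, ?_⟩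
  intro Ω _ μ _ X hm hstat hmean hsup hs
  have H : BddStationary μ X := BddStationary.of_zero hm hstat hmean <| by
    rw [eLpNorm_exponent_top] at hsup
    filter_upwards [ae_le_eLpNormEssSup (f := X 0) (μ := μ)] with ω hω
    rw [hsup, ← ofReal_norm, ENNReal.ofReal_le_one] at hω
    exact hω
  refine ⟨longRunVar μ X, longRunVar_nonneg H hs, ?_, fun x n hx hn =>
    measureReal_maxPartialSum_le H hs hx hn⟩
  have h := tendsto_longRunVar H hs
  simp only [acov] at h
  simpa only [sum_Icc_one_eq_range H (fun k : ℕ => ∫ ω, X 0 ω * X (k : ℤ) ω ∂μ), pow_two,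
    Nat.cast_add, Nat.cast_one, Nat.cast_zero] using h
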